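/- Let $q$ range over the odd prime powers and let $\mathbf{F}_q$ be the field with $q$ elements. For a non-degenerate hermitian form on $\mathbf{F}_{q^2}^n$ (with respect to $x\mapsto \bar x=x^q$) with Gram matrix $\beta$, so $\beta$ is invertible and ${}^t\bar\beta=\beta$, let $U_n(\mathbf{F}_q)=\{g\in GL_n(\mathbf{F}_{q^2}) \mid {}^tg\,\beta\,\bar g=\beta\}$; the statements below hold for every choice of $\beta$. Let $Sp_2(\mathbf{F}_q)=\{g \in GL_2(\mathbf{F}_q)\mid gJ\,{}^tg=J\}$ with $J=\begin{pmatrix}0&-1\\1&0\end{pmatrix}$. For a finite group $G$ and $k\ge 0$, the number of simultaneous conjugacy classes of commuting $k$-tuples in $G$ is the number of orbits of $G$, acting by simultaneous conjugation, on the set of $k$-tuples $(g_1,\dots,g_k)\in G^k$ with $g_ig_j=g_jg_i$ for all $i,j$. Denote it by $c_g(2,k,q)$ for $G=GL_2(\mathbf{F}_q)$, by $c_u(n,k,q)$ for $G=U_n(\mathbf{F}_q)$, and by $c_s(2,k,q)$ for $G=Sp_2(\mathbf{F}_q)$. (1) For integers $j$ and indeterminates $x,m,p$ put $$S_j(x,m,p)=\sum_{\substack{a,b,c,d\ge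 0\\ a+b+c+d=j}} m^a\, m^{2b}\,(xm)^c\,(pm)^d$$ (so $S_j=0$ for $j<0$), and $$\Phi_k(x,m,p)=S_k-2xm\,S_{k-1}+(xm)^2\,S_{k-2}-m^3\,S_{k-3}.$$ Then for every $k\ge 0$ and every odd prime power $q$, $$c_g(2,k,q)=\Phi_k(q,\,q-1,\,q+1),\qquad c_u(2,k,q)=\Phi_k(q,\,q+1,\,q-1).$$ That is, $c_u(2,k,q)$ is obtained from this formula for $c_g(2,k,q)$ by swapping the factors $q-1$ with the factors $q+1$. (2) For each $k\le 20$ there are polynomials $P_k,Q_k,R_k$ with non-negative integer coefficients such that $c_u(2,k,q)=P_k(q)$, $c_u(3,k,q)=Q_k(q)$ and $c_s(2,k,q)=R_k(q)$ for all odd prime powers $q$. -/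

import Mathlib

open scoped Matrix

universe u v

/-- The `k`-tuples of pairwise commuting elements of a group `G`. -/
def CommutingTuple (G : Type*) [Group G] (k : ℕ) : Type _ :=
  {g : Fin k → G // ∀ i j, g i * g j = g j * g i}

/-- Two commuting `k`-tuples are simultaneously conjugate if one element `x` of `G` conjugates
every entry of the first into the corresponding entry of the second. -/
def simConj (G : Type*) [Group G] (k : ℕ) : Setoid (CommutingTuple G k) where
  r g h := ∃ x : G, ∀ i, x * g.1 i * x⁻¹ = h.1 i
  iseqv :=
    { refl := fun g => ⟨1, fun i => by simp⟩
      symm := by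
        rintro g h ⟨x, hx⟩
        exact ⟨x⁻¹, fun i => by rw [← hx i]; group⟩
      trans := by
        rintro f g h ⟨x, hx⟩ ⟨y, hy⟩
        exact ⟨y * x, fun i => by rw [← hy i, ← hx i]; group⟩ }

/-- The number `c_G(k)` of simultaneous conjugacy classes of commuting `k`-tuples in `G`. -/
noncomputable def numSimConjClasses (G : Type*) [Group G] (k : ℕ) : ℕ :=
  Nat.card (Quotient (simConj G k))

section Unitary

variable (F : Type*) [Field F] [Fintype F] {E : Type*} [Field E] [Algebra F E]
variable {n : Type*}

/-- `matBar F M` raises every entry of a matrix `M` over `E` to the power `q = #F`. -/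
noncomputable def matBar (M : Matrix n n E) : Matrix n n E :=
  M.map (fun x => x ^ Fintype.card F)

theorem matBar_mul [Fintype n] (M N : Matrix n n E) : matBar F (M * N) = matBar F M * matBar F N :=
  Matrix.map_mul (f := (FiniteField.frobeniusAlgHom F E))

theorem matBar_one [DecidableEq n] : matBar F (1 : Matrix n n E) = 1 :=
  Matrix.map_one (FiniteField.frobeniusAlgHom F E) (map_zero _) (map_one _)

/-- `β` is the Gram matrix of a non-degenerate hermitian form on `E ^ n`, with respect to the
involution `x ↦ x ^ q` of the quadratic extension `E` of the field `F` with `q` elements. -/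
def IsNondegHermitian [Fintype n] [DecidableEq n] (β : Matrix n n E) : Prop :=
  matBar F βᵀ = β ∧ IsUnit β.det

/-- The unitary group of the hermitian form with Gram matrix `β`:
all `g` in `GL_n(E)` with `ᵗg β ḡ = β`. -/
noncomputable def hermitianUnitaryGroup [Fintype n] [DecidableEq n] (β : Matrix n n E) :
    Subgroup (GL n E) where
  carrier := {g | (g : Matrix n n E)ᵀ * β * matBar F (g : Matrix n n E) = β}
  one_mem' := by simp [matBar_one]
  mul_mem' := by
    intro g h hg hh
    simp only [Set.mem_ofPred_eq] at hg hh ⊢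
    rw [Units.val_mul, Matrix.transpose_mul, matBar_mul]
    calc _ = (h : Matrix n n E)ᵀ * ((g : Matrix n n E)ᵀ * β * matBar F (g : Matrix n n E))
            * matBar F (h : Matrix n n E) := by simp only [mul_assoc]
      _ = β := by rw [hg, hh]
  inv_mem' := by
    intro g hg
    simp only [Set.mem_ofPred_eq] at hg ⊢
    have h1 : ((g⁻¹ : GL n E) : Matrix n n E)ᵀ * (g : Matrix n n E)ᵀ = 1 := by
      rw [← Matrix.transpose_mul, Units.mul_inv, Matrix.transpose_one]
    have h2 : matBar F (g : Matrix n n E) * matBar F ((g⁻¹ : GL n E) : Matrix n n E) = 1 := by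
      rw [← matBar_mul, Units.mul_inv, matBar_one]
    calc ((g⁻¹ : GL n E) : Matrix n n E)ᵀ * β * matBar F ((g⁻¹ : GL n E) : Matrix n n E)
        = ((g⁻¹ : GL n E) : Matrix n n E)ᵀ *
            ((g : Matrix n n E)ᵀ * β * matBar F (g : Matrix n n E)) *
            matBar F ((g⁻¹ : GL n E) : Matrix n n E) := by rw [hg]
      _ = (((g⁻¹ : GL n E) : Matrix n n E)ᵀ * (g : Matrix n n E)ᵀ) * β *
            (matBar F (g : Matrix n n E) * matBar F ((g⁻¹ : GL n E) : Matrix n n E)) := by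
          simp only [mul_assoc]
      _ = β := by rw [h1, h2, one_mul, mul_one]

end Unitary

/-- The sum over all `(a, b, c, d)` in `ℕ⁴` with `a + b + c + d = k - i` of
`m ^ a * m ^ (2 b) * (q m) ^ c * (p m) ^ d`; it is empty if `k < i`. -/
def gl2Sum (k i : ℕ) (q m p : ℤ) : ℤ :=
  if i ≤ k then
    ∑ v ∈ Finset.Nat.antidiagonalTuple 4 (k - i),
      m ^ v 0 * m ^ (2 * v 1) * (q * m) ^ v 2 * (p * m) ^ v 3
  else 0

/-- The formula for the number of simultaneous conjugacy classes of commuting `k`-tuples in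
`GL_2` over the field with `q` elements, with `m` written for every factor `q - 1` and `p` for
every factor `q + 1`. -/
def gl2Formula (k : ℕ) (q m p : ℤ) : ℤ :=
  gl2Sum k 0 q m p - 2 * (q * m) * gl2Sum k 1 q m p
    + (q * m) ^ 2 * gl2Sum k 2 q m p - m ^ 3 * gl2Sum k 3 q m p

/-! By Burnside's lemma the number of classes of commuting `k`-tuples times `|G|` is the number of
commuting `(k+1)`-tuples (`numSimConjClasses_mul_card`). Everything therefore reduces to closed
forms, in `q` and `k`, for numbers of commuting tuples.

Two by two matrices over `F` (`two_mul_numComm_det`). As 2 is invertible, a matrix is a scalar plus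
a traceless part, and two matrices commute exactly when their traceless parts are proportional. A
non-scalar commuting tuple thus lies in `F[P]` for a traceless `P ≠ 0`, unique up to `F^×`. Since
`P² = -det P`, the algebra `F[P]` is `F[ε]`, `F × F` or the quadratic field, and it remains to count
each kind of `P`. Determinant nonzero gives `GL₂`, determinant one gives `Sp₂`.

`U₂` (`numComm_isom_of_finrank_two`). In a suitable hyperbolic basis the isometries are the matrices
`a G` with `G` in `GL₂(F)` and `N(a) det G = 1`. Being proportional over `E` entry by entry matches
commuting tuples of `U₂` with commuting tuples of `GL₂(F)`, with fibres of sizes `(q-1)^k` and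
`(q+1)^k`. This is the source of the symmetry between `q-1` and `q+1`.

`U₃` (`numComm_eq_add`). A commuting tuple is of exactly one of three types. Irreducible: there is
no common eigenvector. Some entry then has no eigenvector, its centralizer is a field with `q^6`
elements on which the adjoint is an involution, and the commuting isometries are the `q^3+1`
elements of norm one (`ncard_irredTuples`). Unipotent up to scalars: the tuple lies in norm one
scalars times the Heisenberg group of an isotropic line, where commuting means that the first
coordinates are proportional over `F` (`ncard_unipTuples`). Split: a full common eigenspace is an
anisotropic line. These tuples are counted through the unit vectors of such lines and the characters
of tuples on the orthogonal plane (`ncard_splitTuples`). The number of isometries without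
eigenvectors is found by comparing the case `k = 1` with the order of `U₃`.

For (1), the sums `S_j` are complete homogeneous symmetric functions. The bialternant formula turns
`Φ_k` into a combination of four `k`-th powers (`mul_gl2Formula`), which is compared with the count.
For (2), the closed form must be divided by the group order. At the large integer `B = 2^200` the
base-`B` digits of the quotient serve as candidate coefficients. A polynomial vanishing at an
integer larger than the sum of the absolute values of its coefficients is zero, so one evaluation
certifies the division (`exists_polynomial_of_divides`). -/

set_option linter.unusedSectionVars false

/-! ### Counting commuting tuples -/

/-- The `k`-tuples of pairwise commuting elements of a subset `S` of a monoid. -/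
def commTuples {M : Type*} [Mul M] (S : Set M) (k : ℕ) : Set (Fin k → M) :=
  {t | (∀ i, t i ∈ S) ∧ ∀ i j, t i * t j = t j * t i}

/-- The number of `k`-tuples of pairwise commuting elements of `S`. -/
noncomputable def numComm {M : Type*} [Mul M] (S : Set M) (k : ℕ) : ℕ := (commTuples S k).ncard

/-- Double counting along a relation with constant fibre sizes. -/
theorem ncard_mul_eq_ncard_mul {α β : Type*} [Finite α] [Finite β] {A : Set α} {B : Set β}
    (r : α → β → Prop) {m n : ℕ} (hA : ∀ a ∈ A, {b | b ∈ B ∧ r a b}.ncard = m)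
    (hB : ∀ b ∈ B, {a | a ∈ A ∧ r a b}.ncard = n) : A.ncard * m = B.ncard * n := by
  classical
  have := Fintype.ofFinite α
  have := Fintype.ofFinite β
  rw [Set.ncard_eq_toFinset_card', Set.ncard_eq_toFinset_card']
  refine Finset.card_mul_eq_card_mul r (fun a ha => ?_) (fun b hb => ?_)
  · rw [← hA a (by simpa using ha), Set.ncard_eq_toFinset_card']
    congr 1; ext b; simp [Finset.bipartiteAbove]
  · rw [← hB b (by simpa using hb), Set.ncard_eq_toFinset_card']
    congr 1; ext b; simp [Finset.bipartiteBelow]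

/-- The size of a set fibred over `A` with fibres of constant size. -/
theorem ncard_eq_mul_of_fibers {α β : Type*} [Finite α] [Finite β] {A : Set α} {B : Set β}
    (f : β → α) {m : ℕ} (hf : ∀ b ∈ B, f b ∈ A)
    (hA : ∀ a ∈ A, {b | b ∈ B ∧ f b = a}.ncard = m) : B.ncard = A.ncard * m := by
  rw [← mul_one B.ncard]
  refine (ncard_mul_eq_ncard_mul (fun a b => f b = a) hA fun b hb => ?_).symm
  have : {a | a ∈ A ∧ f b = a} = {f b} := by
    ext a; simp only [Set.mem_ofPred_eq, Set.mem_singleton_iff]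
    exact ⟨fun h => h.2.symm, fun h => ⟨h ▸ hf b hb, h.symm⟩⟩
  rw [this, Set.ncard_singleton]

theorem ncard_pi_const {α : Type*} (S : Set α) (k : ℕ) :
    {t : Fin k → α | ∀ i, t i ∈ S}.ncard = S.ncard ^ k := by
  rw [← Nat.card_coe_set_eq, ← Nat.card_coe_set_eq]
  have e : {t : Fin k → α | ∀ i, t i ∈ S} ≃ (Fin k → S) := Equiv.subtypePiEquivPi
  rw [Nat.card_congr e, Nat.card_fun, Nat.card_fin]

theorem numComm_of_commute {M : Type*} [Mul M] {S : Set M}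
    (hS : ∀ a ∈ S, ∀ b ∈ S, a * b = b * a) (k : ℕ) : numComm S k = S.ncard ^ k := by
  rw [← ncard_pi_const, numComm]
  congr 1; ext t
  exact ⟨fun h => h.1, fun h => ⟨h, fun i j => hS _ (h i) _ (h j)⟩⟩

theorem numComm_one {M : Type*} [Mul M] (S : Set M) : numComm S 1 = S.ncard := by
  rw [← pow_one S.ncard, ← ncard_pi_const, numComm]
  congr 1; ext t
  exact ⟨fun h => h.1, fun h => ⟨h, fun i j => by rw [Subsingleton.elim i j]⟩⟩

theorem numComm_image {M N : Type*} [Monoid M] [Monoid N] (φ : M →* N)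
    (hφ : Function.Injective φ) (S : Set M) (k : ℕ) : numComm (φ '' S) k = numComm S k := by
  rw [numComm, numComm, ← Set.ncard_image_of_injective (commTuples S k) (hφ.comp_left (α := Fin k))]
  congr 1; ext t
  constructor
  · rintro ⟨h1, h2⟩
    choose s hs hst using h1
    refine ⟨s, ⟨hs, fun i j => hφ ?_⟩, funext hst⟩
    simp only [map_mul, hst, h2 i j]
  · rintro ⟨s, ⟨h1, h2⟩, rfl⟩
    refine ⟨fun i => ⟨s i, h1 i, rfl⟩, fun i j => ?_⟩
    simp only [Function.comp, ← map_mul, h2 i j]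

/-! ### Burnside's lemma -/

/-- Simultaneous conjugation on commuting tuples. -/
instance conjTupleAction (G : Type*) [Group G] (k : ℕ) : MulAction G (CommutingTuple G k) where
  smul x g := ⟨fun i => x * g.1 i * x⁻¹, fun i j => by
    have := g.2 i j
    calc _ = x * (g.1 i * g.1 j) * x⁻¹ := by group
      _ = _ := by rw [this]; group⟩
  one_smul g := Subtype.ext (funext fun i => by
    change 1 * g.1 i * 1⁻¹ = g.1 i; simp)
  mul_smul x y g := Subtype.ext (funext fun i => by
    change x * y * g.1 i * (x * y)⁻¹ = x * (y * g.1 i * y⁻¹) * x⁻¹; group)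

/-- A commuting `k`-tuple is fixed by `g` exactly when all its entries commute with `g`, so a pair
of a group element and a fixed tuple is a commuting `(k+1)`-tuple with `g` prepended. Burnside's
orbit count finishes the argument. -/
theorem numSimConjClasses_mul_card (G : Type*) [Group G] [Finite G] (k : ℕ) :
    numSimConjClasses G k * Nat.card G = numComm (Set.univ : Set G) (k + 1) := by
  classical
  have := Fintype.ofFinite G
  have : Finite (CommutingTuple G k) := Subtype.finite
  have := Fintype.ofFinite (CommutingTuple G k)
  have hset : simConj G k = MulAction.orbitRel G (CommutingTuple G k) := by
    ext g h
    rw [MulAction.orbitRel_apply]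
    constructor
    · rintro ⟨x, hx⟩
      refine ⟨x⁻¹, Subtype.ext (funext fun i => ?_)⟩
      change x⁻¹ * h.1 i * x⁻¹⁻¹ = g.1 i
      rw [← hx i]; group
    · rintro ⟨x, rfl⟩
      refine ⟨x⁻¹, fun i => ?_⟩
      change x⁻¹ * (x * h.1 i * x⁻¹) * x⁻¹⁻¹ = h.1 i
      group
  have hB := MulAction.sum_card_fixedBy_eq_card_orbits_mul_card_group G (CommutingTuple G k)
  have h1 : numSimConjClasses G k
      = Fintype.card (Quotient (MulAction.orbitRel G (CommutingTuple G k))) := by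
    rw [numSimConjClasses, hset, Nat.card_eq_fintype_card]
  rw [h1, Nat.card_eq_fintype_card, ← hB, ← Fintype.card_sigma, ← Nat.card_eq_fintype_card,
    numComm, ← Nat.card_coe_set_eq]
  refine Nat.card_congr
    { toFun := fun p => ⟨Fin.cons p.1 p.2.1.1, fun _ => trivial, ?_⟩
      invFun := fun t => ⟨t.1 0, ⟨⟨fun i => t.1 i.succ, fun i j => t.2.2 _ _⟩,
        Subtype.ext (funext fun i => ?_)⟩⟩
      left_inv := ?_
      right_inv := ?_ }
  · have key : ∀ i, p.1 * p.2.1.1 i = p.2.1.1 i * p.1 := fun i => by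
      have := congrFun (congrArg Subtype.val p.2.2) i
      change p.1 * p.2.1.1 i * p.1⁻¹ = p.2.1.1 i at this
      rwa [mul_inv_eq_iff_eq_mul] at this
    intro i j
    refine Fin.cases ?_ (fun i => ?_) i <;> refine Fin.cases ?_ (fun j => ?_) j
    · rfl
    · simpa using key j
    · simpa using (key i).symm
    · simpa using p.2.1.2 i j
  · change t.1 0 * t.1 i.succ * (t.1 0)⁻¹ = t.1 i.succ
    rw [t.2.2, mul_inv_cancel_right]
  · rintro ⟨g, t, ht⟩; rfl
  · rintro ⟨t, ht⟩
    exact Subtype.ext (Fin.cons_self_tail t)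

/-- The number of classes of commuting tuples of a group embedded in a monoid. -/
theorem numSimConjClasses_mul_numComm {G M : Type*} [Group G] [Finite G] [Monoid M] (φ : G →* M)
    (hφ : Function.Injective φ) {S : Set M} (hS : Set.range φ = S) (k : ℕ) :
    numSimConjClasses G k * numComm S 1 = numComm S (k + 1) := by
  rw [← hS, ← Set.image_univ, numComm_image φ hφ, numComm_image φ hφ, numComm_one,
    Set.ncard_univ, numSimConjClasses_mul_card]

/-! ### Commuting tuples of two by two matrices -/

/-- A double count with constant fibres on one side only. It is needed for pairs of a tuple and a
traceless matrix `P`, where the number of tuples depends on `det P`. -/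
theorem ncard_mul_eq_sum {α β : Type*} [Finite α] [Finite β] {A : Set α} {B : Finset β}
    (r : α → β → Prop) {m : ℕ} (hA : ∀ a ∈ A, {b | b ∈ B ∧ r a b}.ncard = m) :
    A.ncard * m = ∑ b ∈ B, {a | a ∈ A ∧ r a b}.ncard := by
  classical
  have := Fintype.ofFinite α
  have := Fintype.ofFinite β
  have h := Finset.sum_card_bipartiteAbove_eq_sum_card_bipartiteBelow r (s := A.toFinset) (t := B)
  have h1 : ∀ a ∈ A.toFinset, (Finset.bipartiteAbove r B a).card = m := fun a ha => by
    rw [← hA a (by simpa using ha), Set.ncard_eq_toFinset_card']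
    congr 1; ext b; simp [Finset.bipartiteAbove]
  rw [Finset.sum_congr rfl h1, Finset.sum_const, smul_eq_mul] at h
  rw [Set.ncard_eq_toFinset_card', h]
  refine Finset.sum_congr rfl fun b _ => ?_
  rw [Set.ncard_eq_toFinset_card']
  congr 1; ext a; simp [Finset.bipartiteBelow]

section TwoByTwo

variable {F : Type*} [Field F]

/-- The number of square roots. -/
noncomputable def numSqrt (d : F) : ℕ := {x : F | x ^ 2 = d}.ncard

theorem numSqrt_zero : numSqrt (0 : F) = 1 := by
  rw [numSqrt, ← Set.ncard_singleton (0 : F)]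
  congr 1; ext x; simp

theorem numSqrt_sq (h2 : (2 : F) ≠ 0) {c : F} (hc : c ≠ 0) : numSqrt (c ^ 2) = 2 := by
  have : {x : F | x ^ 2 = c ^ 2} = {c, -c} := by
    ext x; simp [sq_eq_sq_iff_eq_or_eq_neg]
  rw [numSqrt, this, Set.ncard_pair]
  intro h
  have : 2 * c = 0 := by linear_combination h
  exact (mul_ne_zero h2 hc) this

theorem numSqrt_trichotomy (h2 : (2 : F) ≠ 0) {d : F} (hd : d ≠ 0) :
    (numSqrt d = 0 ∧ ∀ x, x ^ 2 ≠ d) ∨ (numSqrt d = 2 ∧ ∃ c, c ≠ 0 ∧ c ^ 2 = d) := by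
  by_cases h : ∃ c, c ^ 2 = d
  · obtain ⟨c, rfl⟩ := h
    have hc : c ≠ 0 := by rintro rfl; simp at hd
    exact Or.inr ⟨numSqrt_sq h2 hc, c, hc, rfl⟩
  · push Not at h
    refine Or.inl ⟨?_, h⟩
    have : {x : F | x ^ 2 = d} = ∅ := by ext x; simp [h x]
    rw [numSqrt, this, Set.ncard_empty]

end TwoByTwo

section TwoByTwoCount

variable {F : Type*} [Field F] [Fintype F]

theorem sum_numSqrt : ∑ d : F, numSqrt d = Fintype.card F := by
  classical
  have h := Finset.card_eq_sum_card_fiberwise (f := fun x : F => x ^ 2) (s := Finset.univ)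
    (t := Finset.univ) (fun _ _ => by simp)
  rw [Finset.card_univ] at h
  rw [h]
  refine Finset.sum_congr rfl fun d _ => ?_
  rw [numSqrt, Set.ncard_eq_toFinset_card']
  congr 1; ext; simp

theorem ncard_hyperbola [DecidableEq F] (c : F) :
    ({p : F × F | p.1 * p.2 = c}.ncard : ℤ)
      = Fintype.card F - 1 + if c = 0 then (Fintype.card F : ℤ) else 0 := by
  classical
  have key : {p : F × F | p.1 * p.2 = c} = (fun y : F => (y, c * y⁻¹)) '' {y | y ≠ 0} ∪
      (fun z : F => ((0 : F), z)) '' {z | c = 0} := by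
    ext ⟨y, z⟩
    simp only [Set.mem_ofPred_eq, Set.mem_union, Set.mem_image, Prod.mk.injEq]
    constructor
    · rintro rfl
      by_cases hy : y = 0
      · right; exact ⟨z, by simp [hy], hy.symm, rfl⟩
      · left; exact ⟨y, hy, rfl, by field_simp⟩
    · rintro (⟨y', hy, rfl, rfl⟩ | ⟨z', hz, rfl, rfl⟩)
      · field_simp
      · simp [hz]
  have hdis : Disjoint ((fun y : F => (y, c * y⁻¹)) '' {y | y ≠ 0})
      ((fun z : F => ((0 : F), z)) '' {z | c = 0}) := by
    rw [Set.disjoint_left]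
    rintro _ ⟨y, hy, rfl⟩ ⟨z, -, hz⟩
    exact hy (congrArg Prod.fst hz).symm
  rw [key, Set.ncard_union_eq hdis, Set.ncard_image_of_injective _
    (fun a b h => congrArg Prod.fst h), Set.ncard_image_of_injective _
    (fun a b h => congrArg Prod.snd h)]
  have h1 : ({y : F | y ≠ 0}.ncard : ℤ) = Fintype.card F - 1 := by
    have : {y : F | y ≠ 0} = {0}ᶜ := by ext; simp
    rw [this, Set.ncard_compl, Set.ncard_singleton, Nat.card_eq_fintype_card,
      Nat.cast_sub Fintype.card_pos, Nat.cast_one]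
  push_cast
  rw [h1]
  congr 1
  split_ifs with hc
  · simp [hc, Set.ncard_univ]
  · simp [hc]

/-- The number of traceless matrices with given determinant. -/
theorem ncard_quadric (d : F) :
    ({p : F × F × F | p.1 ^ 2 + p.2.1 * p.2.2 = d}.ncard : ℤ)
      = Fintype.card F * (Fintype.card F - 1) + Fintype.card F * numSqrt d := by
  classical
  have h := Finset.card_eq_sum_card_fiberwise (f := fun p : F × F × F => p.1)
    (s := {p : F × F × F | p.1 ^ 2 + p.2.1 * p.2.2 = d}.toFinset)
    (t := Finset.univ) (fun _ _ => by simp)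
  rw [Set.ncard_eq_toFinset_card', h]
  -- For fixed `x` the remaining equation is the hyperbola `yz = d - x²`, which has `q` additional
  -- points when it degenerates, that is, for the `numSqrt d` values of `x` with `x² = d`.
  have hf : ∀ x : F, (({p ∈ {p : F × F × F | p.1 ^ 2 + p.2.1 * p.2.2 = d}.toFinset |
      p.1 = x}.card : ℕ) : ℤ) = Fintype.card F - 1 + if x ^ 2 = d then (Fintype.card F : ℤ) else 0 := by
    intro x
    have := ncard_hyperbola (d - x ^ 2)
    simp only [sub_eq_zero (a := d), eq_comm (a := d) (b := x ^ 2)] at this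
    rw [← this, ← Set.ncard_coe_finset, ← Set.ncard_image_of_injective
      {p : F × F | p.1 * p.2 = d - x ^ 2} (f := fun p => (x, p)) (fun a b h => congrArg Prod.snd h)]
    congr 2
    ext ⟨y, z⟩
    simp only [Set.mem_toFinset, Set.mem_ofPred_eq, Finset.coe_filter, Set.mem_image, Prod.mk.injEq]
    constructor
    · rintro ⟨h, rfl⟩; exact ⟨z, by linear_combination h, rfl, rfl⟩
    · rintro ⟨w, h, rfl, rfl⟩; exact ⟨by linear_combination h, rfl⟩
  push_cast
  rw [Finset.sum_congr rfl fun x _ => hf x, Finset.sum_add_distrib, Finset.sum_const,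
    Finset.card_univ, nsmul_eq_mul, ← Finset.sum_filter, Finset.sum_const, nsmul_eq_mul, mul_comm (Finset.card _ : ℤ)]
  congr 3
  rw [numSqrt, Set.ncard_eq_toFinset_card']
  congr 1; ext; simp

/-- A sum over nonzero traceless matrices of a function of the determinant that depends only on
whether the determinant is minus a square. -/
theorem sum_quadric (h2 : (2 : F) ≠ 0) [DecidableEq F] (f : F → ℤ) (f0 f1 f2 : ℤ) (h0 : f 0 = f0)
    (h1 : ∀ c : F, c ≠ 0 → f (c ^ 2) = f1) (hn : ∀ d : F, (∀ x, x ^ 2 ≠ d) → f d = f2) :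
    2 * ∑ p ∈ (Finset.univ : Finset (F × F × F)).filter (· ≠ 0), f (p.1 ^ 2 + p.2.1 * p.2.2)
      = (Fintype.card F - 1) * (2 * (Fintype.card F + 1) * f0
        + Fintype.card F * (Fintype.card F + 1) * f1
        + Fintype.card F * (Fintype.card F - 1) * f2) := by
  classical
  set q : ℤ := (Fintype.card F : ℤ)
  have htot : ∑ p : F × F × F, f (p.1 ^ 2 + p.2.1 * p.2.2)
      = ∑ d : F, (q * (q - 1) + q * numSqrt d) * f d := by
    rw [← Finset.sum_fiberwise (s := Finset.univ) (g := fun p : F × F × F => p.1 ^ 2 + p.2.1 * p.2.2)]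
    refine Finset.sum_congr rfl fun d _ => ?_
    rw [← ncard_quadric d, Finset.sum_congr rfl (g := fun _ => f d)
      (fun p hp => by rw [(Finset.mem_filter.1 hp).2]), Finset.sum_const, nsmul_eq_mul,
      Set.ncard_eq_toFinset_card']
    congr 3
    ext; simp
  have hne : ∑ p ∈ (Finset.univ : Finset (F × F × F)).filter (· ≠ 0), f (p.1 ^ 2 + p.2.1 * p.2.2)
      = (∑ p : F × F × F, f (p.1 ^ 2 + p.2.1 * p.2.2)) - f0 := by
    rw [Finset.filter_ne', ← Finset.sum_erase_add _ _ (Finset.mem_univ (0 : F × F × F))]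
    simp [h0]
  have hs := sum_numSqrt (F := F)
  -- On nonzero `d` the number of square roots is 0 or 2 and `f` depends only on which of the two
  -- occurs. The summand is therefore an affine function of `numSqrt d`, and the total number of
  -- square roots suffices to sum it.
  have hf : ∀ d ∈ Finset.univ.erase (0 : F), 2 * (q * (q - 1) + q * numSqrt d) * f d
      = (q * (q + 1) * f1 - q * (q - 1) * f2) * numSqrt d + 2 * (q * (q - 1)) * f2 := by
    intro d hd
    rcases numSqrt_trichotomy h2 (Finset.ne_of_mem_erase hd) with ⟨h, h'⟩ | ⟨h, c, hc, rfl⟩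
    · rw [h, hn d h']; push_cast; ring
    · rw [h, h1 c hc]; push_cast; ring
  have hs' : ∑ d ∈ Finset.univ.erase (0 : F), (numSqrt d : ℤ) = q - 1 := by
    rw [← Finset.sum_erase_add _ _ (Finset.mem_univ (0 : F)), numSqrt_zero] at hs
    have := congrArg (Nat.cast : ℕ → ℤ) hs
    push_cast at this
    linarith
  have hc : ((Finset.univ.erase (0 : F)).card : ℤ) = q - 1 := by
    rw [Finset.card_erase_of_mem (Finset.mem_univ _), Finset.card_univ,
      Nat.cast_sub Fintype.card_pos, Nat.cast_one]
  rw [hne, htot, ← Finset.sum_erase_add _ _ (Finset.mem_univ (0 : F)), numSqrt_zero, h0]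
  have : 2 * ∑ d ∈ Finset.univ.erase (0 : F), (q * (q - 1) + q * numSqrt d) * f d
      = (q - 1) * (q * (q + 1) * f1 + q * (q - 1) * f2) := by
    rw [Finset.mul_sum, Finset.sum_congr rfl fun d hd => (mul_assoc _ _ _).symm.trans (hf d hd),
      Finset.sum_add_distrib, ← Finset.mul_sum, hs', Finset.sum_const, nsmul_eq_mul, hc]
    ring
  push_cast
  linear_combination this

end TwoByTwoCount

section TwoByTwo

variable {F : Type*} [Field F]

/-- The matrix with scalar part `a` and traceless part given by `p`. -/
def scalarAddTraceless (a : F) (p : F × F × F) : Matrix (Fin 2) (Fin 2) F :=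
  !![a + p.1, p.2.1; p.2.2, a - p.1]

theorem det_scalarAddTraceless (a : F) (p : F × F × F) :
    (scalarAddTraceless a p).det = a ^ 2 - (p.1 ^ 2 + p.2.1 * p.2.2) := by
  rw [scalarAddTraceless, Matrix.det_fin_two_of]; ring

theorem scalarAddTraceless_bijective (h2 : (2 : F) ≠ 0) :
    Function.Bijective fun s : F × F × F × F => scalarAddTraceless s.1 s.2 := by
  constructor
  · rintro ⟨a, x, y, z⟩ ⟨a', x', y', z'⟩ h
    have h1 := congrFun (congrFun h 0) 0
    have h3 := congrFun (congrFun h 0) 1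
    have h4 := congrFun (congrFun h 1) 0
    have h5 := congrFun (congrFun h 1) 1
    simp [scalarAddTraceless] at h1 h3 h4 h5
    have ha : a = a' := mul_left_cancel₀ h2 (by linear_combination h1 + h5)
    have hx : x = x' := mul_left_cancel₀ h2 (by linear_combination h1 - h5)
    rw [ha, hx, h3, h4]
  · intro g
    refine ⟨((g 0 0 + g 1 1) / 2, (g 0 0 - g 1 1) / 2, g 0 1, g 1 0), ?_⟩
    ext i j
    fin_cases i <;> fin_cases j <;> simp [scalarAddTraceless] <;> field_simp <;> ring

/-- Scalar parts drop out of the commutator, whose entries are, up to signs and factors 2, the two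
by two minors of the pair `(p, p')`. Inverting 2 recovers the minors. -/
theorem scalarAddTraceless_commute_iff (h2 : (2 : F) ≠ 0) (a a' : F) (p p' : F × F × F) :
    scalarAddTraceless a p * scalarAddTraceless a' p'
        = scalarAddTraceless a' p' * scalarAddTraceless a p ↔
      p.1 * p'.2.1 = p'.1 * p.2.1 ∧ p.1 * p'.2.2 = p'.1 * p.2.2 ∧
        p.2.1 * p'.2.2 = p'.2.1 * p.2.2 := by
  simp only [scalarAddTraceless, ← Matrix.ext_iff, Fin.forall_fin_two, Matrix.mul_apply,
    Fin.sum_univ_two]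
  simp
  constructor
  · rintro ⟨⟨h1, h3⟩, h4, h5⟩
    refine ⟨mul_left_cancel₀ h2 ?_, mul_left_cancel₀ h2 ?_, ?_⟩
    · linear_combination h3
    · linear_combination -h4
    · linear_combination h1
  · rintro ⟨h1, h3, h4⟩
    refine ⟨⟨?_, ?_⟩, ?_, ?_⟩
    · linear_combination h4
    · linear_combination 2 * h1
    · linear_combination -2 * h3
    · linear_combination -h4

/-- Proportionality to a nonzero vector. -/
theorem exists_smul_of_minors {p p' : F × F × F} (hp : p ≠ 0)
    (h : p.1 * p'.2.1 = p'.1 * p.2.1 ∧ p.1 * p'.2.2 = p'.1 * p.2.2 ∧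
        p.2.1 * p'.2.2 = p'.2.1 * p.2.2) : ∃ c : F, p' = c • p := by
  obtain ⟨x, y, z⟩ := p
  obtain ⟨x', y', z'⟩ := p'
  obtain ⟨h1, h3, h4⟩ := h
  simp only at h1 h3 h4
  by_cases hx : x = 0
  · by_cases hy : y = 0
    · have hz : z ≠ 0 := by rintro rfl; simp [hx, hy] at hp
      refine ⟨z' / z, ?_⟩
      simp only [Prod.smul_mk, smul_eq_mul, Prod.mk.injEq]
      refine ⟨?_, ?_, ?_⟩ <;> field_simp
      · linear_combination -h3
      · linear_combination -h4
    · refine ⟨y' / y, ?_⟩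
      simp only [Prod.smul_mk, smul_eq_mul, Prod.mk.injEq]
      refine ⟨?_, ?_, ?_⟩ <;> field_simp
      · linear_combination -h1
      · linear_combination h4
  · refine ⟨x' / x, ?_⟩
    simp only [Prod.smul_mk, smul_eq_mul, Prod.mk.injEq]
    refine ⟨?_, ?_, ?_⟩ <;> field_simp
    · linear_combination h1
    · linear_combination h3

/-- The number of commuting tuples in the set of two by two matrices with determinant in `D`. -/
theorem two_mul_numComm_det [Fintype F] (h2 : (2 : F) ≠ 0) (D : Set F) (z n0 n1 n2 : ℕ)
    (hz : {a : F | a ^ 2 ∈ D}.ncard = z)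
    (h0 : {s : F × F | s.1 ^ 2 - s.2 ^ 2 * 0 ∈ D}.ncard = n0)
    (h1 : ∀ c : F, c ≠ 0 → {s : F × F | s.1 ^ 2 - s.2 ^ 2 * c ^ 2 ∈ D}.ncard = n1)
    (hn : ∀ d : F, (∀ x, x ^ 2 ≠ d) → {s : F × F | s.1 ^ 2 - s.2 ^ 2 * d ∈ D}.ncard = n2) (k : ℕ) :
    2 * (numComm {g : Matrix (Fin 2) (Fin 2) F | g.det ∈ D} k : ℤ)
      = 2 * (Fintype.card F + 1) * n0 ^ k + Fintype.card F * (Fintype.card F + 1) * n1 ^ k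
        + Fintype.card F * (Fintype.card F - 1) * n2 ^ k
        - 2 * Fintype.card F * (Fintype.card F + 1) * z ^ k := by
  classical
  set par : F × F × F → F × F × F → Prop := fun p p' => p.1 * p'.2.1 = p'.1 * p.2.1 ∧
    p.1 * p'.2.2 = p'.1 * p.2.2 ∧ p.2.1 * p'.2.2 = p'.2.1 * p.2.2 with hpar
  set Q : F × F × F → F := fun p => p.1 ^ 2 + p.2.1 * p.2.2 with hQ
  set C : Set (Fin k → F × F × F × F) :=
    {s | (∀ i, (s i).1 ^ 2 - Q (s i).2 ∈ D) ∧ ∀ i j, par (s i).2 (s j).2} with hC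
  have hbij := scalarAddTraceless_bijective h2
  have hN : numComm {g : Matrix (Fin 2) (Fin 2) F | g.det ∈ D} k = C.ncard := by
    rw [numComm, ← Set.ncard_image_of_injective C (hbij.1.comp_left (α := Fin k))]
    congr 1; ext t
    constructor
    · rintro ⟨ht1, ht2⟩
      obtain ⟨s, rfl⟩ := (hbij.2.comp_left (α := Fin k)) t
      refine ⟨s, ⟨fun i => ?_, fun i j => ?_⟩, rfl⟩
      · have := ht1 i
        simp only [Function.comp, Set.mem_ofPred_eq, det_scalarAddTraceless] at this
        exact this
      · exact (scalarAddTraceless_commute_iff h2 _ _ _ _).1 (ht2 i j)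
    · rintro ⟨s, ⟨hs1, hs2⟩, rfl⟩
      refine ⟨fun i => ?_, fun i j => (scalarAddTraceless_commute_iff h2 _ _ _ _).2 (hs2 i j)⟩
      simp only [Function.comp, Set.mem_ofPred_eq, det_scalarAddTraceless]
      exact hs1 i
  set A : Set (Fin k → F × F × F × F) := {s | s ∈ C ∧ ∃ i, (s i).2 ≠ 0} with hA
  set Z : Set (Fin k → F × F × F × F) := {s | s ∈ C ∧ ∀ i, (s i).2 = 0} with hZ
  have hZc : Z.ncard = z ^ k := by
    rw [← hz, ← ncard_pi_const, ← Set.ncard_image_of_injective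
      {t : Fin k → F | ∀ i, t i ∈ {a : F | a ^ 2 ∈ D}}
      (f := fun t i => (t i, (0 : F × F × F)))
      (fun s t h => funext fun i => congrArg Prod.fst (congrFun h i))]
    congr 1; ext s
    constructor
    · rintro ⟨⟨hs1, hs2⟩, hs3⟩
      refine ⟨fun i => (s i).1, fun i => ?_, funext fun i => Prod.ext rfl (hs3 i).symm⟩
      have := hs1 i
      rw [hs3 i] at this
      simpa [hQ] using this
    · rintro ⟨t, ht, rfl⟩
      exact ⟨⟨fun i => by simpa [hQ] using ht i, fun i j => by simp [hpar]⟩, fun i => rfl⟩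
  have hCA : C.ncard = A.ncard + z ^ k := by
    rw [← hZc, ← Set.ncard_union_eq]
    · congr 1; ext s
      simp only [hA, hZ, Set.mem_union, Set.mem_ofPred_eq, ← and_or_left]
      constructor
      · intro h; exact ⟨h, by by_contra! h'; obtain ⟨h3, i, h4⟩ := h'; exact h4 (h3 i)⟩
      · exact fun h => h.1
    · rw [Set.disjoint_left]
      rintro s ⟨-, i, hi⟩ ⟨-, h⟩
      exact hi (h i)
  -- each tuple that is not scalar spans a line of traceless matrices
  have hq1 : {c : F | c ≠ 0}.ncard = Fintype.card F - 1 := by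
    have : {y : F | y ≠ 0} = {0}ᶜ := by ext; simp
    rw [this, Set.ncard_compl, Set.ncard_singleton, Nat.card_eq_fintype_card]
  have hdc := ncard_mul_eq_sum (A := A) (B := (Finset.univ : Finset (F × F × F)).filter (· ≠ 0))
    (fun s P => ∀ i, ∃ b : F, (s i).2 = b • P) (m := Fintype.card F - 1) (by
      rintro s ⟨⟨hs1, hs2⟩, i, hi⟩
      rw [← hq1, ← Set.ncard_image_of_injective {c : F | c ≠ 0} (smul_left_injective F hi)]
      congr 1; ext P
      simp only [Finset.mem_filter, Finset.mem_univ, true_and, Set.mem_ofPred_eq, Set.mem_image]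
      constructor
      · rintro ⟨hP, h⟩
        obtain ⟨b, hb⟩ := h i
        have hb0 : b ≠ 0 := by rintro rfl; simp at hb; exact hi hb
        exact ⟨b⁻¹, inv_ne_zero hb0, by rw [hb, inv_smul_smul₀ hb0]⟩
      · rintro ⟨c, hc, rfl⟩
        refine ⟨smul_ne_zero hc hi, fun j => ?_⟩
        obtain ⟨b, hb⟩ := exists_smul_of_minors hi (hs2 i j)
        exact ⟨b * c⁻¹, by rw [hb, smul_smul, mul_assoc, inv_mul_cancel₀ hc, mul_one]⟩)
  -- All elements `a + bP` commute with each other, so the tuples in `F[P]` satisfying the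
  -- determinant condition form a full `k`-th power. The scalar tuples, which belong to every
  -- `F[P]`, are subtracted.
  have hfib : ∀ P ∈ (Finset.univ : Finset (F × F × F)).filter (· ≠ 0),
      (({s | s ∈ A ∧ ∀ i, ∃ b : F, (s i).2 = b • P}.ncard : ℕ) : ℤ)
        = ({s : F × F | s.1 ^ 2 - s.2 ^ 2 * Q P ∈ D}.ncard : ℤ) ^ k - (z : ℤ) ^ k := by
    intro P hP
    have hP0 : P ≠ 0 := by simpa using hP
    rw [eq_sub_iff_add_eq]
    norm_cast
    rw [← hZc, ← ncard_pi_const, ← Set.ncard_union_eq, ← Set.ncard_image_of_injective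
      {t : Fin k → F × F | ∀ i, t i ∈ {s : F × F | s.1 ^ 2 - s.2 ^ 2 * Q P ∈ D}}
      (f := fun t i => ((t i).1, (t i).2 • P))]
    · congr 1; ext s
      constructor
      · have key : s ∈ C → (∀ i, ∃ b : F, (s i).2 = b • P) → s ∈
          (fun (t : Fin k → F × F) i => ((t i).1, (t i).2 • P)) ''
            {t : Fin k → F × F | ∀ i, t i ∈ {s : F × F | s.1 ^ 2 - s.2 ^ 2 * Q P ∈ D}} := by
          intro hs h
          choose b hb using h
          refine ⟨fun i => ((s i).1, b i), fun i => ?_, funext fun i => Prod.ext rfl (hb i).symm⟩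
          have := hs.1 i
          rw [hb i] at this
          simp only [Set.mem_ofPred_eq, hQ, Prod.smul_fst, Prod.smul_snd, smul_eq_mul] at this ⊢
          convert this using 1
          ring
        rintro (⟨⟨hs, -⟩, h⟩ | ⟨hs, h⟩)
        · exact key hs h
        · exact key hs fun i => ⟨0, by rw [h i, zero_smul]⟩
      · rintro ⟨t, ht, rfl⟩
        have hC' : (fun i => ((t i).1, (t i).2 • P)) ∈ C := by
          refine ⟨fun i => ?_, fun i j => ?_⟩
          · have := ht i
            simp only [Set.mem_ofPred_eq, hQ, Prod.smul_fst, Prod.smul_snd, smul_eq_mul] at this ⊢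
            convert this using 1
            ring
          · simp only [hpar, Prod.smul_fst, Prod.smul_snd, smul_eq_mul]
            refine ⟨?_, ?_, ?_⟩ <;> ring
        by_cases h : ∃ i, (t i).2 • P ≠ 0
        · exact Or.inl ⟨⟨hC', h⟩, fun i => ⟨(t i).2, rfl⟩⟩
        · push Not at h
          exact Or.inr ⟨hC', h⟩
    · intro s t h
      funext i
      have := congrFun h i
      rw [Prod.mk.injEq] at this
      exact Prod.ext this.1 (smul_left_injective F hP0 this.2)
    · rw [Set.disjoint_left]
      rintro s ⟨⟨-, i, hi⟩, -⟩ ⟨-, h⟩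
      exact hi (h i)
  have hq0 : ((Fintype.card F - 1 : ℕ) : ℤ) = Fintype.card F - 1 := by
    rw [Nat.cast_sub Fintype.card_pos, Nat.cast_one]
  have hqne : (Fintype.card F : ℤ) - 1 ≠ 0 := by
    have := Fintype.one_lt_card (α := F)
    omega
  have hsum := sum_quadric h2
    (fun d => ({s : F × F | s.1 ^ 2 - s.2 ^ 2 * d ∈ D}.ncard : ℤ) ^ k - (z : ℤ) ^ k)
    ((n0 : ℤ) ^ k - z ^ k) ((n1 : ℤ) ^ k - z ^ k) ((n2 : ℤ) ^ k - z ^ k)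
    (by rw [h0]) (fun c hc => by rw [h1 c hc]) (fun d hd => by rw [hn d hd])
  have hdc' := congrArg (Nat.cast : ℕ → ℤ) hdc
  rw [Nat.cast_mul, hq0, Nat.cast_sum, Finset.sum_congr rfl hfib] at hdc'
  rw [hN, hCA]
  apply mul_left_cancel₀ hqne
  push_cast
  linear_combination 2 * hdc' + hsum

end TwoByTwo

/-! ### Commuting tuples in `GL₂` and in `Sp₂ = SL₂` -/

section TwoByTwoGroups

variable {F : Type*} [Field F] [Fintype F]

theorem ncard_ne_zero : {y : F | y ≠ 0}.ncard = Fintype.card F - 1 := by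
  have : {y : F | y ≠ 0} = {0}ᶜ := by ext; simp
  rw [this, Set.ncard_compl, Set.ncard_singleton, Nat.card_eq_fintype_card]


/-- The change of variables splitting a hyperbolic plane. -/
theorem ncard_split_conic (h2 : (2 : F) ≠ 0) {c : F} (hc : c ≠ 0) (D : Set F) :
    {s : F × F | s.1 ^ 2 - s.2 ^ 2 * c ^ 2 ∈ D}.ncard = {s : F × F | s.1 * s.2 ∈ D}.ncard := by
  refine Set.ncard_congr (fun s _ => (s.1 - s.2 * c, s.1 + s.2 * c)) ?_ ?_ ?_
  · rintro ⟨a, b⟩ h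
    simp only [Set.mem_ofPred_eq] at h ⊢
    convert h using 1
    ring
  · rintro ⟨a, b⟩ ⟨a', b'⟩ _ _ h
    simp only [Prod.mk.injEq] at h ⊢
    refine ⟨mul_left_cancel₀ h2 ?_, mul_left_cancel₀ (mul_ne_zero h2 hc) ?_⟩
    · linear_combination h.1 + h.2
    · linear_combination h.2 - h.1
  · rintro ⟨x, y⟩ h
    have e1 : (x + y) / 2 - (y - x) / (2 * c) * c = x := by field_simp; ring
    have e2 : (x + y) / 2 + (y - x) / (2 * c) * c = y := by field_simp; ring
    refine ⟨((x + y) / 2, (y - x) / (2 * c)), ?_, by simp only [e1, e2]⟩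
    simp only [Set.mem_ofPred_eq] at h ⊢
    convert h using 1
    field_simp; ring

/-- The unit groups of `F[ε]`, `F × F` and the quadratic field have orders `q(q-1)`, `(q-1)²` and
`q²-1`. These are the values of `n0`, `n1` and `n2`, while `z = q-1` counts the nonzero scalars. -/
theorem numComm_det_ne_zero (h2 : (2 : F) ≠ 0) (k : ℕ) :
    2 * (numComm {g : Matrix (Fin 2) (Fin 2) F | g.det ≠ 0} k : ℤ)
      = 2 * (Fintype.card F + 1) * (Fintype.card F * (Fintype.card F - 1)) ^ k
        + Fintype.card F * (Fintype.card F + 1) * ((Fintype.card F - 1) ^ 2) ^ k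
        + Fintype.card F * (Fintype.card F - 1) * (Fintype.card F ^ 2 - 1) ^ k
        - 2 * Fintype.card F * (Fintype.card F + 1) * (Fintype.card F - 1) ^ k := by
  have hq := Fintype.card_pos (α := F)
  have h := two_mul_numComm_det h2 {x : F | x ≠ 0} (Fintype.card F - 1)
    (Fintype.card F * (Fintype.card F - 1)) ((Fintype.card F - 1) ^ 2) (Fintype.card F ^ 2 - 1)
    ?_ ?_ ?_ ?_ k
  · rw [Nat.cast_mul, Nat.cast_pow, Nat.cast_sub hq, Nat.cast_sub (Nat.one_le_pow _ _ hq)] at h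
    push_cast at h
    exact h
  · rw [← ncard_ne_zero]; congr 1; ext; simp
  · have : {s : F × F | s.1 ^ 2 - s.2 ^ 2 * 0 ∈ {x : F | x ≠ 0}} = {y : F | y ≠ 0} ×ˢ Set.univ := by
      ext; simp
    rw [this, Set.ncard_prod, ncard_ne_zero, Set.ncard_univ, Nat.card_eq_fintype_card, mul_comm]
  · intro c hc
    rw [ncard_split_conic h2 hc]
    have : {s : F × F | s.1 * s.2 ∈ {x : F | x ≠ 0}} = {y : F | y ≠ 0} ×ˢ {y : F | y ≠ 0} := by
      ext; simp
    rw [this, Set.ncard_prod, ncard_ne_zero, sq]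
  · intro d hd
    have : {s : F × F | s.1 ^ 2 - s.2 ^ 2 * d ∈ {x : F | x ≠ 0}} = {0}ᶜ := by
      ext ⟨a, b⟩
      simp only [Set.mem_ofPred_eq, Set.mem_compl_iff, Set.mem_singleton_iff]
      refine not_congr ⟨fun h => ?_, ?_⟩
      · have hb : b = 0 := by
          by_contra hb
          refine hd (a / b) ?_
          field_simp
          linear_combination h
        subst hb
        simpa using h
      · rintro h
        rw [Prod.mk_eq_zero] at h
        simp [h.1, h.2]
    rw [this, Set.ncard_compl, Set.ncard_singleton, Nat.card_eq_fintype_card, Fintype.card_prod, sq]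

theorem ncard_sq_eq_one (h2 : (2 : F) ≠ 0) : {a : F | a ^ 2 ∈ ({1} : Set F)}.ncard = 2 := by
  have := numSqrt_sq h2 (one_ne_zero (α := F))
  rw [one_pow] at this
  exact this

/-- The number of points of an anisotropic conic. -/
theorem ncard_anisotropic_conic (h2 : (2 : F) ≠ 0) {d : F} (hd : ∀ x, x ^ 2 ≠ d) :
    {s : F × F | s.1 ^ 2 - s.2 ^ 2 * d ∈ ({1} : Set F)}.ncard = Fintype.card F + 1 := by
  have hd' : ∀ s : F, 1 - d * s ^ 2 ≠ 0 := by
    intro s hs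
    have hs0 : s ≠ 0 := by rintro rfl; simp at hs
    refine hd s⁻¹ ?_
    field_simp
    linear_combination hs
  have hd0 : d ≠ 0 := by rintro rfl; exact hd 0 (by simp)
  -- Stereographic projection from the point `(-1, 0)`, with parameter the slope `b / (1 + a)`. The
  -- denominator never vanishes because `d` is not a square, so all `q` slopes occur, and the centre
  -- of projection is the one missing point.
  set f : F → F × F := fun s => ((1 + d * s ^ 2) / (1 - d * s ^ 2), 2 * s / (1 - d * s ^ 2)) with hf
  have h1a : ∀ s, 1 + (f s).1 = 2 / (1 - d * s ^ 2) := fun s => by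
    have := hd' s; simp only [hf]; field_simp; ring
  have h1a' : ∀ s, 1 + (f s).1 ≠ 0 := fun s => by
    rw [h1a]; exact div_ne_zero h2 (hd' s)
  have hfi : Function.Injective f := by
    have hs : ∀ s, s = (f s).2 / (1 + (f s).1) := fun s => by
      rw [h1a]; simp only [hf]; rw [div_div_div_cancel_right₀ (hd' s), mul_div_cancel_left₀ _ h2]
    intro s t h
    rw [hs s, hs t, h]
  have key : {s : F × F | s.1 ^ 2 - s.2 ^ 2 * d ∈ ({1} : Set F)} = insert (-1, 0) (f '' Set.univ) := by
    ext ⟨a, b⟩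
    simp only [Set.mem_ofPred_eq, Set.mem_singleton_iff, Set.mem_insert_iff, Set.image_univ,
      Set.mem_range, Prod.mk.injEq]
    constructor
    · intro h
      by_cases ha : 1 + a = 0
      · left
        have ha' : a = -1 := by linear_combination ha
        refine ⟨ha', ?_⟩
        have : b ^ 2 * d = 0 := by rw [ha'] at h; linear_combination -h
        simpa [hd0] using this
      · right
        have e : 1 - d * (b / (1 + a)) ^ 2 = 2 / (1 + a) := by
          field_simp; linear_combination h
        have e' : 1 + d * (b / (1 + a)) ^ 2 = 2 * a / (1 + a) := by
          field_simp; linear_combination -h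
        refine ⟨b / (1 + a), ?_⟩
        simp only [hf, e, e']
        rw [Prod.mk.injEq]
        constructor <;> field_simp
    · rintro (⟨rfl, rfl⟩ | ⟨s, h⟩)
      · simp
      · rw [← (Prod.mk.inj h).1, ← (Prod.mk.inj h).2]
        have := hd' s
        field_simp; ring
  rw [key, Set.ncard_insert_of_notMem, Set.ncard_image_of_injective _ hfi, Set.ncard_univ,
    Nat.card_eq_fintype_card]
  rintro ⟨s, -, hs⟩
  refine h1a' s ?_
  rw [hs]; simp

/-- The elements of norm one in `F[ε]`, `F × F` and the quadratic field number `2q`, `q-1` and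
`q+1`, and the scalars of determinant one are `±1`. -/
theorem numComm_det_eq_one (h2 : (2 : F) ≠ 0) (k : ℕ) :
    2 * (numComm {g : Matrix (Fin 2) (Fin 2) F | g.det = 1} k : ℤ)
      = 2 * (Fintype.card F + 1) * (2 * Fintype.card F) ^ k
        + Fintype.card F * (Fintype.card F + 1) * (Fintype.card F - 1) ^ k
        + Fintype.card F * (Fintype.card F - 1) * (Fintype.card F + 1) ^ k
        - 2 * Fintype.card F * (Fintype.card F + 1) * 2 ^ k := by
  classical
  have hq := Fintype.card_pos (α := F)
  have h := two_mul_numComm_det h2 ({1} : Set F) 2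
    (2 * Fintype.card F) (Fintype.card F - 1) (Fintype.card F + 1)
    (ncard_sq_eq_one h2) ?_ ?_ (fun d hd => ncard_anisotropic_conic h2 hd) k
  · rw [Nat.cast_sub hq] at h
    push_cast at h
    exact h
  · have : {s : F × F | s.1 ^ 2 - s.2 ^ 2 * 0 ∈ ({1} : Set F)}
        = {y : F | y ^ 2 ∈ ({1} : Set F)} ×ˢ Set.univ := by
      ext; simp
    rw [this, Set.ncard_prod, ncard_sq_eq_one h2, Set.ncard_univ, Nat.card_eq_fintype_card]
  · intro c hc
    rw [ncard_split_conic h2 hc]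
    have := ncard_hyperbola (1 : F)
    simp only [one_ne_zero, if_false, add_zero] at this
    have e : {s : F × F | s.1 * s.2 ∈ ({1} : Set F)} = {p : F × F | p.1 * p.2 = 1} := rfl
    rw [e]
    omega

theorem range_GL_coe {n K : Type*} [Fintype n] [DecidableEq n] [Field K] :
    Set.range (Units.coeHom (Matrix n n K)) = {g | g.det ≠ 0} := by
  ext g
  simp only [Set.mem_range, Set.mem_ofPred_eq, ← isUnit_iff_ne_zero]
  rw [← Matrix.isUnit_iff_isUnit_det]
  rfl

/-- Classes of commuting tuples in `GL₂` in terms of commuting tuples of matrices. -/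
theorem numSimConjClasses_GL_two (k : ℕ) :
    numSimConjClasses (GL (Fin 2) F) k * numComm {g : Matrix (Fin 2) (Fin 2) F | g.det ≠ 0} 1
      = numComm {g : Matrix (Fin 2) (Fin 2) F | g.det ≠ 0} (k + 1) :=
  numSimConjClasses_mul_numComm (Units.coeHom _) Units.val_injective range_GL_coe k

/-- A symplectic matrix of size two is a matrix of determinant one. -/
theorem mem_symplecticGroup_fin_one_iff {K : Type*} [Field K]
    (A : Matrix (Fin 1 ⊕ Fin 1) (Fin 1 ⊕ Fin 1) K) :
    A ∈ Matrix.symplecticGroup (Fin 1) K ↔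
      (Matrix.reindex (finSumFinEquiv (m := 1) (n := 1)) (finSumFinEquiv (m := 1) (n := 1)) A).det = 1 := by
  rw [SymplecticGroup.mem_iff, Matrix.det_fin_two]
  simp only [Matrix.reindex_apply, Matrix.submatrix_apply]
  have e0 : (finSumFinEquiv (m := 1) (n := 1)).symm 0 = Sum.inl 0 := rfl
  have e1 : (finSumFinEquiv (m := 1) (n := 1)).symm 1 = Sum.inr 0 := rfl
  rw [e0, e1]
  simp only [← Matrix.ext_iff, Matrix.mul_apply, Fintype.sum_sum_type, Matrix.J]
  simp
  constructor
  · rintro ⟨⟨h1, h3⟩, h4, h5⟩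
    linear_combination h4
  · intro h
    refine ⟨⟨?_, ?_⟩, ?_, ?_⟩
    · ring
    · linear_combination -h
    · linear_combination h
    · ring

theorem numSimConjClasses_symplectic (k : ℕ) :
    numSimConjClasses (Matrix.symplecticGroup (Fin 1) F) k
        * numComm {g : Matrix (Fin 2) (Fin 2) F | g.det = 1} 1
      = numComm {g : Matrix (Fin 2) (Fin 2) F | g.det = 1} (k + 1) := by
  set e := Matrix.reindexAlgEquiv F F (finSumFinEquiv (m := 1) (n := 1))
  refine numSimConjClasses_mul_numComm
    ((e : _ →* Matrix (Fin 2) (Fin 2) F).comp (Matrix.symplecticGroup (Fin 1) F).subtype)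
    (e.injective.comp Subtype.val_injective) ?_ k
  ext g
  constructor
  · rintro ⟨a, rfl⟩
    exact (mem_symplecticGroup_fin_one_iff _).1 a.2
  · intro hg
    refine ⟨⟨e.symm g, (mem_symplecticGroup_fin_one_iff _).2 ?_⟩, e.apply_symm_apply g⟩
    have : e (e.symm g) = g := e.apply_symm_apply g
    rw [Matrix.coe_reindexAlgEquiv] at this
    rw [this]; exact hg

end TwoByTwoGroups

/-! ### Norms and traces for a quadratic extension of finite fields -/

/-- Fibres of size at most `m` whose average size is `m` all have size exactly `m`. For the trace
and the norm the upper bound comes from the degree of a polynomial and the average from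
cardinalities, so surjectivity comes out at the same time. -/
theorem ncard_fiber_eq_of_le {α β : Type*} [Finite α] [Finite β] (f : α → β) (B : Set β) (m : ℕ)
    (hf : ∀ a, f a ∈ B) (hle : ∀ b ∈ B, {a | f a = b}.ncard ≤ m)
    (hc : Nat.card α = B.ncard * m) : ∀ b ∈ B, {a | f a = b}.ncard = m := by
  classical
  have := Fintype.ofFinite α
  have := Fintype.ofFinite β
  have h := Finset.card_eq_sum_card_fiberwise (f := f) (s := Finset.univ)
    (t := B.toFinset) (fun a _ => by simpa using hf a)
  have e : ∀ b, {a | f a = b}.ncard = (Finset.univ.filter fun a => f a = b).card := fun b => by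
    rw [Set.ncard_eq_toFinset_card']; congr 1; ext; simp
  simp only [← e] at h
  rw [Finset.card_univ, ← Nat.card_eq_fintype_card, hc, Set.ncard_eq_toFinset_card',
    ← smul_eq_mul, ← Finset.sum_const] at h
  have := (Finset.sum_eq_sum_iff_of_le (fun b hb => hle b (by simpa using hb))).1 h.symm
  exact fun b hb => this b (by simpa using hb)

section QuadraticExtension

variable (F : Type*) [Field F] [Fintype F] {E : Type*} [Field E] [Algebra F E]

/-- The automorphism `x ↦ x ^ q` of an extension of the field with `q` elements. -/
noncomputable def bar : E →+* E := (FiniteField.frobeniusAlgHom F E : E →+* E)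

theorem bar_apply (x : E) : bar F x = x ^ Fintype.card F := rfl

theorem bar_algebraMap (x : F) : bar F (algebraMap F E x) = algebraMap F E x :=
  (FiniteField.frobeniusAlgHom F E).commutes x

variable [Finite E] [Fact (Module.finrank F E = 2)]

theorem card_quadratic : Nat.card E = Fintype.card F ^ 2 := by
  rw [Module.natCard_eq_pow_finrank (K := F), Fact.out (p := Module.finrank F E = 2),
    Nat.card_eq_fintype_card]

@[simp] theorem bar_bar (x : E) : bar F (bar F x) = x := by
  have := Fintype.ofFinite E
  rw [bar_apply, bar_apply, ← pow_mul, ← sq, ← card_quadratic F (E := E),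
    Nat.card_eq_fintype_card, FiniteField.pow_card]

theorem ncard_roots_le {K : Type*} [Field K] (p : Polynomial K) (hp : p ≠ 0) :
    {x : K | p.eval x = 0}.ncard ≤ p.natDegree := by
  classical
  have : {x : K | p.eval x = 0} = (p.roots.toFinset : Set K) := by
    ext x; simp [hp]
  rw [this, Set.ncard_coe_finset]
  exact (Multiset.toFinset_card_le _).trans (Polynomial.card_roots' p)

/-- The fixed elements are roots of `X^q - X`, of which there are at most `q`, and the image of `F`
already supplies `q` of them. -/
theorem setOf_bar_eq_self : {x : E | bar F x = x} = Set.range (algebraMap F E) := by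
  symm
  refine Set.eq_of_subset_of_ncard_le ?_ ?_ (Set.toFinite _)
  · rintro _ ⟨x, rfl⟩
    exact bar_algebraMap F x
  · have h1 := Fintype.one_lt_card (α := F)
    have hd : (Polynomial.X ^ Fintype.card F - Polynomial.X : Polynomial E).natDegree = Fintype.card F :=
      FiniteField.X_pow_card_sub_X_natDegree_eq E h1
    have := ncard_roots_le (Polynomial.X ^ Fintype.card F - Polynomial.X : Polynomial E)
      (FiniteField.X_pow_card_sub_X_ne_zero E h1)
    rw [hd] at this
    simp only [Polynomial.eval_sub, Polynomial.eval_pow, Polynomial.eval_X, sub_eq_zero] at this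
    rw [← Set.image_univ, Set.ncard_image_of_injective _ (algebraMap F E).injective, Set.ncard_univ,
      Nat.card_eq_fintype_card]
    exact this

theorem exists_algebraMap_of_bar_eq {x : E} (hx : bar F x = x) : ∃ y : F, algebraMap F E y = x := by
  have : x ∈ {x : E | bar F x = x} := hx
  rwa [setOf_bar_eq_self] at this

theorem ncard_bar_eq_self : {x : E | bar F x = x}.ncard = Fintype.card F := by
  rw [setOf_bar_eq_self, ← Set.image_univ, Set.ncard_image_of_injective _ (algebraMap F E).injective,
    Set.ncard_univ, Nat.card_eq_fintype_card]

/-- A trace fibre consists of roots of `X^q + X - d`, so it has at most `q` elements. The trace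
lands in the `q` fixed elements and `|E| = q·q`. -/
theorem ncard_trace_eq {d : E} (hd : bar F d = d) :
    {x : E | x + bar F x = d}.ncard = Fintype.card F := by
  have h1 := Fintype.one_lt_card (α := F)
  refine ncard_fiber_eq_of_le (fun x : E => x + bar F x) {x : E | bar F x = x} _ ?_ ?_ ?_ d hd
  · intro a
    simp [add_comm]
  · intro b _
    have hdeg : (Polynomial.X ^ Fintype.card F + Polynomial.X - Polynomial.C b :
        Polynomial E).natDegree = Fintype.card F := by
      rw [add_sub_assoc, Polynomial.natDegree_add_eq_left_of_natDegree_lt] <;> simp [h1]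
    have := ncard_roots_le (Polynomial.X ^ Fintype.card F + Polynomial.X - Polynomial.C b :
      Polynomial E) (by intro h; rw [h] at hdeg; simp at hdeg; omega)
    rw [hdeg] at this
    simpa [sub_eq_zero, bar_apply, add_comm] using this
  · rw [ncard_bar_eq_self, card_quadratic F, sq]

/-- The same counting on units: a norm fibre consists of roots of `X^(q+1) - d`, and `|E^×| =
(q-1)(q+1)`. -/
theorem ncard_norm_eq {d : E} (hd : bar F d = d) (hd0 : d ≠ 0) :
    {x : E | x * bar F x = d}.ncard = Fintype.card F + 1 := by
  have h1 := Fintype.one_lt_card (α := F)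
  set B : Set E := {x : E | bar F x = x ∧ x ≠ 0}
  have hB : B.ncard = Fintype.card F - 1 := by
    have : B = {x : E | bar F x = x} \ {0} := by ext; simp [B]
    rw [this, Set.ncard_sdiff_singleton_of_mem (by simp), ncard_bar_eq_self]
  have key := ncard_fiber_eq_of_le (fun x : Eˣ => (x : E) * bar F (x : E)) B (Fintype.card F + 1)
    ?_ ?_ ?_ d ⟨hd, hd0⟩
  · rw [← key, ← Set.ncard_image_of_injective _ Units.val_injective]
    congr 1; ext x
    constructor
    · intro hx
      have hx0 : x ≠ 0 := by rintro rfl; simp at hx; exact hd0 hx.symm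
      exact ⟨Units.mk0 x hx0, hx, rfl⟩
    · rintro ⟨x, hx, rfl⟩
      exact hx
  · intro a
    refine ⟨?_, mul_ne_zero a.ne_zero ((map_ne_zero _).2 a.ne_zero)⟩
    simp [mul_comm]
  · intro b _
    have hdeg : (Polynomial.X ^ (Fintype.card F + 1) - Polynomial.C b :
        Polynomial E).natDegree = Fintype.card F + 1 := Polynomial.natDegree_X_pow_sub_C
    have := ncard_roots_le (Polynomial.X ^ (Fintype.card F + 1) - Polynomial.C b :
      Polynomial E) (by intro h; rw [h] at hdeg; simp at hdeg)
    rw [hdeg] at this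
    refine le_trans ?_ this
    rw [← Set.ncard_image_of_injective _ Units.val_injective]
    refine Set.ncard_le_ncard ?_ (Set.toFinite _)
    rintro _ ⟨x, hx, rfl⟩
    simp only [Set.mem_ofPred_eq] at hx ⊢
    rw [Polynomial.eval_sub, Polynomial.eval_pow, Polynomial.eval_X, Polynomial.eval_C, ← hx,
      bar_apply, pow_succ', sub_self]
  · rw [hB, Nat.card_units, card_quadratic F, Nat.sub_mul, one_mul, Nat.mul_add, mul_one, ← sq]
    omega

theorem ncard_norm_zero : {x : E | x * bar F x = 0}.ncard = 1 := by
  have : {x : E | x * bar F x = 0} = {0} := by ext; simp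
  rw [this, Set.ncard_singleton]

theorem exists_mul_bar_eq {d : E} (hd : bar F d = d) : ∃ x : E, x * bar F x = d := by
  by_cases hd0 : d = 0
  · exact ⟨0, by simp [hd0]⟩
  · have : {x : E | x * bar F x = d}.Nonempty := by
      rw [← Set.ncard_pos, ncard_norm_eq F hd hd0]; omega
    exact this

/-- Multiples of `c` fill `E`, so otherwise the trace would vanish on all `q²` elements, whereas its
kernel has only `q`. -/
theorem exists_trace_ne_zero {c : E} (hc : c ≠ 0) : ∃ a : E, a * c + bar F (a * c) ≠ 0 := by
  by_contra! h
  have h1 := Fintype.one_lt_card (α := F)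
  have : {x : E | x + bar F x = 0} = Set.univ := by
    ext x
    simp only [Set.mem_ofPred_eq, Set.mem_univ, iff_true]
    have := h (x / c)
    rwa [div_mul_cancel₀ _ hc] at this
  have h2 := ncard_trace_eq F (map_zero (bar F) : bar F (0 : E) = 0)
  rw [this, Set.ncard_univ, card_quadratic F] at h2
  nlinarith

/-- The elements of norm one. -/
def normOne (F : Type*) [Field F] [Fintype F] (E : Type*) [Field E] [Algebra F E] : Set E :=
  {x : E | x * bar F x = 1}

theorem ncard_normOne : (normOne F E).ncard = Fintype.card F + 1 :=
  ncard_norm_eq F (map_one _) one_ne_zero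

variable {F} in
theorem ne_zero_of_mem_normOne {x : E} (hx : x ∈ normOne F E) : x ≠ 0 := by
  rintro rfl
  simp [normOne] at hx

end QuadraticExtension

/-! ### Hermitian spaces -/

/-- A non-degenerate hermitian form for the involution `x ↦ x ^ q`. -/
structure HermitianSpace (F : Type*) [Field F] [Fintype F] (E : Type*) [Field E] [Algebra F E]
    (V : Type*) [AddCommGroup V] [Module E V] where
  form : V → V → E
  add_left : ∀ x y z, form (x + y) z = form x z + form y z
  smul_left : ∀ (a : E) x y, form (a • x) y = a * form x y
  bar_form : ∀ x y, bar F (form x y) = form y x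
  nondeg : ∀ x, (∀ y, form x y = 0) → x = 0

namespace HermitianSpace

variable {F : Type*} [Field F] [Fintype F] {E : Type*} [Field E] [Algebra F E]
  {V : Type*} [AddCommGroup V] [Module E V] (h : HermitianSpace F E V)

theorem add_right (x y z : V) : h.form x (y + z) = h.form x y + h.form x z := by
  rw [← h.bar_form, h.add_left, map_add, h.bar_form, h.bar_form]

theorem smul_right (a : E) (x y : V) : h.form x (a • y) = bar F a * h.form x y := by
  rw [← h.bar_form, h.smul_left, map_mul, h.bar_form]

/-- The form as a linear map in the first variable. -/
def formLeft (y : V) : V →ₗ[E] E where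
  toFun x := h.form x y
  map_add' x x' := h.add_left x x' y
  map_smul' a x := h.smul_left a x y

theorem zero_left (y : V) : h.form 0 y = 0 := (h.formLeft y).map_zero
theorem zero_right (x : V) : h.form x 0 = 0 := by rw [← h.bar_form, zero_left, map_zero]
theorem sub_left (x y z : V) : h.form (x - y) z = h.form x z - h.form y z :=
  (h.formLeft z).map_sub x y
theorem sub_right (x y z : V) : h.form x (y - z) = h.form x y - h.form x z := by
  rw [← h.bar_form, h.sub_left, map_sub, h.bar_form, h.bar_form]
theorem form_eq_zero_comm (x y : V) : h.form x y = 0 ↔ h.form y x = 0 := by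
  rw [← h.bar_form y x, map_eq_zero]

/-- The orthogonal complement of a vector. -/
def perp (v : V) : Submodule E V := LinearMap.ker (h.formLeft v)

theorem mem_perp {v x : V} : x ∈ h.perp v ↔ h.form x v = 0 := Iff.rfl

theorem mem_perp' {v x : V} : x ∈ h.perp v ↔ h.form v x = 0 := by
  rw [mem_perp, form_eq_zero_comm]

theorem formLeft_ne_zero {v : V} (hv : v ≠ 0) : h.formLeft v ≠ 0 := by
  intro h0
  refine hv (h.nondeg v fun y => ?_)
  rw [form_eq_zero_comm]
  exact LinearMap.congr_fun h0 y

theorem finrank_perp [FiniteDimensional E V] {v : V} (hv : v ≠ 0) :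
    Module.finrank E (h.perp v) + 1 = Module.finrank E V :=
  Module.Dual.finrank_ker_add_one_of_ne_zero (h.formLeft_ne_zero hv)

/-- The restriction of the form to the orthogonal complement of a unit vector. -/
def perpSpace {v : V} (hv : h.form v v = 1) : HermitianSpace F E (h.perp v) where
  form x y := h.form x y
  add_left x y z := h.add_left x y z
  smul_left a x y := h.smul_left a x y
  bar_form x y := h.bar_form x y
  nondeg x hx := by
    refine Subtype.ext (h.nondeg _ fun y => ?_)
    have hy : y - h.form y v • v ∈ h.perp v := by
      rw [mem_perp, h.sub_left, h.smul_left, hv, mul_one, sub_self]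
    have := hx ⟨_, hy⟩
    simp only [h.sub_right, h.smul_right, h.mem_perp.1 x.2, mul_zero, sub_zero] at this
    exact this

theorem ne_zero_of_unit {v : V} (hv : h.form v v = 1) : v ≠ 0 := by
  rintro rfl
  simp [zero_left] at hv

/-- Splitting off a unit vector. -/
def splitUnit {v : V} (hv : h.form v v = 1) : V ≃ₗ[E] E × h.perp v where
  toFun x := (h.form x v, ⟨x - h.form x v • v, by
    rw [mem_perp, h.sub_left, h.smul_left, hv, mul_one, sub_self]⟩)
  invFun p := p.1 • v + p.2
  map_add' x y := by
    refine Prod.ext (h.add_left _ _ _) (Subtype.ext ?_)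
    simp only [h.add_left, add_smul, Prod.snd_add, Submodule.coe_add]
    abel
  map_smul' a x := by
    refine Prod.ext (h.smul_left _ _ _) (Subtype.ext ?_)
    simp only [h.smul_left, smul_sub, mul_smul, RingHom.id_apply, Prod.smul_snd, Submodule.coe_smul]
  left_inv x := by simp
  right_inv p := by
    have h1 : h.form (p.1 • v + p.2) v = p.1 := by
      rw [h.add_left, h.smul_left, hv, h.mem_perp.1 p.2.2, mul_one, add_zero]
    refine Prod.ext h1 (Subtype.ext ?_)
    simp [h1]

theorem splitUnit_symm_apply {v : V} (hv : h.form v v = 1) (p : E × h.perp v) :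
    (h.splitUnit hv).symm p = p.1 • v + p.2 := rfl

theorem form_split {v : V} (hv : h.form v v = 1) (a b : E) (x y : h.perp v) :
    h.form (a • v + x) (b • v + y) = a * bar F b + h.form x y := by
  rw [h.add_left, h.add_right, h.add_right, h.smul_left, h.smul_left, h.smul_right, h.smul_right, hv,
    h.mem_perp.1 x.2, h.mem_perp'.1 y.2]
  ring

variable [Finite E] [Fact (Module.finrank F E = 2)]

/-- Polarization: if all values `h(v, v)` vanish, expanding `h(ax + y, ax + y)` shows that `a h(x,
y)` has trace zero for every `a`, which forces `h(x, y) = 0`. -/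
theorem exists_anisotropic [Nontrivial V] : ∃ v : V, h.form v v ≠ 0 := by
  by_contra! h0
  obtain ⟨x, hx⟩ := exists_ne (0 : V)
  refine hx (h.nondeg x fun y => ?_)
  by_contra hxy
  obtain ⟨a, ha⟩ := exists_trace_ne_zero F hxy
  refine ha ?_
  have := h0 (a • x + y)
  rw [h.add_left, h.add_right, h.add_right, h.smul_left, h.smul_left, h.smul_right, h0 x, h0 y] at this
  rw [map_mul, h.bar_form]
  simpa [h.smul_right] using this

theorem exists_unit_smul {v : V} (hv : h.form v v ≠ 0) :
    ∃ a : E, a ≠ 0 ∧ h.form (a • v) (a • v) = 1 := by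
  obtain ⟨a, ha⟩ := exists_mul_bar_eq F (d := (h.form v v)⁻¹) (by rw [map_inv₀, h.bar_form])
  refine ⟨a, ?_, ?_⟩
  · rintro rfl
    simp at ha; exact hv ha.symm
  · rw [h.smul_left, h.smul_right, ← mul_assoc, ha, inv_mul_cancel₀ hv]

theorem exists_unit [Nontrivial V] : ∃ v : V, h.form v v = 1 := by
  obtain ⟨v, hv⟩ := h.exists_anisotropic
  obtain ⟨a, -, ha⟩ := h.exists_unit_smul hv
  exact ⟨_, ha⟩

/-- The number of vectors with given value of the form, from a hyperplane to the whole space. -/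
theorem ncard_form_eq [Finite V] {v : V} (hv : h.form v v = 1) {b : E} (hb : bar F b = b) :
    -- Splitting off `v` turns the equation into `N(a) = b - h(x, x)` with `x` orthogonal to `v`. It
    -- has one solution `a` when `h(x, x) = b` and `q+1` solutions otherwise.
    ({x : V | h.form x x = b}.ncard : ℤ) = (Fintype.card F + 1) * Nat.card (h.perp v)
      - Fintype.card F * {x : h.perp v | h.form x x = b}.ncard := by
  set S : Set (E × h.perp v) := {p | p.1 * bar F p.1 = b - h.form p.2 p.2} with hS
  set A : Set (h.perp v) := {x : h.perp v | h.form x x = b} with hA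
  have e : {x : V | h.form x x = b}.ncard = S.ncard := by
    rw [← Set.ncard_image_of_injective _ (h.splitUnit hv).injective]
    congr 1; ext p
    constructor
    · rintro ⟨x, hx, rfl⟩
      obtain ⟨p, rfl⟩ := (h.splitUnit hv).symm.surjective x
      rw [LinearEquiv.apply_symm_apply]
      rw [Set.mem_ofPred_eq, splitUnit_symm_apply, form_split _ hv] at hx
      exact eq_sub_of_add_eq hx
    · intro hp
      refine ⟨(h.splitUnit hv).symm p, ?_, LinearEquiv.apply_symm_apply _ _⟩
      rw [Set.mem_ofPred_eq, splitUnit_symm_apply, form_split _ hv]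
      rw [hS, Set.mem_ofPred_eq] at hp
      rw [hp, sub_add_cancel]
  have h1 : {p | p ∈ S ∧ p.2 ∈ A}.ncard = A.ncard * 1 := by
    refine ncard_eq_mul_of_fibers (fun p => p.2) (fun p hp => hp.2) fun x hx => ?_
    rw [← ncard_norm_zero F (E := E), ← Set.ncard_image_of_injective
      {x : E | x * bar F x = 0} (f := fun a => (a, x)) (fun a b h => congrArg Prod.fst h)]
    congr 1; ext ⟨a, y⟩
    simp only [hA, Set.mem_ofPred_eq] at hx
    simp only [hS, hA, Set.mem_ofPred_eq, Set.mem_image, Prod.mk.injEq]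
    constructor
    · rintro ⟨⟨h1, h2⟩, rfl⟩
      exact ⟨a, by rw [h1, h2, sub_self], rfl, rfl⟩
    · rintro ⟨a, h1, rfl, rfl⟩
      exact ⟨⟨by rw [h1, hx, sub_self], hx⟩, rfl⟩
  have h2 : {p | p ∈ S ∧ p.2 ∉ A}.ncard = Aᶜ.ncard * (Fintype.card F + 1) := by
    refine ncard_eq_mul_of_fibers (fun p => p.2) (fun p hp => hp.2) fun x hx => ?_
    have hx' : b - h.form x x ≠ 0 := sub_ne_zero.2 (Ne.symm hx)
    rw [← ncard_norm_eq F (d := b - h.form x x) (by rw [map_sub, hb, h.bar_form]) hx',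
      ← Set.ncard_image_of_injective
      {a : E | a * bar F a = b - h.form x x} (f := fun a => (a, x)) (fun a b h => congrArg Prod.fst h)]
    congr 1; ext ⟨a, y⟩
    simp only [hA, Set.mem_ofPred_eq, Set.mem_compl_iff] at hx
    simp only [hS, hA, Set.mem_ofPred_eq, Set.mem_image, Prod.mk.injEq]
    constructor
    · rintro ⟨⟨h1, h2⟩, rfl⟩
      exact ⟨a, h1, rfl, rfl⟩
    · rintro ⟨a, h1, rfl, rfl⟩
      exact ⟨⟨h1, hx⟩, rfl⟩
  have h3 : S.ncard = {p | p ∈ S ∧ p.2 ∈ A}.ncard + {p | p ∈ S ∧ p.2 ∉ A}.ncard := by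
    rw [← Set.ncard_union_eq]
    · congr 1; ext p
      simp only [Set.mem_union, Set.mem_ofPred_eq, ← and_or_left, em, and_true]
    · rw [Set.disjoint_left]
      rintro p hp hp'
      exact hp'.2 hp.2
  have h4 := Set.ncard_add_ncard_compl A
  rw [e, h3, h1, h2]
  push_cast
  rw [← h4]
  push_cast
  ring

theorem card_space [FiniteDimensional E V] : Nat.card V = Fintype.card F ^ (2 * Module.finrank E V) := by
  rw [Module.natCard_eq_pow_finrank (K := E), card_quadratic F, pow_mul]

theorem nontrivial_of_finrank {n : ℕ} (hn : Module.finrank E V = n + 1) : Nontrivial V :=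
  Module.nontrivial_of_finrank_pos (R := E) (by omega)

/-- A hermitian line has no isotropic vector except 0, and `ncard_form_eq` passes from the line to
the plane. The counts in dimension three below come from the same recursion. -/
theorem ncard_form_eq_zero_two [FiniteDimensional E V] (hn : Module.finrank E V = 2) :
    ({x : V | h.form x x = 0}.ncard : ℤ)
      = Fintype.card F ^ 3 + Fintype.card F ^ 2 - Fintype.card F := by
  have := Module.finite_of_finite E (M := V)
  have := nontrivial_of_finrank (E := E) (V := V) hn
  obtain ⟨v, hv⟩ := h.exists_unit
  have hd := h.finrank_perp (h.ne_zero_of_unit hv)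
  rw [hn] at hd
  have hd1 : Module.finrank E (h.perp v) = 1 := by omega
  have := nontrivial_of_finrank (E := E) (V := h.perp v) hd1
  obtain ⟨w, hw⟩ := (h.perpSpace hv).exists_unit
  have hz : {x : h.perp v | h.form x x = 0} = {0} := by
    ext x
    obtain ⟨a, rfl⟩ := (finrank_eq_one_iff_of_nonzero' w ((h.perpSpace hv).ne_zero_of_unit hw)).1 hd1 x
    have hw' : h.form w w = 1 := hw
    simp [h.smul_left, h.smul_right, hw', (h.perpSpace hv).ne_zero_of_unit hw]
  rw [h.ncard_form_eq hv (map_zero _), hz, Set.ncard_singleton, card_space (F := F) (E := E), hd1]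
  push_cast
  ring

theorem ncard_form_eq_one_one [FiniteDimensional E V] (hn : Module.finrank E V = 1) :
    {x : V | h.form x x = 1}.ncard = Fintype.card F + 1 := by
  have := nontrivial_of_finrank (E := E) (V := V) hn
  obtain ⟨w, hw⟩ := h.exists_unit
  have hw0 := h.ne_zero_of_unit hw
  rw [← ncard_normOne F (E := E), ← Set.ncard_image_of_injective (normOne F E) (smul_left_injective E hw0)]
  congr 1; ext x
  obtain ⟨a, rfl⟩ := (finrank_eq_one_iff_of_nonzero' w hw0).1 hn x
  simp only [Set.mem_ofPred_eq, Set.mem_image, h.smul_left, h.smul_right, hw, mul_one]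
  constructor
  · intro ha; exact ⟨a, ha, rfl⟩
  · rintro ⟨b, hb, hba⟩
    rw [← smul_left_injective E hw0 hba]; exact hb

theorem ncard_form_eq_one_two [FiniteDimensional E V] (hn : Module.finrank E V = 2) :
    ({x : V | h.form x x = 1}.ncard : ℤ) = Fintype.card F * (Fintype.card F ^ 2 - 1) := by
  have := Module.finite_of_finite E (M := V)
  have := nontrivial_of_finrank (E := E) (V := V) hn
  obtain ⟨v, hv⟩ := h.exists_unit
  have hd := h.finrank_perp (h.ne_zero_of_unit hv)
  rw [hn] at hd
  have hd1 : Module.finrank E (h.perp v) = 1 := by omega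
  have := (h.perpSpace hv).ncard_form_eq_one_one hd1
  rw [h.ncard_form_eq hv (map_one _), card_space (F := F) (E := E), hd1]
  erw [this]
  push_cast
  ring

theorem ncard_form_eq_zero_three [FiniteDimensional E V] (hn : Module.finrank E V = 3) :
    ({x : V | h.form x x = 0}.ncard : ℤ)
      = Fintype.card F ^ 5 - Fintype.card F ^ 3 + Fintype.card F ^ 2 := by
  have := Module.finite_of_finite E (M := V)
  have := nontrivial_of_finrank (E := E) (V := V) hn
  obtain ⟨v, hv⟩ := h.exists_unit
  have hd := h.finrank_perp (h.ne_zero_of_unit hv)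
  rw [hn] at hd
  have hd1 : Module.finrank E (h.perp v) = 2 := by omega
  have := (h.perpSpace hv).ncard_form_eq_zero_two hd1
  rw [h.ncard_form_eq hv (map_zero _), card_space (F := F) (E := E), hd1]
  erw [this]
  push_cast
  ring

theorem ncard_form_eq_one_three [FiniteDimensional E V] (hn : Module.finrank E V = 3) :
    ({x : V | h.form x x = 1}.ncard : ℤ)
      = Fintype.card F ^ 5 + Fintype.card F ^ 2 := by
  have := Module.finite_of_finite E (M := V)
  have := nontrivial_of_finrank (E := E) (V := V) hn
  obtain ⟨v, hv⟩ := h.exists_unit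
  have hd := h.finrank_perp (h.ne_zero_of_unit hv)
  rw [hn] at hd
  have hd1 : Module.finrank E (h.perp v) = 2 := by omega
  have := (h.perpSpace hv).ncard_form_eq_one_two hd1
  rw [h.ncard_form_eq hv (map_one _), card_space (F := F) (E := E), hd1]
  erw [this]
  push_cast
  ring

end HermitianSpace

/-! ### Common eigenspaces of tuples -/

/-- The common eigenspace of a tuple of endomorphisms. -/
def eigen {E V : Type*} [Field E] [AddCommGroup V] [Module E V] {k : ℕ}
    (t : Fin k → Module.End E V) (χ : Fin k → E) : Submodule E V where
  carrier := {w | ∀ i, t i w = χ i • w}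
  add_mem' ha hb i := by rw [map_add, ha i, hb i, smul_add]
  zero_mem' i := by simp
  smul_mem' c x hx i := by rw [map_smul, hx i, smul_comm]

theorem mem_eigen {E V : Type*} [Field E] [AddCommGroup V] [Module E V] {k : ℕ}
    {t : Fin k → Module.End E V} {χ : Fin k → E} {w : V} :
    w ∈ eigen t χ ↔ ∀ i, t i w = χ i • w := Iff.rfl

/-- The tuple of homotheties with given ratios. -/
def scalarTuple {E : Type*} (V : Type*) [Field E] [AddCommGroup V] [Module E V] {k : ℕ}
    (χ : Fin k → E) : Fin k → Module.End E V := fun i => χ i • 1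

theorem eigen_eq_top_iff {E V : Type*} [Field E] [AddCommGroup V] [Module E V] {k : ℕ}
    {t : Fin k → Module.End E V} {χ : Fin k → E} : eigen t χ = ⊤ ↔ t = scalarTuple V χ := by
  constructor
  · intro h0
    funext i
    ext w
    have : w ∈ eigen t χ := h0 ▸ Submodule.mem_top
    exact this i
  · rintro rfl
    rw [Submodule.eq_top_iff']
    intro w i
    rfl

/-- The tuples of elements of norm one. -/
def normOneTuples (F : Type*) [Field F] [Fintype F] (E : Type*) [Field E] [Algebra F E] (k : ℕ) :
    Set (Fin k → E) := {χ | ∀ i, χ i ∈ normOne F E}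

theorem ncard_normOneTuples (F : Type*) [Field F] [Fintype F] (E : Type*) [Field E] [Algebra F E]
    [Finite E] [Fact (Module.finrank F E = 2)] (k : ℕ) :
    (normOneTuples F E k).ncard = (Fintype.card F + 1) ^ k := by
  rw [normOneTuples, ncard_pi_const, ncard_normOne]

theorem card_nonzero_of_finrank_one {E V : Type*} [Field E] [Finite E] [AddCommGroup V] [Module E V]
    {K : Submodule E V} (hK : Module.finrank E K = 1) :
    {w : V | w ∈ K ∧ w ≠ 0}.ncard = Nat.card E - 1 := by
  have : FiniteDimensional E K := Module.finite_of_finrank_pos (by omega)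
  have : Finite K := Module.finite_of_finite E
  have e : {w : V | w ∈ K ∧ w ≠ 0} = (K : Set V) \ {0} := by ext; simp
  rw [e, Set.ncard_sdiff_singleton_of_mem (by simp)]
  have := Module.natCard_eq_pow_finrank (K := E) (V := K)
  rw [hK, pow_one] at this
  rw [← this]; rfl

theorem exists_smul_of_finrank_one {E V : Type*} [Field E] [AddCommGroup V] [Module E V]
    {K : Submodule E V} (hK : Module.finrank E K = 1) {v w : V} (hv : v ∈ K) (hv0 : v ≠ 0)
    (hw : w ∈ K) : ∃ a : E, w = a • v := by
  obtain ⟨a, ha⟩ := (finrank_eq_one_iff_of_nonzero' (⟨v, hv⟩ : K) (by simpa using hv0)).1 hK ⟨w, hw⟩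
  exact ⟨a, (congrArg Subtype.val ha).symm⟩

/-! ### Isometries, orthogonal splittings and stabilisers of isotropic vectors in a plane -/

namespace HermitianSpace

variable {F : Type*} [Field F] [Fintype F] {E : Type*} [Field E] [Algebra F E]
  {V : Type*} [AddCommGroup V] [Module E V] (h : HermitianSpace F E V)

/-- The isometries of a hermitian space. -/
def isom : Set (Module.End E V) := {g | ∀ x y, h.form (g x) (g y) = h.form x y}

variable {h} in
theorem isom_injective {g : Module.End E V} (hg : g ∈ h.isom) : Function.Injective g := by
  rw [injective_iff_map_eq_zero]
  intro x hx
  refine h.nondeg x fun y => ?_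
  rw [← hg x y, hx, zero_left]

/-- The commuting tuples of isometries. -/
abbrev tuples (k : ℕ) : Set (Fin k → Module.End E V) := commTuples h.isom k

theorem scalarTuple_mem_tuples {k : ℕ} {χ : Fin k → E} (hχ : χ ∈ normOneTuples F E k) :
    scalarTuple V χ ∈ h.tuples k := by
  refine ⟨fun i x y => ?_, fun i j => ?_⟩
  · simp only [scalarTuple, LinearMap.smul_apply, Module.End.one_apply, h.smul_left, h.smul_right,
      ← mul_assoc]
    rw [show χ i * bar F (χ i) = 1 from hχ i, one_mul]
  · simp only [scalarTuple, smul_mul_smul_comm, mul_one, mul_comm]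

variable {h} in
theorem eigenvalue_mem_normOne {g : Module.End E V} (hg : g ∈ h.isom) {v : V} {a : E}
    (hv : h.form v v ≠ 0) (hgv : g v = a • v) : a ∈ normOne F E := by
  have := hg v v
  rw [hgv, h.smul_left, h.smul_right, ← mul_assoc] at this
  exact mul_right_cancel₀ hv (by rw [this, one_mul])

variable {h} in
-- Invariance gives `h(w, v) = b ā h(w, v)`. A nonzero value would make `b` the inverse of `ā`,
-- which is `a` because `a` has norm one. The eigenvalue `b` may be arbitrary.
theorem form_eq_zero_of_eigen {g : Module.End E V} (hg : g ∈ h.isom) {v w : V} {a b : E}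
    (ha : a ∈ normOne F E) (hab : a ≠ b) (hgv : g v = a • v) (hgw : g w = b • w) :
    h.form w v = 0 := by
  by_contra h0
  have h1 := hg w v
  rw [hgv, hgw, h.smul_left, h.smul_right, ← mul_assoc] at h1
  have h2 : b * bar F a = 1 := mul_right_cancel₀ h0 (by rw [h1, one_mul])
  have h3 : a * bar F a = 1 := ha
  refine hab (mul_right_cancel₀ (b := bar F a) ?_ (h3.trans h2.symm))
  intro h4
  rw [h4, mul_zero] at h3
  exact zero_ne_one h3

variable {h} in
theorem perp_stable {g : Module.End E V} (hg : g ∈ h.isom) {v x : V} {a : E} (hgv : g v = a • v)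
    (hx : x ∈ h.perp v) : g x ∈ h.perp v := by
  by_cases hv : v = 0
  · rw [mem_perp, hv, zero_right]
  have ha : a ≠ 0 := by
    rintro rfl
    rw [zero_smul] at hgv
    exact hv (isom_injective hg (by rw [hgv, map_zero]))
  have h1 := hg x v
  rw [hgv, h.smul_right, h.mem_perp.1 hx] at h1
  exact (mul_eq_zero.1 h1).resolve_left ((map_ne_zero _).2 ha)

/-- An endomorphism assembled from a scalar on a unit vector and an endomorphism of its
orthogonal complement. -/
def glue {v : V} (hv : h.form v v = 1) : E × Module.End E (h.perp v) →* Module.End E V where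
  toFun p := (h.splitUnit hv).symm.toLinearMap ∘ₗ
    (LinearMap.prodMap (p.1 • LinearMap.id) p.2) ∘ₗ (h.splitUnit hv).toLinearMap
  map_one' := by
    ext x
    simp [Module.End.one_eq_id]
  map_mul' p p' := by
    ext x
    simp [mul_smul, Module.End.mul_apply]

theorem glue_apply {v : V} (hv : h.form v v = 1) (p : E × Module.End E (h.perp v)) (b : E)
    (x : h.perp v) : h.glue hv p (b • v + x) = (p.1 * b) • v + p.2 x := by
  have : b • v + (x : V) = (h.splitUnit hv).symm (b, x) := rfl
  rw [this]
  change (h.splitUnit hv).symm (LinearMap.prodMap (p.1 • LinearMap.id) p.2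
    (h.splitUnit hv ((h.splitUnit hv).symm (b, x)))) = _
  rw [LinearEquiv.apply_symm_apply]
  rfl

theorem glue_self {v : V} (hv : h.form v v = 1) (p : E × Module.End E (h.perp v)) :
    h.glue hv p v = p.1 • v := by
  have := h.glue_apply hv p 1 0
  simpa using this

theorem glue_perp {v : V} (hv : h.form v v = 1) (p : E × Module.End E (h.perp v)) (x : h.perp v) :
    h.glue hv p x = p.2 x := by
  have := h.glue_apply hv p 0 x
  simpa using this

theorem exists_split {v : V} (hv : h.form v v = 1) (x : V) :
    ∃ (b : E) (y : h.perp v), x = b • v + y :=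
  ⟨_, _, ((h.splitUnit hv).symm_apply_apply x).symm⟩

theorem glue_injective {v : V} (hv : h.form v v = 1) : Function.Injective (h.glue hv) := by
  rintro ⟨a, g⟩ ⟨a', g'⟩ hp
  have h1 := congrFun (congrArg DFunLike.coe hp) v
  rw [glue_self, glue_self] at h1
  refine Prod.ext (smul_left_injective E (h.ne_zero_of_unit hv) h1) ?_
  ext x
  have h2 := congrFun (congrArg DFunLike.coe hp) (x : V)
  rwa [glue_perp, glue_perp] at h2

theorem glue_mem_isom {v : V} (hv : h.form v v = 1) (p : E × Module.End E (h.perp v)) :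
    h.glue hv p ∈ h.isom ↔ p.1 ∈ normOne F E ∧ p.2 ∈ (h.perpSpace hv).isom := by
  constructor
  · intro hp
    constructor
    · exact eigenvalue_mem_normOne hp (by rw [hv]; exact one_ne_zero) (h.glue_self hv p)
    · intro x y
      change h.form (p.2 x) (p.2 y) = h.form x y
      rw [← glue_perp h hv, ← glue_perp h hv]
      exact hp _ _
  · rintro ⟨h1, h2⟩ x y
    obtain ⟨b, x, rfl⟩ := h.exists_split hv x
    obtain ⟨c, y, rfl⟩ := h.exists_split hv y
    rw [glue_apply, glue_apply, h.form_split hv, h.form_split hv, map_mul]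
    have h3 : p.1 * bar F p.1 = 1 := h1
    have h4 : h.form (p.2 x) (p.2 y) = h.form x y := h2 x y
    rw [h4]
    linear_combination (b * bar F c) * h3

theorem exists_glue {v : V} (hv : h.form v v = 1) {g : Module.End E V} (hg : g ∈ h.isom) {a : E}
    (hgv : g v = a • v) : ∃ g', h.glue hv (a, g') = g := by
  have hst : ∀ x ∈ h.perp v, g x ∈ h.perp v := fun x hx => perp_stable hg hgv hx
  refine ⟨g.restrict hst, ?_⟩
  ext x
  obtain ⟨b, x, rfl⟩ := h.exists_split hv x
  rw [glue_apply, map_add, map_smul, hgv, smul_smul, mul_comm]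
  rfl

/-- Tuples stabilising a unit vector up to scalars, in terms of tuples of its complement. -/
def glueTuple {v : V} (hv : h.form v v = 1) {k : ℕ}
    (p : (Fin k → E) × (Fin k → Module.End E (h.perp v))) : Fin k → Module.End E V :=
  fun i => h.glue hv (p.1 i, p.2 i)

theorem glueTuple_injective {v : V} (hv : h.form v v = 1) (k : ℕ) :
    Function.Injective (h.glueTuple hv (k := k)) := by
  intro p p' hp
  have : ∀ i, (p.1 i, p.2 i) = (p'.1 i, p'.2 i) := fun i => h.glue_injective hv (congrFun hp i)
  exact Prod.ext (funext fun i => congrArg Prod.fst (this i)) (funext fun i => congrArg Prod.snd (this i))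

theorem glueTuple_mem_tuples {v : V} (hv : h.form v v = 1) {k : ℕ}
    {p : (Fin k → E) × (Fin k → Module.End E (h.perp v))} :
    h.glueTuple hv p ∈ h.tuples k ↔ p.1 ∈ normOneTuples F E k ∧ p.2 ∈ (h.perpSpace hv).tuples k := by
  constructor
  · rintro ⟨h1, h2⟩
    refine ⟨fun i => ((h.glue_mem_isom hv _).1 (h1 i)).1,
      fun i => ((h.glue_mem_isom hv _).1 (h1 i)).2, fun i j => ?_⟩
    have := h2 i j
    simp only [glueTuple, ← map_mul] at this
    exact congrArg Prod.snd (h.glue_injective hv this)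
  · rintro ⟨h1, h2, h3⟩
    refine ⟨fun i => (h.glue_mem_isom hv _).2 ⟨h1 i, h2 i⟩, fun i j => ?_⟩
    simp only [glueTuple, ← map_mul]
    congr 1
    exact Prod.ext (mul_comm _ _) (h3 i j)

theorem self_mem_eigen_glueTuple {v : V} (hv : h.form v v = 1) {k : ℕ}
    (p : (Fin k → E) × (Fin k → Module.End E (h.perp v))) : v ∈ eigen (h.glueTuple hv p) p.1 :=
  fun i => h.glue_self hv (p.1 i, p.2 i)

theorem mem_eigen_glueTuple {v : V} (hv : h.form v v = 1) {k : ℕ}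
    (p : (Fin k → E) × (Fin k → Module.End E (h.perp v))) (x : h.perp v) (χ : Fin k → E) :
    (x : V) ∈ eigen (h.glueTuple hv p) χ ↔ x ∈ eigen p.2 χ := by
  simp only [mem_eigen, glueTuple, glue_perp]
  exact forall_congr' fun i => ⟨fun h => Subtype.ext h, fun h => congrArg Subtype.val h⟩

theorem exists_glueTuple {v : V} (hv : h.form v v = 1) {k : ℕ} {t : Fin k → Module.End E V}
    (ht : t ∈ h.tuples k) {χ : Fin k → E} (hχ : v ∈ eigen t χ) :
    ∃ t', h.glueTuple hv (χ, t') = t := by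
  have : ∀ i, ∃ g', h.glue hv (χ i, g') = t i := fun i => h.exists_glue hv (ht.1 i) (hχ i)
  choose t' ht' using this
  exact ⟨t', funext ht'⟩

/-- The number of commuting tuples acting on a given unit vector by a given character. -/
theorem ncard_eigen_unit {v : V} (hv : h.form v v = 1) {k : ℕ} {χ : Fin k → E}
    (hχ : χ ∈ normOneTuples F E k) :
    {t | t ∈ h.tuples k ∧ v ∈ eigen t χ}.ncard = numComm (h.perpSpace hv).isom k := by
  rw [numComm, ← Set.ncard_image_of_injective (commTuples (h.perpSpace hv).isom k)
    (f := fun t' => h.glueTuple hv (χ, t'))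
    (fun a b hab => congrArg Prod.snd (h.glueTuple_injective hv k hab))]
  congr 1; ext t
  constructor
  · rintro ⟨h1, h2⟩
    obtain ⟨t', rfl⟩ := h.exists_glueTuple hv h1 h2
    exact ⟨t', ((h.glueTuple_mem_tuples hv).1 h1).2, rfl⟩
  · rintro ⟨t', ht', rfl⟩
    exact ⟨(h.glueTuple_mem_tuples hv).2 ⟨hχ, ht'⟩, h.self_mem_eigen_glueTuple hv _⟩

theorem numComm_isom_of_finrank_one [Finite E] [Fact (Module.finrank F E = 2)]
    (hn : Module.finrank E V = 1) (k : ℕ) : numComm h.isom k = (Fintype.card F + 1) ^ k := by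
  have := nontrivial_of_finrank (E := E) (V := V) hn
  obtain ⟨w, hw⟩ := h.exists_unit
  have hw0 := h.ne_zero_of_unit hw
  have key : h.isom = (fun a : E => (a • 1 : Module.End E V)) '' normOne F E := by
    ext g
    constructor
    · intro hg
      obtain ⟨a, ha⟩ := (finrank_eq_one_iff_of_nonzero' w hw0).1 hn (g w)
      refine ⟨a, eigenvalue_mem_normOne hg (by rw [hw]; exact one_ne_zero) ha.symm, ?_⟩
      ext x
      obtain ⟨b, rfl⟩ := (finrank_eq_one_iff_of_nonzero' w hw0).1 hn x
      simp [← ha, smul_smul, mul_comm]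
    · rintro ⟨a, ha, rfl⟩ x y
      simp only [LinearMap.smul_apply, Module.End.one_apply, h.smul_left, h.smul_right, ← mul_assoc]
      rw [show a * bar F a = 1 from ha, one_mul]
  rw [numComm_of_commute, key, Set.ncard_image_of_injective, ncard_normOne]
  · intro a b hab
    have := congrFun (congrArg DFunLike.coe hab) w
    exact smul_left_injective E hw0 this
  · rw [key]
    rintro _ ⟨a, -, rfl⟩ _ ⟨b, -, rfl⟩
    simp only [smul_mul_smul_comm, mul_one, mul_comm]

variable [Finite E] [Fact (Module.finrank F E = 2)]

/-- An isotropic vector belongs to a hyperbolic pair. -/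
theorem exists_hyperbolic {v : V} (hv0 : v ≠ 0) (hv : h.form v v = 0) :
    ∃ w, h.form v w = 1 ∧ h.form w w = 0 := by
  have : ∃ y, h.form v y ≠ 0 := by
    by_contra! h0
    exact hv0 (h.nondeg v h0)
  obtain ⟨y, hy⟩ := this
  obtain ⟨z, h1⟩ : ∃ z, h.form v z = 1 := ⟨bar F (h.form v y)⁻¹ • y, by
    rw [h.smul_right, bar_bar, inv_mul_cancel₀ hy]⟩
  have h1' : h.form z v = 1 := by rw [← h.bar_form, h1, map_one]
  -- Replacing `z` by `z - c v` lowers `h(z, z)` by the trace of `c` and leaves `h(v, z)` unchanged.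
  -- Surjectivity of the trace makes the result isotropic.
  have : {x : E | x + bar F x = h.form z z}.Nonempty := by
    rw [← Set.ncard_pos, ncard_trace_eq F (h.bar_form z z)]
    exact Fintype.card_pos
  obtain ⟨c, hc⟩ := this
  refine ⟨z - c • v, ?_, ?_⟩
  · rw [h.sub_right, h.smul_right, hv, h1, mul_zero, sub_zero]
  · rw [h.sub_left, h.sub_right, h.sub_right, h.smul_left, h.smul_left, h.smul_right, h.smul_right, hv,
      h1, h1', ← show c + bar F c = h.form z z from hc]
    ring

/-- The endomorphism `x ↦ h(x, v) v`. -/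
def rankOne (v : V) : Module.End E V := (h.formLeft v).smulRight v

@[simp] theorem rankOne_apply (v x : V) : h.rankOne v x = h.form x v • v := rfl

/-- In a plane `v^⊥` is the line of `v` itself. An isometry with eigenvector `v` then sends a
hyperbolic partner `w` to `a w + b v`, and isotropy of the image says that `a⁻¹ b` has trace zero.
So the isometry is `a` times a transvection. -/
theorem mem_isom_plane_iff [FiniteDimensional E V] (hn : Module.finrank E V = 2) {v : V} (hv0 : v ≠ 0)
    (hv : h.form v v = 0) {a : E} (ha : a ∈ normOne F E) (g : Module.End E V) :
    (g ∈ h.isom ∧ g v = a • v) ↔ ∃ c : E, c + bar F c = 0 ∧ g = a • (1 + c • h.rankOne v) := by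
  have ha' : a * bar F a = 1 := ha
  have ha0 := ne_zero_of_mem_normOne ha
  constructor
  · rintro ⟨hg, hgv⟩
    obtain ⟨w, hvw, hww⟩ := h.exists_hyperbolic hv0 hv
    have hwv : h.form w v = 1 := by rw [← h.bar_form, hvw, map_one]
    have hd := h.finrank_perp hv0
    have hd1 : Module.finrank E (h.perp v) = 1 := by omega
    have hvp : v ∈ h.perp v := hv
    have hgw : g w - a • w ∈ h.perp v := by
      rw [mem_perp, h.sub_left, h.smul_left, hwv]
      have := hg w v
      rw [hgv, h.smul_right, hwv] at this
      have h2 : bar F a ≠ 0 := (map_ne_zero _).2 ha0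
      have : h.form (g w) v = a := mul_left_cancel₀ h2 (by rw [this, mul_comm, ha'])
      rw [this, mul_one, sub_self]
    obtain ⟨b, hb⟩ := exists_smul_of_finrank_one hd1 hvp hv0 hgw
    have hgw' : g w = a • w + b • v := by rw [← hb]; abel
    refine ⟨a⁻¹ * b, ?_, ?_⟩
    · have := hg w w
      rw [hgw', h.add_left, h.add_right, h.add_right, h.smul_left, h.smul_left, h.smul_right, h.smul_right,
        h.smul_left, h.smul_left, h.smul_right, h.smul_right, hww, hv, hvw, hwv] at this
      have e : a⁻¹ = bar F a := inv_eq_of_mul_eq_one_right ha'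
      rw [map_mul, map_inv₀, ← e, inv_inv, e]
      linear_combination this
    · ext x
      have hx : x - h.form x v • w ∈ h.perp v := by
        rw [mem_perp, h.sub_left, h.smul_left, hwv, mul_one, sub_self]
      obtain ⟨d, hd⟩ := exists_smul_of_finrank_one hd1 hvp hv0 hx
      have hx' : x = h.form x v • w + d • v := by rw [← hd]; abel
      have e1 : g x = h.form x v • g w + d • g v := by
        conv_lhs => rw [hx', map_add, map_smul, map_smul]
      rw [e1, hgw', hgv]
      simp only [LinearMap.smul_apply, LinearMap.add_apply, Module.End.one_apply, rankOne_apply]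
      have e2 : a • (x + (a⁻¹ * b) • h.form x v • v) = a • x + (b * h.form x v) • v := by
        rw [smul_add, smul_smul, smul_smul, ← mul_assoc, mul_inv_cancel₀ ha0, one_mul]
      rw [e2]
      conv_rhs => rw [hx']
      have e3 : h.form (h.form x v • w + d • v) v = h.form x v := by rw [← hx']
      rw [e3]
      module
  · rintro ⟨c, hc, rfl⟩
    constructor
    · intro x y
      simp only [LinearMap.smul_apply, LinearMap.add_apply, Module.End.one_apply, rankOne_apply,
        h.smul_left, h.smul_right, h.add_left, h.add_right, hv]
      rw [h.bar_form]
      linear_combination (h.form x y) * ha' +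
        (a * bar F a) * (h.form x v * h.form v y) * hc
    · simp [hv]

/-- The number of commuting tuples acting on an isotropic vector of a plane by a given character. -/
theorem ncard_eigen_isotropic [FiniteDimensional E V] (hn : Module.finrank E V = 2) {v : V}
    (hv0 : v ≠ 0) (hv : h.form v v = 0) {k : ℕ} {χ : Fin k → E} (hχ : χ ∈ normOneTuples F E k) :
    {t | t ∈ h.tuples k ∧ v ∈ eigen t χ}.ncard = Fintype.card F ^ k := by
  have hinj : Set.InjOn (fun (c : Fin k → E) i => χ i • (1 + c i • h.rankOne v))
      {c | ∀ i, c i ∈ {x : E | x + bar F x = 0}} := by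
    intro c _ c' _ hcc
    obtain ⟨w, hvw, -⟩ := h.exists_hyperbolic hv0 hv
    have hwv : h.form w v = 1 := by rw [← h.bar_form, hvw, map_one]
    funext i
    have := congrFun (congrArg DFunLike.coe (congrFun hcc i)) w
    simp only [LinearMap.smul_apply, LinearMap.add_apply, Module.End.one_apply, rankOne_apply, hwv,
      one_smul] at this
    have h1 : w + c i • v = w + c' i • v :=
      smul_right_injective V (ne_zero_of_mem_normOne (hχ i)) this
    exact smul_left_injective E hv0 (add_left_cancel h1)
  rw [← ncard_trace_eq F (map_zero (bar F) : bar F (0 : E) = 0), ← ncard_pi_const,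
    ← hinj.ncard_image]
  · congr 1; ext t
    constructor
    · rintro ⟨h1, h2⟩
      have : ∀ i, ∃ c : E, c + bar F c = 0 ∧ t i = χ i • (1 + c • h.rankOne v) := fun i =>
        (h.mem_isom_plane_iff hn hv0 hv (hχ i) (t i)).1 ⟨h1.1 i, h2 i⟩
      choose c hc1 hc2 using this
      exact ⟨c, hc1, funext fun i => (hc2 i).symm⟩
    · rintro ⟨c, hc, rfl⟩
      have := fun i => (h.mem_isom_plane_iff hn hv0 hv (hχ i)
        (χ i • (1 + c i • h.rankOne v))).2 ⟨c i, hc i, rfl⟩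
      refine ⟨⟨fun i => (this i).1, fun i j => ?_⟩, fun i => (this i).2⟩
      -- Since `v` is isotropic these transvections form an abelian group, so commutation imposes no
      -- condition on the parameters.
      have hN : h.rankOne v * h.rankOne v = 0 := by
        ext x; simp [Module.End.mul_apply, hv]
      simp only [smul_mul_smul_comm, mul_add, add_mul, one_mul, mul_one, hN, smul_zero, add_zero,
        mul_comm (χ j)]
      congr 1
      abel

end HermitianSpace

/-! ### The unitary group of a hyperbolic plane and `GL₂(F)` -/

section RealForm

variable (F : Type*) [Field F] [Fintype F] {E : Type*} [Field E] [Algebra F E]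

/-- The matrices preserving the form `x₀ȳ₁ - x₁ȳ₀`. -/
def skewUnitary : Set (Matrix (Fin 2) (Fin 2) E) :=
  {M | M 0 0 * bar F (M 1 0) = M 1 0 * bar F (M 0 0) ∧ M 0 1 * bar F (M 1 1) = M 1 1 * bar F (M 0 1) ∧
    M 0 0 * bar F (M 1 1) - M 1 0 * bar F (M 0 1) = 1}

variable [Finite E] [Fact (Module.finrank F E = 2)]

/-- Preserving the form amounts to `M = D · bar M` with `D = det M`. All entries are then multiplied
by the same factor under the involution, so the ratio of any two of them (with nonzero denominator)
is fixed and lies in `F`. Factoring out a nonzero entry leaves a matrix over `F`. -/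
theorem mem_skewUnitary_iff (M : Matrix (Fin 2) (Fin 2) E) :
    M ∈ skewUnitary F ↔ ∃ (a : E) (G : Matrix (Fin 2) (Fin 2) F),
      a * bar F a * algebraMap F E G.det = 1 ∧ M = a • G.map (algebraMap F E) := by
  constructor
  · rintro ⟨h1, h2, h3⟩
    have h3' : bar F (M 0 0) * M 1 1 - bar F (M 1 0) * M 0 1 = 1 := by
      have := congrArg (bar F) h3
      simpa using this
    set D := M 0 0 * M 1 1 - M 0 1 * M 1 0 with hD
    have e : ∀ i j, M i j = D * bar F (M i j) := by
      intro i j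
      fin_cases i <;> fin_cases j <;> simp only [Fin.zero_eta, Fin.mk_one, hD]
      · linear_combination -(M 0 0) * h3' - (M 0 1) * h1
      · linear_combination -(M 0 1) * h3 + (M 0 0) * h2
      · linear_combination -(M 1 0) * h3' - (M 1 1) * h1
      · linear_combination -(M 1 1) * h3 + (M 1 0) * h2
    obtain ⟨i₀, j₀, hne⟩ : ∃ i j, M i j ≠ 0 := by
      by_contra! h0
      simp [h0] at h3
    set a := M i₀ j₀ with ha
    have hea : a = D * bar F a := e i₀ j₀
    have hba : bar F a ≠ 0 := (map_ne_zero _).2 hne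
    have hD0 : D ≠ 0 := fun h => hne (by rw [hea, h, zero_mul])
    have hfix : ∀ i j, ∃ y : F, algebraMap F E y = M i j / a := fun i j => by
      refine exists_algebraMap_of_bar_eq F ?_
      rw [map_div₀, div_eq_div_iff hba hne]
      apply mul_left_cancel₀ hD0
      linear_combination -a * (e i j) + (M i j) * hea
    choose G hG using hfix
    have hM : M = a • (Matrix.of G).map (algebraMap F E) := by
      ext i j
      simp only [Matrix.smul_apply, Matrix.map_apply, Matrix.of_apply, hG, smul_eq_mul]
      field_simp
    refine ⟨a, Matrix.of G, ?_, hM⟩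
    have hdet : algebraMap F E (Matrix.of G).det * a ^ 2 = D := by
      rw [Matrix.det_fin_two, map_sub, map_mul, map_mul]
      simp only [Matrix.of_apply, hG]
      rw [hD]; field_simp
    apply mul_right_cancel₀ hne
    linear_combination (bar F a) * hdet - hea
  · rintro ⟨a, G, h, rfl⟩
    rw [Matrix.det_fin_two, map_sub, map_mul, map_mul] at h
    simp only [skewUnitary, Set.mem_ofPred_eq, Matrix.smul_apply, Matrix.map_apply, smul_eq_mul, map_mul,
      bar_algebraMap]
    refine ⟨?_, ?_, ?_⟩
    · ring
    · ring
    · linear_combination h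

/-- Double counting along entrywise proportionality over `E`. Scalars do not affect commutation.
Given the tuple over `E`, each `G i` is unique up to `F^×`; given `G`, each scalar `a i` has
prescribed norm `(det G i)⁻¹`, hence `q+1` choices. -/
theorem numComm_skewUnitary (k : ℕ) :
    numComm (skewUnitary F (E := E)) k * (Fintype.card F - 1) ^ k
      = numComm {g : Matrix (Fin 2) (Fin 2) F | g.det ≠ 0} k * (Fintype.card F + 1) ^ k := by
  have hdet0 : ∀ {G : Matrix (Fin 2) (Fin 2) F}, G.det ≠ 0 → G ≠ 0 := by
    rintro _ h rfl; simp at h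
  have hmap : ∀ (c : F) (G : Matrix (Fin 2) (Fin 2) F),
      (c • G).map (algebraMap F E) = algebraMap F E c • G.map (algebraMap F E) := fun c G => by
    ext i j; simp
  have hmapi : Function.Injective (fun G : Matrix (Fin 2) (Fin 2) F => G.map (algebraMap F E)) :=
    Matrix.map_injective (algebraMap F E).injective
  have hmul : ∀ G H : Matrix (Fin 2) (Fin 2) F,
      (G * H).map (algebraMap F E) = G.map (algebraMap F E) * H.map (algebraMap F E) :=
    fun G H => Matrix.map_mul
  refine ncard_mul_eq_ncard_mul (fun t G => ∀ i, ∃ a : E, t i = a • (G i).map (algebraMap F E)) ?_ ?_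
  · rintro t ⟨ht1, ht2⟩
    have h1 := fun i => (mem_skewUnitary_iff F (t i)).1 (ht1 i)
    choose a G haG htG using h1
    have ha0 : ∀ i, a i ≠ 0 := fun i h => by have := haG i; simp [h] at this
    have hG0 : ∀ i, (G i).det ≠ 0 := fun i h => by have := haG i; simp [h] at this
    rw [← ncard_ne_zero (F := F), ← ncard_pi_const, ← Set.InjOn.ncard_image (f := fun (c : Fin k → F) i => c i • G i)]
    · congr 1
      ext H
      constructor
      · rintro ⟨⟨hH1, hH2⟩, hH3⟩
        choose b hb using hH3
        have key : ∀ i, ∃ c : F, c ≠ 0 ∧ c • G i = H i := by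
          intro i
          have hb0 : b i ≠ 0 := by
            intro h0
            have h2 := hb i
            rw [h0, zero_smul, htG i] at h2
            have h3 := (smul_eq_zero.1 h2).resolve_left (ha0 i)
            exact hdet0 (hG0 i) (hmapi (by simpa using h3))
          have hHr : (H i).map (algebraMap F E) = (a i / b i) • (G i).map (algebraMap F E) := by
            have h2 := hb i
            rw [htG i] at h2
            rw [div_eq_inv_mul, mul_smul, h2, inv_smul_smul₀ hb0]
          obtain ⟨x, y, hxy⟩ : ∃ x y, G i x y ≠ 0 := by
            by_contra! h0
            exact hdet0 (hG0 i) (by ext x y; exact h0 x y)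
          have hxy' := congrFun (congrFun hHr x) y
          simp only [Matrix.map_apply, Matrix.smul_apply, smul_eq_mul] at hxy'
          -- Two matrices over `F` that are proportional over `E` are proportional over `F`; the
          -- ratio is read off at a nonzero entry.
          have hr : a i / b i = algebraMap F E (H i x y / G i x y) := by
            rw [map_div₀, eq_div_iff ((map_ne_zero _).2 hxy), hxy']
          refine ⟨H i x y / G i x y, ?_, hmapi ?_⟩
          · intro h0
            rw [h0, map_zero] at hr
            exact div_ne_zero (ha0 i) hb0 hr
          · simp only [hmap]
            rw [← hr, hHr]
        choose c hc1 hc2 using key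
        exact ⟨c, hc1, funext hc2⟩
      · rintro ⟨c, hc, rfl⟩
        have hc : ∀ i, c i ≠ 0 := hc
        refine ⟨⟨fun i => ?_, fun i j => ?_⟩, fun i => ⟨a i * (algebraMap F E (c i))⁻¹, ?_⟩⟩
        · simp only [Set.mem_ofPred_eq, Matrix.det_smul]
          exact mul_ne_zero (pow_ne_zero _ (hc i)) (hG0 i)
        · have h2 := ht2 i j
          rw [htG i, htG j, smul_mul_smul_comm, smul_mul_smul_comm, mul_comm (a j)] at h2
          have h3 := smul_right_injective _ (mul_ne_zero (ha0 i) (ha0 j)) h2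
          simp only [← hmul] at h3
          simp only [smul_mul_smul_comm, mul_comm (c j)]
          rw [hmapi h3]
        · have : algebraMap F E (c i) ≠ 0 := (map_ne_zero _).2 (hc i)
          simp only [hmap, smul_smul]
          rw [inv_mul_cancel_right₀ this]
          exact htG i
    · intro c _ c' _ h
      funext i
      exact smul_left_injective F (hdet0 (hG0 i)) (congrFun h i)
  · rintro G ⟨hG1, hG2⟩
    have hG0 : ∀ i, (G i).det ≠ 0 := hG1
    have : ∀ i, ∃ a : E, a * bar F a = algebraMap F E (G i).det⁻¹ := fun i =>
      exists_mul_bar_eq F (bar_algebraMap F _)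
    choose a ha using this
    have ha1 : ∀ i, a i * bar F (a i) * algebraMap F E (G i).det = 1 := fun i => by
      rw [ha, ← map_mul, inv_mul_cancel₀ (hG0 i), map_one]
    have ha0 : ∀ i, a i ≠ 0 := fun i h => by have := ha1 i; simp [h] at this
    have hGE : ∀ i, (G i).map (algebraMap F E) ≠ 0 := fun i h =>
      hdet0 (hG0 i) (hmapi (by simpa using h))
    rw [← ncard_normOneTuples F E, ← Set.InjOn.ncard_image
      (f := fun (c : Fin k → E) i => (c i * a i) • (G i).map (algebraMap F E))]
    · congr 1
      ext t
      constructor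
      · rintro ⟨⟨ht1, ht2⟩, ht3⟩
        choose b hb using ht3
        refine ⟨fun i => b i / a i, fun i => ?_, funext fun i => ?_⟩
        · obtain ⟨h1, h2, h3⟩ := ht1 i
          have hd : b i * bar F (b i) * algebraMap F E (G i).det = 1 := by
            rw [hb i] at h3
            simp only [Matrix.smul_apply, Matrix.map_apply, smul_eq_mul, map_mul, bar_algebraMap] at h3
            rw [Matrix.det_fin_two, map_sub, map_mul, map_mul]
            linear_combination h3
          have hd0 : algebraMap F E (G i).det ≠ 0 := (map_ne_zero _).2 (hG0 i)
          have hba : bar F (a i) ≠ 0 := (map_ne_zero _).2 (ha0 i)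
          have e : b i * bar F (b i) = a i * bar F (a i) :=
            mul_right_cancel₀ hd0 (hd.trans (ha1 i).symm)
          simp only [normOne, Set.mem_ofPred_eq, map_div₀]
          rw [div_mul_div_comm, e, div_self (mul_ne_zero (ha0 i) hba)]
        · simp only [div_mul_cancel₀ _ (ha0 i)]
          exact (hb i).symm
      · rintro ⟨c, hc, rfl⟩
        refine ⟨⟨fun i => (mem_skewUnitary_iff F _).2 ⟨c i * a i, G i, ?_, rfl⟩, fun i j => ?_⟩,
          fun i => ⟨_, rfl⟩⟩
        · have hci : c i * bar F (c i) = 1 := hc i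
          rw [map_mul]
          linear_combination (a i * bar F (a i) * algebraMap F E (G i).det) * hci + ha1 i
        · simp only [smul_mul_smul_comm, ← hmul, hG2 i j, mul_comm (c j * a j)]
    · intro c _ c' _ h
      funext i
      exact mul_right_cancel₀ (ha0 i) (smul_left_injective E (hGE i) (congrFun h i))

end RealForm

/-! ### Commuting tuples in `U₂` -/

namespace HermitianSpace

variable {F : Type*} [Field F] [Fintype F] {E : Type*} [Field E] [Algebra F E]
  {V : Type*} [AddCommGroup V] [Module E V] (h : HermitianSpace F E V)
  [Finite E] [Fact (Module.finrank F E = 2)] [FiniteDimensional E V]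

/-- Rescaling one vector of a hyperbolic pair by a nonzero element of trace zero makes the Gram
matrix skew. The form is then `e` times the one in `skewUnitary`, and `e` does not change the
isometries. -/
theorem exists_skew_basis (hn : Module.finrank E V = 2) :
    ∃ (b : Module.Basis (Fin 2) E V) (e : E), e ≠ 0 ∧ h.form (b 0) (b 0) = 0 ∧
      h.form (b 1) (b 1) = 0 ∧ h.form (b 0) (b 1) = e ∧ h.form (b 1) (b 0) = -e := by
  have hF := Fintype.one_lt_card (α := F)
  have : Finite V := Module.finite_of_finite E
  obtain ⟨v, hv, hv0⟩ : ∃ v, h.form v v = 0 ∧ v ≠ 0 := by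
    have h1 := h.ncard_form_eq_zero_two hn
    have h2 : 1 < {x : V | h.form x x = 0}.ncard := by
      zify
      rw [h1]
      have : (1 : ℤ) < Fintype.card F := by exact_mod_cast hF
      nlinarith
    obtain ⟨v, hv, hv0⟩ := Set.exists_ne_of_one_lt_ncard h2 0
    exact ⟨v, hv, hv0⟩
  obtain ⟨e, he, he0⟩ : ∃ e : E, e + bar F e = 0 ∧ e ≠ 0 := by
    have h1 := ncard_trace_eq F (map_zero (bar F) : bar F (0 : E) = 0)
    have h2 : 1 < {x : E | x + bar F x = 0}.ncard := by rw [h1]; exact hF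
    obtain ⟨v, hv, hv0⟩ := Set.exists_ne_of_one_lt_ncard h2 0
    exact ⟨v, hv, hv0⟩
  obtain ⟨w, hvw, hww⟩ := h.exists_hyperbolic hv0 hv
  set w' := bar F e • w
  have h1 : h.form v w' = e := by rw [h.smul_right, bar_bar, hvw, mul_one]
  have h2 : h.form w' v = -e := by rw [← h.bar_form, h1]; linear_combination he
  have h3 : h.form w' w' = 0 := by rw [h.smul_left, h.smul_right, hww, mul_zero, mul_zero]
  have hli : LinearIndependent E ![v, w'] := by
    rw [LinearIndependent.pair_iff]
    intro s t hst
    have e1 : h.form (s • v + t • w') v = 0 := by rw [hst, zero_left]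
    have e2 : h.form (s • v + t • w') w' = 0 := by rw [hst, zero_left]
    rw [h.add_left, h.smul_left, h.smul_left, hv, h2] at e1
    rw [h.add_left, h.smul_left, h.smul_left, h1, h3] at e2
    constructor
    · simpa [he0] using e2
    · simpa [he0] using e1
  refine ⟨basisOfLinearIndependentOfCardEqFinrank hli (by simp [hn]), e, he0, ?_⟩
  simp [hv, h1, h2, h3]

theorem mem_isom_iff_skewUnitary {b : Module.Basis (Fin 2) E V} {e : E} (he : e ≠ 0)
    (h00 : h.form (b 0) (b 0) = 0) (h11 : h.form (b 1) (b 1) = 0) (h01 : h.form (b 0) (b 1) = e)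
    (h10 : h.form (b 1) (b 0) = -e) (g : Module.End E V) :
    g ∈ h.isom ↔ LinearMap.toMatrixAlgEquiv b g ∈ skewUnitary F := by
  have hform : ∀ x0 x1 y0 y1 : E, h.form (x0 • b 0 + x1 • b 1) (y0 • b 0 + y1 • b 1)
      = e * (x0 * bar F y1 - x1 * bar F y0) := by
    intro x0 x1 y0 y1
    simp only [h.add_left, h.add_right, h.smul_left, h.smul_right, h00, h01, h10, h11]
    ring
  set M := LinearMap.toMatrixAlgEquiv b g with hM
  have hg : ∀ j, g (b j) = M 0 j • b 0 + M 1 j • b 1 := by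
    intro j
    rw [← Fin.sum_univ_two (f := fun i => M i j • b i), hM]
    simp only [LinearMap.toMatrixAlgEquiv_apply]
    exact (b.sum_repr (g (b j))).symm
  constructor
  · intro hgi
    have e00 := hgi (b 0) (b 0)
    have e11 := hgi (b 1) (b 1)
    have e01 := hgi (b 0) (b 1)
    rw [hg, hform, h00] at e00
    rw [hg, hform, h11] at e11
    rw [hg, hg, hform, h01] at e01
    refine ⟨?_, ?_, ?_⟩
    · exact sub_eq_zero.1 ((mul_eq_zero.1 e00).resolve_left he)
    · exact sub_eq_zero.1 ((mul_eq_zero.1 e11).resolve_left he)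
    · exact mul_left_cancel₀ he (by rw [e01, mul_one])
  · rintro ⟨h1, h2, h3⟩ x y
    have h3' : bar F (M 0 0) * M 1 1 - bar F (M 1 0) * M 0 1 = 1 := by
      have := congrArg (bar F) h3
      simpa using this
    have hx := (b.sum_repr x).symm
    have hy := (b.sum_repr y).symm
    rw [Fin.sum_univ_two] at hx hy
    generalize b.repr x 0 = x0 at hx
    generalize b.repr x 1 = x1 at hx
    generalize b.repr y 0 = y0 at hy
    generalize b.repr y 1 = y1 at hy
    have hgx : ∀ x0 x1 : E, g (x0 • b 0 + x1 • b 1)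
        = (M 0 0 * x0 + M 0 1 * x1) • b 0 + (M 1 0 * x0 + M 1 1 * x1) • b 1 := by
      intro x0 x1
      rw [map_add, map_smul, map_smul, hg, hg]
      module
    rw [hx, hy, hgx, hgx, hform, hform]
    simp only [map_add, map_mul]
    linear_combination (e * x0 * bar F y0) * h1 + (e * x1 * bar F y1) * h2
      + (e * x0 * bar F y1) * h3 - (e * x1 * bar F y0) * h3'

/-- Commuting tuples of isometries of a hermitian plane. -/
theorem numComm_isom_of_finrank_two (hn : Module.finrank E V = 2) (k : ℕ) :
    numComm h.isom k * (Fintype.card F - 1) ^ k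
      = numComm {g : Matrix (Fin 2) (Fin 2) F | g.det ≠ 0} k * (Fintype.card F + 1) ^ k := by
  obtain ⟨b, e, he, h00, h11, h01, h10⟩ := h.exists_skew_basis hn
  rw [← numComm_skewUnitary F (E := E)]
  congr 1
  rw [← numComm_image ((LinearMap.toMatrixAlgEquiv b : _ →* Matrix (Fin 2) (Fin 2) E))
    (LinearMap.toMatrixAlgEquiv b).injective]
  congr 1
  ext M
  constructor
  · rintro ⟨g, hg, rfl⟩
    exact (h.mem_isom_iff_skewUnitary he h00 h11 h01 h10 g).1 hg
  · intro hM
    refine ⟨(LinearMap.toMatrixAlgEquiv b).symm M, ?_, (LinearMap.toMatrixAlgEquiv b).apply_symm_apply M⟩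
    rw [h.mem_isom_iff_skewUnitary he h00 h11 h01 h10, AlgEquiv.apply_symm_apply]
    exact hM

/-- The closed form for the number of commuting tuples of isometries of a hermitian plane. -/
theorem two_mul_numComm_isom (h2 : (2 : F) ≠ 0) (hn : Module.finrank E V = 2) (k : ℕ) :
    2 * (numComm h.isom k : ℤ)
      = 2 * (Fintype.card F + 1) * (Fintype.card F * (Fintype.card F + 1)) ^ k
        + Fintype.card F * (Fintype.card F + 1) * (Fintype.card F ^ 2 - 1) ^ k
        + Fintype.card F * (Fintype.card F - 1) * ((Fintype.card F + 1) ^ 2) ^ k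
        - 2 * Fintype.card F * (Fintype.card F + 1) * (Fintype.card F + 1) ^ k := by
  have h1 := h.numComm_isom_of_finrank_two hn k
  have h3 := numComm_det_ne_zero h2 k
  have hF := Fintype.one_lt_card (α := F)
  have hq0 : ((Fintype.card F - 1 : ℕ) : ℤ) = Fintype.card F - 1 := by
    rw [Nat.cast_sub hF.le, Nat.cast_one]
  have hne : ((Fintype.card F : ℤ) - 1) ^ k ≠ 0 := pow_ne_zero _ (by omega)
  have h1' := congrArg (Nat.cast : ℕ → ℤ) h1
  push_cast at h1'
  rw [hq0] at h1'
  apply mul_right_cancel₀ hne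
  have e1 : ((Fintype.card F : ℤ) ^ 2 - 1) ^ k
      = (Fintype.card F - 1) ^ k * (Fintype.card F + 1) ^ k := by rw [← mul_pow]; ring
  rw [e1, mul_pow, ← pow_mul, mul_comm 2 k, pow_mul] at h3 ⊢
  linear_combination 2 * h1' + (Fintype.card F + 1 : ℤ) ^ k * h3

end HermitianSpace

/-! ### Characters of commuting tuples on a plane -/

namespace HermitianSpace

variable {F : Type*} [Field F] [Fintype F] {E : Type*} [Field E] [Algebra F E]
  {V : Type*} [AddCommGroup V] [Module E V] (h : HermitianSpace F E V)
  [Finite E] [Fact (Module.finrank F E = 2)] [FiniteDimensional E V]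

/-- The number of pairs of a tuple and a nontrivial character of norm one acting on some fixed
vector, when the number of tuples is known for each character. -/
theorem ncard_pairs_of_eigen [Nontrivial V] {k c : ℕ} (w : V)
    (hc : ∀ χ ∈ normOneTuples F E k, {t | t ∈ h.tuples k ∧ w ∈ eigen t χ}.ncard = c) :
    {p : (Fin k → E) × (Fin k → Module.End E V) | p.1 ∈ normOneTuples F E k ∧ p.2 ∈ h.tuples k ∧
        w ∈ eigen p.2 p.1 ∧ eigen p.2 p.1 ≠ ⊤}.ncard + (Fintype.card F + 1) ^ k
      = (Fintype.card F + 1) ^ k * c := by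
  have : Finite V := Module.finite_of_finite E
  have : Finite (Module.End E V) := Module.finite_of_finite E
  rw [← ncard_normOneTuples F E]
  have h1 : {p : (Fin k → E) × (Fin k → Module.End E V) | p.1 ∈ normOneTuples F E k ∧
      p.2 ∈ h.tuples k ∧ w ∈ eigen p.2 p.1}.ncard = (normOneTuples F E k).ncard * c := by
    refine ncard_eq_mul_of_fibers Prod.fst (fun p hp => hp.1) fun χ hχ => ?_
    rw [← hc χ hχ, ← Set.ncard_image_of_injective {t | t ∈ h.tuples k ∧ w ∈ eigen t χ}
      (f := fun t => (χ, t)) (fun a b hab => congrArg Prod.snd hab)]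
    congr 1
    ext ⟨χ', t⟩
    simp only [Set.mem_ofPred_eq, Set.mem_image, Prod.mk.injEq]
    constructor
    · rintro ⟨⟨h1, h2, h3⟩, rfl⟩
      exact ⟨t, ⟨h2, h3⟩, rfl, rfl⟩
    · rintro ⟨t, ⟨h2, h3⟩, rfl, rfl⟩
      exact ⟨⟨hχ, h2, h3⟩, rfl⟩
  rw [← h1, ← Set.ncard_image_of_injective (normOneTuples F E k) (f := fun χ => (χ, scalarTuple V χ))
    (fun a b hab => congrArg Prod.fst hab), ← Set.ncard_union_eq]
  · congr 1
    ext ⟨χ, t⟩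
    constructor
    · rintro (⟨h1, h2, h3, -⟩ | ⟨χ', h1, h2⟩)
      · exact ⟨h1, h2, h3⟩
      · obtain ⟨rfl, rfl⟩ := Prod.mk.inj h2
        exact ⟨h1, h.scalarTuple_mem_tuples h1, fun i => rfl⟩
    · rintro ⟨h1, h2, h3⟩
      by_cases h4 : eigen t χ = ⊤
      · right
        rw [eigen_eq_top_iff] at h4
        exact ⟨χ, h1, by rw [h4]⟩
      · exact Or.inl ⟨h1, h2, h3, h4⟩
  · rw [Set.disjoint_left]
    rintro _ ⟨-, -, -, h4⟩ ⟨χ, -, rfl⟩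
    exact h4 (eigen_eq_top_iff.2 rfl)

/-- In a hermitian plane, the number of pairs of a commuting tuple and one of its characters of
norm one. -/
theorem ncard_characters_plane (hn : Module.finrank E V = 2) (k : ℕ) :
    ({p : (Fin k → E) × (Fin k → Module.End E V) | p.1 ∈ normOneTuples F E k ∧ p.2 ∈ h.tuples k ∧
        eigen p.2 p.1 ≠ ⊥}.ncard : ℤ)
      = Fintype.card F * (Fintype.card F - 1) * ((Fintype.card F + 1) ^ k) ^ 2
        + (Fintype.card F + 1) * (Fintype.card F + 1) ^ k * Fintype.card F ^ k
        - Fintype.card F ^ 2 * (Fintype.card F + 1) ^ k := by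
  have : Finite V := Module.finite_of_finite E
  have : Finite (Module.End E V) := Module.finite_of_finite E
  have := nontrivial_of_finrank (E := E) (V := V) hn
  have hF := Fintype.one_lt_card (α := F)
  have hq1 : (1 : ℤ) < Fintype.card F := by exact_mod_cast hF
  set q : ℤ := (Fintype.card F : ℤ) with hq
  set A : Set ((Fin k → E) × (Fin k → Module.End E V)) := {p | p.1 ∈ normOneTuples F E k ∧
    p.2 ∈ h.tuples k ∧ eigen p.2 p.1 ≠ ⊥ ∧ eigen p.2 p.1 ≠ ⊤} with hA
  set B₁ : Set V := {w | h.form w w ≠ 0} with hB₁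
  set B₂ : Set V := {w | h.form w w = 0 ∧ w ≠ 0} with hB₂
  have hY : {p : (Fin k → E) × (Fin k → Module.End E V) | p.1 ∈ normOneTuples F E k ∧
      p.2 ∈ h.tuples k ∧ eigen p.2 p.1 ≠ ⊥}.ncard = A.ncard + (Fintype.card F + 1) ^ k := by
    rw [← ncard_normOneTuples F E, ← Set.ncard_image_of_injective (normOneTuples F E k)
      (f := fun χ => (χ, scalarTuple V χ)) (fun a b hab => congrArg Prod.fst hab),
      ← Set.ncard_union_eq]
    · congr 1
      ext ⟨χ, t⟩
      constructor
      · rintro ⟨h1, h2, h3⟩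
        by_cases h4 : eigen t χ = ⊤
        · right
          rw [eigen_eq_top_iff] at h4
          exact ⟨χ, h1, by rw [h4]⟩
        · exact Or.inl ⟨h1, h2, h3, h4⟩
      · rintro (⟨h1, h2, h3, -⟩ | ⟨χ', h1, h2⟩)
        · exact ⟨h1, h2, h3⟩
        · obtain ⟨rfl, rfl⟩ := Prod.mk.inj h2
          refine ⟨h1, h.scalarTuple_mem_tuples h1, ?_⟩
          rw [eigen_eq_top_iff.2 rfl]
          exact top_ne_bot
    · rw [Set.disjoint_left]
      rintro _ ⟨-, -, -, h4⟩ ⟨χ, -, rfl⟩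
      exact h4 (eigen_eq_top_iff.2 rfl)
  -- Double count of pairs in `A` together with a nonzero eigenvector. A proper nonzero eigenspace
  -- in a plane is a line, so each pair has `q² - 1` eigenvectors. For a given vector the number of
  -- pairs depends only on whether it is isotropic.
  set R : Set (((Fin k → E) × (Fin k → Module.End E V)) × V) :=
    {r | r.1 ∈ A ∧ r.2 ∈ eigen r.1.2 r.1.1 ∧ r.2 ≠ 0} with hR
  have hRA : R.ncard = A.ncard * (Nat.card E - 1) := by
    refine ncard_eq_mul_of_fibers Prod.fst (fun r hr => hr.1) fun p hp => ?_
    have hK : Module.finrank E (eigen p.2 p.1) = 1 := by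
      have h1 : Module.finrank E (eigen p.2 p.1) < 2 := hn ▸ Submodule.finrank_lt hp.2.2.2
      have h2 : Module.finrank E (eigen p.2 p.1) ≠ 0 := fun h0 =>
        hp.2.2.1 (Submodule.finrank_eq_zero.1 h0)
      omega
    rw [← card_nonzero_of_finrank_one hK, ← Set.ncard_image_of_injective
      {w : V | w ∈ eigen p.2 p.1 ∧ w ≠ 0} (f := fun w => (p, w)) (fun a b hab => congrArg Prod.snd hab)]
    congr 1
    ext ⟨p', w⟩
    simp only [hR, Set.mem_ofPred_eq, Set.mem_image, Prod.mk.injEq]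
    constructor
    · rintro ⟨⟨h1, h2, h3⟩, rfl⟩
      exact ⟨w, ⟨h2, h3⟩, rfl, rfl⟩
    · rintro ⟨w, ⟨h2, h3⟩, rfl, rfl⟩
      exact ⟨⟨hp, h2, h3⟩, rfl⟩
  have hfib : ∀ (B : Set V) (c : ℕ), (∀ w ∈ B, w ≠ 0) → (∀ w ∈ B, ∀ χ ∈ normOneTuples F E k,
      {t | t ∈ h.tuples k ∧ w ∈ eigen t χ}.ncard = c) →
      {r | r ∈ R ∧ r.2 ∈ B}.ncard + B.ncard * (Fintype.card F + 1) ^ k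
        = B.ncard * ((Fintype.card F + 1) ^ k * c) := by
    intro B c hB0 hB
    rcases B.eq_empty_or_nonempty with rfl | ⟨w₀, hw₀⟩
    · simp
    have h1 := fun w hw => h.ncard_pairs_of_eigen w (hB w hw)
    have h2 : {r | r ∈ R ∧ r.2 ∈ B}.ncard
        = B.ncard * ((Fintype.card F + 1) ^ k * c - (Fintype.card F + 1) ^ k) := by
      refine ncard_eq_mul_of_fibers Prod.snd (fun r hr => hr.2) fun w hw => ?_
      rw [← h1 w hw, Nat.add_sub_cancel, ← Set.ncard_image_of_injective
        {p : (Fin k → E) × (Fin k → Module.End E V) | p.1 ∈ normOneTuples F E k ∧ p.2 ∈ h.tuples k ∧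
        w ∈ eigen p.2 p.1 ∧ eigen p.2 p.1 ≠ ⊤} (f := fun p => (p, w))
        (fun a b hab => congrArg Prod.fst hab)]
      congr 1
      ext ⟨p, w'⟩
      simp only [hR, Set.mem_ofPred_eq, Set.mem_image, Prod.mk.injEq]
      constructor
      · rintro ⟨⟨⟨⟨h1, h2, h3, h4⟩, h5, h6⟩, h7⟩, rfl⟩
        exact ⟨p, ⟨h1, h2, h5, h4⟩, rfl, rfl⟩
      · rintro ⟨p, ⟨h1, h2, h3, h4⟩, rfl, rfl⟩
        refine ⟨⟨⟨⟨h1, h2, ?_, h4⟩, h3, hB0 w hw⟩, hw⟩, rfl⟩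
        exact (Submodule.ne_bot_iff _).2 ⟨w, h3, hB0 w hw⟩
    rw [h2, ← mul_add, Nat.sub_add_cancel]
    rw [← h1 w₀ hw₀]
    exact Nat.le_add_left _ _
  -- An anisotropic vector may be rescaled to a unit vector, and the tuple is then free on the
  -- orthogonal line, whose isometries are the `q+1` scalars of norm one.
  have hf1 := hfib B₁ ((Fintype.card F + 1) ^ k)
    (by rintro w hw rfl; exact hw (h.zero_left 0)) (by
      intro w hw χ hχ
      obtain ⟨a, ha0, ha⟩ := h.exists_unit_smul hw
      have hd := h.finrank_perp (h.ne_zero_of_unit ha)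
      rw [← (h.perpSpace ha).numComm_isom_of_finrank_one (by omega) k, ← h.ncard_eigen_unit ha hχ]
      congr 1
      ext t
      exact and_congr_right fun _ => (Submodule.smul_mem_iff _ ha0).symm)
  have hf2 := hfib B₂ (Fintype.card F ^ k) (fun w hw => hw.2)
    (fun w hw χ hχ => h.ncard_eigen_isotropic hn hw.2 hw.1 hχ)
  have hRR : R.ncard = {r | r ∈ R ∧ r.2 ∈ B₁}.ncard + {r | r ∈ R ∧ r.2 ∈ B₂}.ncard := by
    rw [← Set.ncard_union_eq]
    · congr 1
      ext r
      simp only [Set.mem_union, Set.mem_ofPred_eq, ← and_or_left]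
      refine ⟨fun hr => ⟨hr, ?_⟩, fun hr => hr.1⟩
      by_cases h0 : h.form r.2 r.2 = 0
      · exact Or.inr ⟨h0, hr.2.2⟩
      · exact Or.inl h0
    · rw [Set.disjoint_left]
      rintro r ⟨-, h1⟩ ⟨-, h2⟩
      exact h1 h2.1
  have hZ := h.ncard_form_eq_zero_two hn
  have hcard : Nat.card V = Fintype.card F ^ 4 := by
    rw [card_space (F := F) (E := E), hn]
  have hB1c : (B₁.ncard : ℤ) = q ^ 4 - (q ^ 3 + q ^ 2 - q) := by
    have := Set.ncard_add_ncard_compl {x : V | h.form x x = 0}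
    rw [hcard] at this
    have e : {x : V | h.form x x = 0}ᶜ = B₁ := rfl
    rw [e] at this
    have := congrArg (Nat.cast : ℕ → ℤ) this
    push_cast at this
    rw [hZ] at this
    linear_combination this
  have hB2c : (B₂.ncard : ℤ) = q ^ 3 + q ^ 2 - q - 1 := by
    have e : B₂ = {x : V | h.form x x = 0} \ {0} := rfl
    have h0 : (0 : V) ∈ {x : V | h.form x x = 0} := h.zero_left 0
    have := Set.ncard_sdiff_singleton_add_one h0
    rw [← e] at this
    have := congrArg (Nat.cast : ℕ → ℤ) this
    push_cast at this
    rw [hZ] at this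
    linear_combination this
  have hE1 : ((Nat.card E - 1 : ℕ) : ℤ) = q ^ 2 - 1 := by
    rw [card_quadratic F, Nat.cast_sub (Nat.one_le_pow _ _ (by omega))]
    push_cast; rfl
  rw [hY]
  rw [hRR] at hRA
  have hRA' := congrArg (Nat.cast : ℕ → ℤ) hRA
  have hf1' := congrArg (Nat.cast : ℕ → ℤ) hf1
  have hf2' := congrArg (Nat.cast : ℕ → ℤ) hf2
  rw [Nat.cast_mul, hE1] at hRA'
  push_cast at hRA' hf1' hf2' ⊢
  rw [hB1c] at hf1'
  rw [hB2c] at hf2'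
  rw [← hq] at hf1' hf2' ⊢
  have hne : q ^ 2 - 1 ≠ 0 := by nlinarith
  apply mul_right_cancel₀ hne
  linear_combination -hRA' + hf1' + hf2'

end HermitianSpace

/-! ### Orthonormal and hyperbolic frames in dimension three -/

namespace HermitianSpace

variable {F : Type*} [Field F] [Fintype F] {E : Type*} [Field E] [Algebra F E]
  {V : Type*} [AddCommGroup V] [Module E V] (h : HermitianSpace F E V)
  [Finite E] [Fact (Module.finrank F E = 2)] [FiniteDimensional E V]

/-- The vectors orthogonal to a unit vector and an isotropic vector in dimension three. -/
theorem exists_smul_of_mem_perp (hn : Module.finrank E V = 3) {u v y : V} (hu : h.form u u = 1)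
    (hv0 : v ≠ 0) (hv : h.form v v = 0) (hvu : h.form v u = 0) (hyu : h.form y u = 0)
    (hyv : h.form y v = 0) : ∃ a : E, y = a • v := by
  have h1 := h.finrank_perp (h.ne_zero_of_unit hu)
  have h2 := (h.perpSpace hu).finrank_perp (v := ⟨v, hvu⟩) (fun h0 => hv0 (congrArg Subtype.val h0))
  obtain ⟨a, ha⟩ := exists_smul_of_finrank_one (K := (h.perpSpace hu).perp ⟨v, hvu⟩)
    (v := ⟨v, hvu⟩) (w := ⟨y, hyu⟩) (by omega) hv (fun h0 => hv0 (congrArg Subtype.val h0)) hyv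
  exact ⟨a, congrArg Subtype.val ha⟩

/-- In dimension three, two orthogonal unit vectors extend to an orthonormal basis. -/
theorem exists_third_unit (hn : Module.finrank E V = 3) {u w : V} (hu : h.form u u = 1)
    (hw : h.form w w = 1) (huw : h.form w u = 0) :
    ∃ z, h.form z z = 1 ∧ h.form z u = 0 ∧ h.form z w = 0 ∧
      ∀ y, h.form y u = 0 → h.form y w = 0 → ∃ a : E, y = a • z := by
  have h1 := h.finrank_perp (h.ne_zero_of_unit hu)
  have hw' : (h.perpSpace hu).form ⟨w, huw⟩ ⟨w, huw⟩ = 1 := hw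
  have h2 := (h.perpSpace hu).finrank_perp ((h.perpSpace hu).ne_zero_of_unit hw')
  have h3 : Module.finrank E ((h.perpSpace hu).perp ⟨w, huw⟩) = 1 := by omega
  have := nontrivial_of_finrank (E := E) h3
  obtain ⟨⟨⟨z, hzu⟩, hzw⟩, hz⟩ := ((h.perpSpace hu).perpSpace hw').exists_unit
  have hz : h.form z z = 1 := hz
  refine ⟨z, hz, hzu, hzw, fun y hyu hyw => ?_⟩
  obtain ⟨a, ha⟩ := exists_smul_of_finrank_one (v := ⟨z, hzu⟩) (w := ⟨y, hyu⟩) h3 hzw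
    ((h.perpSpace hu).ne_zero_of_unit hz) hyw
  exact ⟨a, congrArg Subtype.val ha⟩

/-- A hyperbolic pair together with a unit vector orthogonal to it, in dimension three. -/
structure Frame (v u w : V) : Prop where
  vv : h.form v v = 0
  ww : h.form w w = 0
  uu : h.form u u = 1
  vw : h.form v w = 1
  vu : h.form v u = 0
  wu : h.form w u = 0

namespace Frame

variable {h} {v u w : V} (f : h.Frame v u w)
include f

theorem wv : h.form w v = 1 := by rw [← h.bar_form, f.vw, map_one]
theorem uv : h.form u v = 0 := by rw [← h.bar_form, f.vu, map_zero]
theorem uw : h.form u w = 0 := by rw [← h.bar_form, f.wu, map_zero]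

theorem ne_zero : v ≠ 0 := by
  rintro rfl
  have := f.vw
  rw [zero_left] at this
  exact zero_ne_one this

theorem expand (hn : Module.finrank E V = 3) (x : V) :
    x = h.form x w • v + h.form x u • u + h.form x v • w := by
  obtain ⟨a, ha⟩ := h.exists_smul_of_mem_perp hn f.uu f.ne_zero f.vv f.vu
    (y := x - h.form x u • u - h.form x v • w)
    (by rw [h.sub_left, h.sub_left, h.smul_left, h.smul_left, f.uu, f.wu]; ring)
    (by rw [h.sub_left, h.sub_left, h.smul_left, h.smul_left, f.uv, f.wv]; ring)
  have hx : x = a • v + h.form x u • u + h.form x v • w := by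
    rw [← ha]; abel
  have : h.form x w = a := by
    have h1 := congrArg (fun y => h.form y w) hx
    simp only [h.add_left, h.smul_left, f.vw, f.uw, f.ww] at h1
    linear_combination h1
  rw [this]; exact hx

end Frame

/-- With `a` of trace one, `v + a w` and `v - ā w` are orthogonal of norms 1 and -1 and span the
hyperbolic plane. A unit vector orthogonal to both is therefore orthogonal to `v` and to `w`. -/
theorem exists_frame_of_hyperbolic (hn : Module.finrank E V = 3) {v w : V} (hvv : h.form v v = 0)
    (hww : h.form w w = 0) (hvw : h.form v w = 1) : ∃ u, h.Frame v u w := by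
  have hwv : h.form w v = 1 := by rw [← h.bar_form, hvw, map_one]
  obtain ⟨a, ha⟩ : {x : E | x + bar F x = 1}.Nonempty := by
    rw [← Set.ncard_pos, ncard_trace_eq F (map_one _)]
    exact Fintype.card_pos
  have ha : a + bar F a = 1 := ha
  have hz : h.form (v + a • w) (v + a • w) = 1 := by
    simp only [h.add_left, h.add_right, h.smul_left, h.smul_right, hvv, hww, hvw, hwv]
    linear_combination ha
  have hy : h.form (v - bar F a • w) (v - bar F a • w) ≠ 0 := by
    simp only [h.sub_left, h.sub_right, h.smul_left, h.smul_right, hvv, hww, hvw, hwv, bar_bar]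
    intro h0
    have : (1 : E) = 0 := by linear_combination -h0 - ha
    exact one_ne_zero this
  have hyz : h.form (v - bar F a • w) (v + a • w) = 0 := by
    simp only [h.add_right, h.sub_left, h.smul_left, h.smul_right, hvv, hww, hvw, hwv]
    ring
  obtain ⟨b, hb0, hb⟩ := h.exists_unit_smul hy
  obtain ⟨u, hu, huz, huy, -⟩ := h.exists_third_unit hn hz hb (by rw [h.smul_left, hyz, mul_zero])
  rw [h.smul_right] at huy
  have huy := (mul_eq_zero.1 huy).resolve_left ((map_ne_zero _).2 hb0)
  rw [h.add_right, h.smul_right] at huz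
  rw [h.sub_right, h.smul_right, bar_bar] at huy
  have huw : h.form u w = 0 := by
    linear_combination huz - huy - (h.form u w) * ha
  have huv : h.form u v = 0 := by
    rw [huw] at huz; linear_combination huz
  exact ⟨u, hvv, hww, hu, hvw, by rw [form_eq_zero_comm]; exact huv,
    by rw [form_eq_zero_comm]; exact huw⟩

theorem exists_frame (hn : Module.finrank E V = 3) {v : V} (hv0 : v ≠ 0) (hvv : h.form v v = 0) :
    ∃ u w, h.Frame v u w := by
  obtain ⟨w, hvw, hww⟩ := h.exists_hyperbolic hv0 hvv
  obtain ⟨u, hu⟩ := h.exists_frame_of_hyperbolic hn hvv hww hvw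
  exact ⟨u, w, hu⟩

/-! ### Unipotent tuples -/

/-- The endomorphisms acting by a single scalar on the successive quotients of the flag of an
isotropic vector. -/
def IsUnip (v : V) (a : E) (g : Module.End E V) : Prop :=
  g v = a • v ∧ ∀ x ∈ h.perp v, ∃ c : E, g x = a • x + c • v

/-- The unipotent isometry with parameters `b` and `c`. -/
noncomputable def heis (v u : V) (b c : E) : Module.End E V :=
  1 + (c • h.formLeft v - bar F b • h.formLeft u).smulRight v + (b • h.formLeft v).smulRight u

theorem heis_apply (v u : V) (b c : E) (x : V) :
    h.heis v u b c x = x + (c * h.form x v - bar F b * h.form x u) • v + (b * h.form x v) • u := rfl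

variable {h} in
-- The Heisenberg group law: the parameters `b` add, and `c` is central up to the cocycle `b̄ b'`.
theorem Frame.heis_mul {v u w : V} (f : h.Frame v u w) (b c b' c' : E) :
    h.heis v u b c * h.heis v u b' c' = h.heis v u (b + b') (c + c' - bar F b * b') := by
  ext x
  rw [Module.End.mul_apply]
  simp only [heis_apply, h.smul_left, f.vv, f.vu, f.uv, f.uu, map_add]
  module

variable {h} in
theorem Frame.heis_injective {v u w : V} (f : h.Frame v u w) {a b c b' c' : E} (ha : a ≠ 0)
    (hh : a • h.heis v u b c = a • h.heis v u b' c') : b = b' ∧ c = c' := by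
  have h1 := smul_right_injective _ ha hh
  have h2 := congrFun (congrArg DFunLike.coe h1) w
  have e : ∀ b c, h.heis v u b c w = w + c • v + b • u := fun b c => by
    rw [heis_apply, f.wv, f.wu]; simp
  rw [e, e] at h2
  have h3 := congrArg (fun x => h.form x w) h2
  have h4 := congrArg (fun x => h.form x u) h2
  simp only [h.add_left, h.smul_left, f.ww, f.vw, f.uw, f.wu, f.vu, f.uu] at h3 h4
  exact ⟨by linear_combination h4, by linear_combination h3⟩

variable {h} in
-- The two products differ only in the cocycle, so commuting means that `b̄ b'` is symmetric in the
-- two elements. The parameters `c` play no role.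
theorem Frame.heis_commute_iff {v u w : V} (f : h.Frame v u w) {a a' b c b' c' : E} (ha : a ≠ 0)
    (ha' : a' ≠ 0) : (a • h.heis v u b c) * (a' • h.heis v u b' c')
      = (a' • h.heis v u b' c') * (a • h.heis v u b c) ↔ b * bar F b' = b' * bar F b := by
  rw [smul_mul_smul_comm, smul_mul_smul_comm, mul_comm a' a, f.heis_mul, f.heis_mul]
  constructor
  · intro hh
    have := (f.heis_injective (mul_ne_zero ha ha') hh).2
    linear_combination this
  · intro hh
    rw [add_comm b' b, add_comm c' c, mul_comm (bar F b'), hh, mul_comm b']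

variable {h} in
-- After division by `a`, the isometry fixes `v` and sends `u` to `u + d' v`. Pairing the image `y`
-- of `w` with the images of `v`, `u` and `w` fixes its `w`-coordinate as 1, ties its `u`-coordinate
-- `b` to `d'`, and puts the trace condition on its `v`-coordinate `c`.
theorem Frame.mem_isom_iff (hn : Module.finrank E V = 3) {v u w : V} (f : h.Frame v u w) {a : E}
    (ha : a ∈ normOne F E) (g : Module.End E V) : (g ∈ h.isom ∧ h.IsUnip v a g) ↔
      ∃ b c : E, c + bar F c = -(b * bar F b) ∧ g = a • h.heis v u b c := by
  have ha' : a * bar F a = 1 := ha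
  have ha0 := ne_zero_of_mem_normOne ha
  constructor
  · rintro ⟨hg, hgv, hgp⟩
    obtain ⟨d, hd⟩ := hgp u f.uv
    obtain ⟨y, hy⟩ : ∃ y, g w = a • y := ⟨a⁻¹ • g w, (smul_inv_smul₀ ha0 _).symm⟩
    obtain ⟨d', rfl⟩ : ∃ d', d = a * d' := ⟨a⁻¹ * d, (mul_inv_cancel_left₀ ha0 d).symm⟩
    have hd' : g u = a • (u + d' • v) := by rw [hd, smul_add, smul_smul]
    have hscal : ∀ x y : V, h.form (a • x) (a • y) = h.form x y := fun x y => by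
      rw [h.smul_left, h.smul_right, ← mul_assoc, ha', one_mul]
    have e1 : h.form y v = 1 := by
      rw [← hscal, ← hy, ← hgv, hg, f.wv]
    have e2 : h.form y u + bar F d' = 0 := by
      have : h.form y (u + d' • v) = 0 := by rw [← hscal, ← hy, ← hd', hg, f.wu]
      rw [h.add_right, h.smul_right, e1] at this
      linear_combination this
    have e3 : h.form y y = 0 := by rw [← hscal, ← hy, hg, f.ww]
    have hyx := f.expand hn y
    rw [e1, one_smul] at hyx
    set b := h.form y u with hb
    set c := h.form y w with hc
    have hd'' : d' = -bar F b := by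
      have h1 : b = -bar F d' := by linear_combination e2
      rw [h1, map_neg, bar_bar, neg_neg]
    refine ⟨b, c, ?_, ?_⟩
    · rw [hyx] at e3
      simp only [h.add_left, h.add_right, h.smul_left, h.smul_right, f.vv, f.vu, f.vw, f.uv, f.uu, f.uw,
        f.wv, f.wu, f.ww] at e3
      linear_combination e3
    · ext x
      have hx := f.expand hn x
      have e4 : g x = h.form x w • g v + h.form x u • g u + h.form x v • g w := by
        conv_lhs => rw [hx, map_add, map_add, map_smul, map_smul, map_smul]
      rw [LinearMap.smul_apply, heis_apply, e4, hgv, hd', hy, hd'']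
      nth_rw 4 [hx]
      rw [hyx]
      module
  · rintro ⟨b, c, hbc, rfl⟩
    refine ⟨fun x y => ?_, ?_, fun x hx => ?_⟩
    · rw [LinearMap.smul_apply, LinearMap.smul_apply, h.smul_left, h.smul_right, heis_apply, heis_apply]
      simp only [h.add_left, h.add_right, h.smul_left, h.smul_right, f.vv, f.vu, f.uv, f.uu, map_sub,
        map_mul, h.bar_form, bar_bar]
      linear_combination (h.form x y) * ha' + (a * bar F a) * (h.form x v * h.form v y) * hbc
    · rw [LinearMap.smul_apply, heis_apply, f.vv, f.vu]; simp
    · refine ⟨-(a * bar F b * h.form x u), ?_⟩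
      rw [LinearMap.smul_apply, heis_apply, h.mem_perp.1 hx]
      module

/-- Tuples of elements of the quadratic extension that are proportional over the small field. -/
def proportional (F : Type*) [Field F] [Fintype F] (E : Type*) [Field E] [Algebra F E] (k : ℕ) :
    Set (Fin k → E) := {b | ∀ i j, b i * bar F (b j) = b j * bar F (b i)}

/-- A nonzero such tuple has all ratios of its entries in `F`, so it is `x d` with `x` in `F^k`
nonzero and `d` in `E^×`, uniquely up to `F^×`. This gives `(q^k - 1)(q² - 1)/(q - 1)` nonzero
tuples. -/
theorem ncard_proportional (F : Type*) [Field F] [Fintype F] (E : Type*) [Field E] [Algebra F E]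
    [Finite E] [Fact (Module.finrank F E = 2)] (k : ℕ) :
    ((proportional F E k).ncard : ℤ) = 1 + (Fintype.card F + 1) * (Fintype.card F ^ k - 1) := by
  have hF := Fintype.one_lt_card (α := F)
  set A : Set (Fin k → E) := proportional F E k \ {0} with hA
  have h0 : (0 : Fin k → E) ∈ proportional F E k := fun i j => rfl
  have hA1 := Set.ncard_sdiff_singleton_add_one h0
  rw [← hA] at hA1
  have key : A.ncard * (Fintype.card F - 1) = {d : E | d ≠ 0}.ncard * (Fintype.card F ^ k - 1) := by
    refine ncard_mul_eq_ncard_mul (fun b d => ∀ i, ∃ x : F, b i = algebraMap F E x * d) ?_ ?_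
    · rintro b ⟨hb, hb0⟩
      obtain ⟨i, hi⟩ : ∃ i, b i ≠ 0 := by
        by_contra! h1
        exact hb0 (funext h1)
      have hinj : Function.Injective (fun x : F => algebraMap F E x * b i) := fun x y hxy =>
        (algebraMap F E).injective (mul_right_cancel₀ hi hxy)
      rw [← ncard_ne_zero (F := F), ← Set.ncard_image_of_injective _ hinj]
      congr 1
      ext d
      constructor
      · rintro ⟨hd, h1⟩
        obtain ⟨x, hx⟩ := h1 i
        have hx0 : x ≠ 0 := by rintro rfl; simp at hx; exact hi hx
        have hx0' : algebraMap F E x ≠ 0 := (map_ne_zero _).2 hx0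
        refine ⟨x⁻¹, inv_ne_zero hx0, ?_⟩
        simp only [hx, map_inv₀, inv_mul_cancel_left₀ hx0']
      · rintro ⟨x, hx, rfl⟩
        have hx0' : algebraMap F E x ≠ 0 := (map_ne_zero _).2 hx
        refine ⟨mul_ne_zero hx0' hi, fun j => ?_⟩
        obtain ⟨y, hy⟩ := exists_algebraMap_of_bar_eq F (x := b j / b i) (by
          rw [map_div₀, div_eq_div_iff ((map_ne_zero _).2 hi) hi]
          have := hb i j
          linear_combination this)
        refine ⟨y * x⁻¹, ?_⟩
        rw [map_mul, map_inv₀, hy]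
        field_simp
    · intro d hd
      have hinj : Function.Injective (fun (x : Fin k → F) i => algebraMap F E (x i) * d) :=
        fun x y hxy => funext fun i =>
          (algebraMap F E).injective (mul_right_cancel₀ hd (congrFun hxy i))
      have hc : {x : Fin k → F | x ≠ 0}.ncard = Fintype.card F ^ k - 1 := by
        have : {x : Fin k → F | x ≠ 0} = {0}ᶜ := by ext; simp
        rw [this, Set.ncard_compl, Set.ncard_singleton, Nat.card_fun, Nat.card_fin,
          Nat.card_eq_fintype_card]
      rw [← hc, ← Set.ncard_image_of_injective _ hinj]
      congr 1
      ext b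
      constructor
      · rintro ⟨⟨hb, hb0⟩, h1⟩
        choose x hx using h1
        refine ⟨x, ?_, funext fun i => (hx i).symm⟩
        rintro rfl
        exact hb0 (funext fun i => by simp [hx i])
      · rintro ⟨x, hx, rfl⟩
        refine ⟨⟨fun i j => ?_, fun h1 => hx (hinj ?_)⟩, fun i => ⟨x i, rfl⟩⟩
        · simp only [map_mul, bar_algebraMap]; ring
        · rw [Set.mem_singleton_iff.1 h1]; funext i; simp
  have hE : {d : E | d ≠ 0}.ncard + 1 = Fintype.card F ^ 2 := by
    have : {d : E | d ≠ 0} = {0}ᶜ := by ext; simp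
    rw [this, ← card_quadratic F (E := E), ← Set.ncard_add_ncard_compl ({0} : Set E),
      Set.ncard_singleton, add_comm]
  have hq0 : ((Fintype.card F - 1 : ℕ) : ℤ) = Fintype.card F - 1 := by
    rw [Nat.cast_sub hF.le, Nat.cast_one]
  have hqk : ((Fintype.card F ^ k - 1 : ℕ) : ℤ) = Fintype.card F ^ k - 1 := by
    rw [Nat.cast_sub (Nat.one_le_pow _ _ (by omega))]; push_cast; rfl
  have key' := congrArg (Nat.cast : ℕ → ℤ) key
  rw [Nat.cast_mul, Nat.cast_mul, hq0, hqk] at key'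
  have hE' := congrArg (Nat.cast : ℕ → ℤ) hE
  rw [← hA1]
  push_cast at hE' ⊢
  have hne : (Fintype.card F : ℤ) - 1 ≠ 0 := by omega
  apply mul_right_cancel₀ hne
  linear_combination key' + ((Fintype.card F : ℤ) ^ k - 1) * hE'

/-- The number of commuting tuples unipotent up to a given character, for a given flag. -/
theorem ncard_unip (hn : Module.finrank E V = 3) {v : V} (hv0 : v ≠ 0) (hvv : h.form v v = 0) {k : ℕ}
    {χ : Fin k → E} (hχ : χ ∈ normOneTuples F E k) :
    {t | t ∈ h.tuples k ∧ ∀ i, h.IsUnip v (χ i) (t i)}.ncard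
      = (proportional F E k).ncard * Fintype.card F ^ k := by
  obtain ⟨u, w, f⟩ := h.exists_frame hn hv0 hvv
  have hχ0 := fun i => ne_zero_of_mem_normOne (hχ i)
  set S : Set (Fin k → E × E) := {p | (fun i => (p i).1) ∈ proportional F E k ∧
    ∀ i, (p i).2 + bar F (p i).2 = -((p i).1 * bar F (p i).1)} with hS
  have hinj : Function.Injective
      (fun (p : Fin k → E × E) i => χ i • h.heis v u (p i).1 (p i).2) := by
    intro p p' hp
    funext i
    have := f.heis_injective (hχ0 i) (congrFun hp i)
    exact Prod.ext this.1 this.2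
  -- Over each admissible `b`, every entry of `c` runs through a coset of the `q` elements of trace
  -- zero.
  have hSc : S.ncard = (proportional F E k).ncard * Fintype.card F ^ k := by
    refine ncard_eq_mul_of_fibers (fun p i => (p i).1) (fun p hp => hp.1) fun b hb => ?_
    have : ∀ i, ∃ c : E, c + bar F c = -(b i * bar F (b i)) := fun i => by
      have : {x : E | x + bar F x = -(b i * bar F (b i))}.Nonempty := by
        rw [← Set.ncard_pos, ncard_trace_eq F (by simp [mul_comm])]
        exact Fintype.card_pos
      exact this
    choose c hc using this
    rw [← ncard_trace_eq F (map_zero (bar F) : bar F (0 : E) = 0), ← ncard_pi_const,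
      ← Set.ncard_image_of_injective {d : Fin k → E | ∀ i, d i ∈ {x : E | x + bar F x = 0}}
        (f := fun (d : Fin k → E) i => (b i, c i + d i))
        (fun d d' hd => funext fun i => add_left_cancel (congrArg Prod.snd (congrFun hd i)))]
    congr 1
    ext p
    constructor
    · rintro ⟨⟨h1, h2⟩, rfl⟩
      refine ⟨fun i => (p i).2 - c i, fun i => ?_, funext fun i => Prod.ext rfl ?_⟩
      · simp only [Set.mem_ofPred_eq, map_sub]
        linear_combination h2 i - hc i
      · simp
    · rintro ⟨d, hd, rfl⟩
      refine ⟨⟨hb, fun i => ?_⟩, rfl⟩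
      have hdi : d i + bar F (d i) = 0 := hd i
      simp only [map_add]
      linear_combination hc i + hdi
  rw [← hSc, ← Set.ncard_image_of_injective _ hinj]
  congr 1
  ext t
  constructor
  · rintro ⟨⟨h1, h2⟩, h3⟩
    have := fun i => (f.mem_isom_iff hn (hχ i) (t i)).1 ⟨h1 i, h3 i⟩
    choose b c hbc ht using this
    refine ⟨fun i => (b i, c i), ⟨fun i j => ?_, hbc⟩, funext fun i => (ht i).symm⟩
    have := h2 i j
    rw [ht i, ht j, f.heis_commute_iff (hχ0 i) (hχ0 j)] at this
    exact this
  · rintro ⟨p, ⟨hp1, hp2⟩, rfl⟩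
    have := fun i => (f.mem_isom_iff hn (hχ i) _).2 ⟨_, _, hp2 i, rfl⟩
    exact ⟨⟨fun i => (this i).1, fun i j => (f.heis_commute_iff (hχ0 i) (hχ0 j)).2 (hp1 i j)⟩,
      fun i => (this i).2⟩

end HermitianSpace

/-! ### Unipotent tuples counted over all isotropic lines -/

namespace HermitianSpace

variable {F : Type*} [Field F] [Fintype F] {E : Type*} [Field E] [Algebra F E]
  {V : Type*} [AddCommGroup V] [Module E V] (h : HermitianSpace F E V)

/-- The commuting tuples that are unipotent up to scalars of norm one. -/
def unipTuples (k : ℕ) : Set (Fin k → Module.End E V) :=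
  {t | t ∈ h.tuples k ∧ ∃ v χ, v ≠ 0 ∧ h.form v v = 0 ∧ χ ∈ normOneTuples F E k ∧
    ∀ i, h.IsUnip v (χ i) (t i)}

/-- The unit vectors spanning a common eigenspace of a tuple. -/
def splitVectors {k : ℕ} (t : Fin k → Module.End E V) : Set V :=
  {u | h.form u u = 1 ∧ ∃ χ, eigen t χ = Submodule.span E {u}}

/-- The commuting tuples with an anisotropic line as a common eigenspace. -/
def splitTuples (k : ℕ) : Set (Fin k → Module.End E V) :=
  {t | t ∈ h.tuples k ∧ (h.splitVectors t).Nonempty}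

/-- The commuting tuples without common eigenvectors. -/
def irredTuples (k : ℕ) : Set (Fin k → Module.End E V) :=
  {t | t ∈ h.tuples k ∧ ∀ χ, eigen t χ = ⊥}

variable [Finite E] [Fact (Module.finrank F E = 2)] [FiniteDimensional E V]

theorem isUnip_smul_one (v : V) (a : E) : h.IsUnip v a (a • 1) :=
  ⟨rfl, fun x _ => ⟨0, by simp⟩⟩

variable {h} in
theorem IsUnip.smul {v : V} {a : E} {g : Module.End E V} (hg : h.IsUnip v a g) {b : E} (hb : b ≠ 0) :
    h.IsUnip (b • v) a g := by
  refine ⟨by rw [map_smul, hg.1, smul_comm], fun x hx => ?_⟩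
  rw [mem_perp, h.smul_right] at hx
  obtain ⟨c, hc⟩ := hg.2 x ((mul_eq_zero.1 hx).resolve_left ((map_ne_zero _).2 hb))
  exact ⟨c * b⁻¹, by rw [hc, smul_smul, inv_mul_cancel_right₀ hb]⟩

variable {h} in
/-- A tuple that is unipotent for two distinct flags is scalar. -/
theorem exists_smul_of_isUnip (hn : Module.finrank E V = 3) {k : ℕ} {t : Fin k → Module.End E V}
    (ht : t ∈ h.tuples k) {v v' : V} {χ χ' : Fin k → E} (hv0 : v ≠ 0) (hv : h.form v v = 0)
    (hv' : h.form v' v' = 0) (hχ : χ ∈ normOneTuples F E k)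
    (h1 : ∀ i, h.IsUnip v (χ i) (t i)) (h2 : ∀ i, h.IsUnip v' (χ' i) (t i))
    (hns : t ≠ scalarTuple V χ) : ∃ a : E, v' = a • v := by
  -- If `v'` is orthogonal to `v`, it has the form `α v + β u` in a frame, and isotropy kills `β`.
  -- Otherwise `v` and `v'` form a hyperbolic pair up to scaling, and both flags force `t i u - χ i
  -- u` into the independent lines of `v` and `v'`, so the tuple is scalar.
  by_cases h0 : h.form v v' = 0
  · obtain ⟨u, w, f⟩ := h.exists_frame hn hv0 hv
    have hx := f.expand hn v'
    have h0' : h.form v' v = 0 := by rw [form_eq_zero_comm]; exact h0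
    rw [h0', zero_smul, add_zero] at hx
    rw [hx, h.add_left, h.add_right, h.add_right, h.smul_left, h.smul_left, h.smul_right, h.smul_right,
      h.smul_left, h.smul_left, h.smul_right, h.smul_right, f.vv, f.vu, f.uv, f.uu] at hv'
    have : h.form v' u = 0 := by simpa using hv'
    rw [this, zero_smul, add_zero] at hx
    exact ⟨_, hx⟩
  · exfalso
    have hχχ : ∀ i, χ i = χ' i := by
      intro i
      by_contra hne
      refine h0 ?_
      rw [form_eq_zero_comm]
      exact form_eq_zero_of_eigen (ht.1 i) (hχ i) hne (h1 i).1 (h2 i).1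
    set b := bar F (h.form v v')⁻¹ with hb
    have hb0 : b ≠ 0 := (map_ne_zero _).2 (inv_ne_zero h0)
    have hvw : h.form v (b • v') = 1 := by rw [h.smul_right, hb, bar_bar, inv_mul_cancel₀ h0]
    obtain ⟨u, f⟩ := h.exists_frame_of_hyperbolic hn (w := b • v') hv
      (by rw [h.smul_left, h.smul_right, hv', mul_zero, mul_zero]) hvw
    refine hns (funext fun i => ?_)
    obtain ⟨c, hc⟩ := (h1 i).2 u f.uv
    obtain ⟨c', hc'⟩ := ((h2 i).smul hb0).2 u f.uw
    rw [← hχχ i, hc, add_right_inj] at hc'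
    have hc0 : c = 0 := by
      have : h.form (c • v) (b • v') = h.form (c' • b • v') (b • v') := by rw [hc']
      rwa [h.smul_left c, h.smul_left c', f.vw, f.ww, mul_one, mul_zero] at this
    rw [hc0, zero_smul, add_zero] at hc
    ext x
    have hx := f.expand hn x
    have e : (t i) (b • v') = χ i • b • v' := by rw [hχχ i]; exact ((h2 i).smul hb0).1
    have e4 : t i x = h.form x (b • v') • t i v + h.form x u • t i u + h.form x v • t i (b • v') := by
      conv_lhs => rw [hx, map_add, map_add, map_smul, map_smul, map_smul]
    rw [e4, e, hc, (h1 i).1]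
    simp only [scalarTuple, LinearMap.smul_apply, Module.End.one_apply]
    conv_rhs => rw [hx]
    module

theorem ncard_isotropic (hn : Module.finrank E V = 3) :
    ({v : V | v ≠ 0 ∧ h.form v v = 0}.ncard : ℤ)
      = (Fintype.card F ^ 2 - 1) * (Fintype.card F ^ 3 + 1) := by
  have : Finite V := Module.finite_of_finite E
  have e : {v : V | v ≠ 0 ∧ h.form v v = 0} = {x : V | h.form x x = 0} \ {0} := by
    ext; exact and_comm
  have h0 : (0 : V) ∈ {x : V | h.form x x = 0} := h.zero_left 0
  have := Set.ncard_sdiff_singleton_add_one h0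
  rw [← e] at this
  have := congrArg (Nat.cast : ℕ → ℤ) this
  push_cast at this
  rw [h.ncard_form_eq_zero_three hn] at this
  linear_combination this

/-- A non-scalar tuple of this type determines its isotropic line by `exists_smul_of_isUnip`, hence
has `q² - 1` flag vectors. Scalar tuples are compatible with every flag, so they are removed before
the double count and added back once. -/
theorem ncard_unipTuples (hn : Module.finrank E V = 3) (k : ℕ) :
    ((h.unipTuples k).ncard : ℤ) = (Fintype.card F + 1) ^ k + (Fintype.card F ^ 3 + 1)
      * (Fintype.card F + 1) ^ k * ((1 + (Fintype.card F + 1) * (Fintype.card F ^ k - 1))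
        * Fintype.card F ^ k - 1) := by
  have : Finite V := Module.finite_of_finite E
  have : Finite (Module.End E V) := Module.finite_of_finite E
  have := nontrivial_of_finrank (E := E) (V := V) hn
  have hF := Fintype.one_lt_card (α := F)
  have hq1 : (1 : ℤ) < Fintype.card F := by exact_mod_cast hF
  set r := (proportional F E k).ncard * Fintype.card F ^ k with hr
  set A : Set (Fin k → Module.End E V) := {t | t ∈ h.unipTuples k ∧ ∀ χ, t ≠ scalarTuple V χ} with hA
  set B : Set V := {v | v ≠ 0 ∧ h.form v v = 0} with hB
  set S : Set (Fin k → Module.End E V) := scalarTuple V '' normOneTuples F E k with hS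
  have hSinj : Function.Injective (scalarTuple V : (Fin k → E) → _) := by
    intro χ χ' hχ
    obtain ⟨v, hv⟩ := exists_ne (0 : V)
    funext i
    have := congrFun (congrArg DFunLike.coe (congrFun hχ i)) v
    exact smul_left_injective E hv this
  have hSc : S.ncard = (Fintype.card F + 1) ^ k := by
    rw [Set.ncard_image_of_injective _ hSinj, ncard_normOneTuples]
  have hBc := h.ncard_isotropic hn
  have hBne : B.Nonempty := by
    rw [← Set.ncard_pos]
    zify
    rw [hBc]
    have : (1 : ℤ) < Fintype.card F ^ 2 := by nlinarith
    exact mul_pos (by linarith) (by positivity)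
  have hAS : (h.unipTuples k).ncard = A.ncard + (Fintype.card F + 1) ^ k := by
    rw [← hSc, ← Set.ncard_union_eq]
    · congr 1
      ext t
      constructor
      · intro ht
        by_cases h1 : ∃ χ, t = scalarTuple V χ
        · right
          obtain ⟨χ, rfl⟩ := h1
          obtain ⟨-, v, χ', hv0, -, hχ', hun⟩ := ht
          refine ⟨χ', hχ', congrArg _ (funext fun i => ?_)⟩
          exact smul_left_injective E hv0 (hun i).1.symm
        · push Not at h1
          exact Or.inl ⟨ht, h1⟩
      · rintro (⟨ht, -⟩ | ⟨χ, hχ, rfl⟩)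
        · exact ht
        · obtain ⟨v, hv0, hv⟩ := hBne
          exact ⟨h.scalarTuple_mem_tuples hχ, v, χ, hv0, hv, hχ, fun i => h.isUnip_smul_one v _⟩
    · rw [Set.disjoint_left]
      rintro _ ⟨-, h1⟩ ⟨χ, -, rfl⟩
      exact h1 χ rfl
  have hfib : ∀ v ∈ B, {t | t ∈ A ∧ ∃ χ ∈ normOneTuples F E k, ∀ i, h.IsUnip v (χ i) (t i)}.ncard
      + (Fintype.card F + 1) ^ k = (Fintype.card F + 1) ^ k * r := by
    rintro v ⟨hv0, hv⟩
    have h1 : {p : (Fin k → E) × (Fin k → Module.End E V) | p.1 ∈ normOneTuples F E k ∧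
        p.2 ∈ h.tuples k ∧ ∀ i, h.IsUnip v (p.1 i) (p.2 i)}.ncard = (Fintype.card F + 1) ^ k * r := by
      rw [← ncard_normOneTuples F E]
      refine ncard_eq_mul_of_fibers Prod.fst (fun p hp => hp.1) fun χ hχ => ?_
      rw [hr, ← h.ncard_unip hn hv0 hv hχ, ← Set.ncard_image_of_injective
        {t | t ∈ h.tuples k ∧ ∀ i, h.IsUnip v (χ i) (t i)}
        (f := fun t => (χ, t)) (fun a b hab => congrArg Prod.snd hab)]
      congr 1
      ext ⟨χ', t⟩
      simp only [Set.mem_ofPred_eq, Set.mem_image, Prod.mk.injEq]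
      constructor
      · rintro ⟨⟨h1, h2, h3⟩, rfl⟩
        exact ⟨t, ⟨h2, h3⟩, rfl, rfl⟩
      · rintro ⟨t, ⟨h2, h3⟩, rfl, rfl⟩
        exact ⟨⟨hχ, h2, h3⟩, rfl⟩
    have hinj : Set.InjOn Prod.snd {p : (Fin k → E) × (Fin k → Module.End E V) |
        p.1 ∈ normOneTuples F E k ∧ p.2 ∈ h.tuples k ∧ ∀ i, h.IsUnip v (p.1 i) (p.2 i)} := by
      rintro ⟨χ, t⟩ ⟨-, -, h1⟩ ⟨χ', t'⟩ ⟨-, -, h2⟩ htt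
      obtain rfl : t = t' := htt
      refine Prod.ext (funext fun i => ?_) rfl
      exact smul_left_injective E hv0 ((h1 i).1.symm.trans (h2 i).1)
    rw [← h1, ← hinj.ncard_image, ← hSc, ← Set.ncard_union_eq]
    · congr 1
      ext t
      constructor
      · rintro (⟨⟨⟨h2, -⟩, -⟩, χ, hχ, h3⟩ | ⟨χ, hχ, rfl⟩)
        · exact ⟨(χ, t), ⟨hχ, h2, h3⟩, rfl⟩
        · exact ⟨(χ, _), ⟨hχ, h.scalarTuple_mem_tuples hχ, fun i => h.isUnip_smul_one v _⟩, rfl⟩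
      · rintro ⟨⟨χ, t⟩, ⟨h2, h3, h4⟩, rfl⟩
        by_cases h5 : t = scalarTuple V χ
        · exact Or.inr ⟨χ, h2, h5.symm⟩
        · refine Or.inl ⟨⟨⟨h3, v, χ, hv0, hv, h2, h4⟩, fun χ' h6 => h5 ?_⟩, χ, h2, h4⟩
          simp only at h6 h4
          rw [h6]
          congr 1
          funext i
          have := (h4 i).1
          rw [h6] at this
          exact smul_left_injective E hv0 this
    · rw [Set.disjoint_left]
      rintro _ ⟨⟨-, h1⟩, -⟩ ⟨χ, -, rfl⟩
      exact h1 χ rfl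
  have key : A.ncard * (Nat.card E - 1)
      = B.ncard * ((Fintype.card F + 1) ^ k * r - (Fintype.card F + 1) ^ k) := by
    refine ncard_mul_eq_ncard_mul
      (fun t v => ∃ χ ∈ normOneTuples F E k, ∀ i, h.IsUnip v (χ i) (t i)) ?_ ?_
    · rintro t ⟨⟨ht, v, χ, hv0, hv, hχ, h1⟩, hns⟩
      rw [← card_nonzero_of_finrank_one (finrank_span_singleton (K := E) hv0)]
      congr 1
      ext v'
      simp only [Set.mem_ofPred_eq, Submodule.mem_span_singleton]
      constructor
      · rintro ⟨⟨hv0', hv'⟩, χ', hχ', h2⟩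
        obtain ⟨a, rfl⟩ := exists_smul_of_isUnip hn ht hv0 hv hv' hχ h1 h2 (hns χ)
        exact ⟨⟨a, rfl⟩, hv0'⟩
      · rintro ⟨⟨a, rfl⟩, hv0'⟩
        refine ⟨⟨hv0', by rw [h.smul_left, h.smul_right, hv, mul_zero, mul_zero]⟩, χ, hχ, fun i => ?_⟩
        exact (h1 i).smul (fun h0 => hv0' (by rw [h0, zero_smul]))
    · intro v hv
      rw [← hfib v hv, Nat.add_sub_cancel]
  have hle : (Fintype.card F + 1) ^ k ≤ (Fintype.card F + 1) ^ k * r := by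
    obtain ⟨v, hv⟩ := hBne
    rw [← hfib v hv]
    exact Nat.le_add_left _ _
  have hE1 : ((Nat.card E - 1 : ℕ) : ℤ) = Fintype.card F ^ 2 - 1 := by
    rw [card_quadratic F, Nat.cast_sub (Nat.one_le_pow _ _ (by omega))]
    push_cast; rfl
  have key' := congrArg (Nat.cast : ℕ → ℤ) key
  rw [Nat.cast_mul, Nat.cast_mul, hE1, Nat.cast_sub hle, hBc] at key'
  have hr' := congrArg (Nat.cast : ℕ → ℤ) hr
  push_cast at key' hr'
  rw [ncard_proportional] at hr'
  rw [hAS]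
  have hne : (Fintype.card F : ℤ) ^ 2 - 1 ≠ 0 := by nlinarith
  apply mul_right_cancel₀ hne
  push_cast
  rw [hr'] at key'
  linear_combination key'

/-! ### The three types of commuting tuples -/

theorem expand_unit {u w z : V} (hu : h.form u u = 1) (hw : h.form w w = 1) (hz : h.form z z = 1)
    (hwu : h.form w u = 0) (hzu : h.form z u = 0) (hzw : h.form z w = 0)
    (hall : ∀ y, h.form y u = 0 → h.form y w = 0 → ∃ a : E, y = a • z) (x : V) :
    x = h.form x u • u + h.form x w • w + h.form x z • z := by
  have huw : h.form u w = 0 := (h.form_eq_zero_comm _ _).1 hwu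
  have huz : h.form u z = 0 := (h.form_eq_zero_comm _ _).1 hzu
  have hwz : h.form w z = 0 := (h.form_eq_zero_comm _ _).1 hzw
  obtain ⟨a, ha⟩ := hall (x - h.form x u • u - h.form x w • w)
    (by rw [h.sub_left, h.sub_left, h.smul_left, h.smul_left, hu, hwu]; ring)
    (by rw [h.sub_left, h.sub_left, h.smul_left, h.smul_left, huw, hw]; ring)
  have hx : x = h.form x u • u + h.form x w • w + a • z := by rw [← ha]; abel
  have : h.form x z = a := by
    have h1 := congrArg (fun y => h.form y z) hx
    simp only [h.add_left, h.smul_left, huz, hwz, hz] at h1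
    linear_combination h1
  rw [this]; exact hx

variable {h} in
/-- Distinct characters have orthogonal eigenspaces. -/
theorem form_eq_zero_of_mem_eigen {k : ℕ} {t : Fin k → Module.End E V} (ht : t ∈ h.tuples k)
    {χ ψ : Fin k → E} (hχ : χ ∈ normOneTuples F E k) (hne : χ ≠ ψ) {x y : V} (hx : x ∈ eigen t χ)
    (hy : y ∈ eigen t ψ) : h.form y x = 0 := by
  obtain ⟨i, hi⟩ := Function.ne_iff.1 hne
  exact form_eq_zero_of_eigen (ht.1 i) (hχ i) hi (hx i) (hy i)

variable {h} in
theorem mem_normOneTuples_of_eigen {k : ℕ} {t : Fin k → Module.End E V} (ht : t ∈ h.tuples k)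
    {χ : Fin k → E} {x : V} (hx : x ∈ eigen t χ) (h0 : h.form x x ≠ 0) : χ ∈ normOneTuples F E k :=
  fun i => eigenvalue_mem_normOne (ht.1 i) h0 (hx i)

variable {h} in
/-- The orthogonal complement of two common eigenvectors is an eigenline. -/
theorem exists_character_third {k : ℕ} {t : Fin k → Module.End E V} (ht : t ∈ h.tuples k)
    {χ ψ : Fin k → E} {u w z : V} (hu : u ∈ eigen t χ) (hw : w ∈ eigen t ψ)
    (hzu : h.form z u = 0) (hzw : h.form z w = 0)
    (hall : ∀ y, h.form y u = 0 → h.form y w = 0 → ∃ a : E, y = a • z) : ∃ ζ, z ∈ eigen t ζ := by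
  have : ∀ i, ∃ a : E, t i z = a • z := fun i =>
    hall _ (perp_stable (ht.1 i) (hu i) hzu) (perp_stable (ht.1 i) (hw i) hzw)
  choose ζ hζ using this
  exact ⟨ζ, hζ⟩

theorem exists_isotropic (hn : Module.finrank E V = 3) : ∃ v, v ≠ 0 ∧ h.form v v = 0 := by
  have hF := Fintype.one_lt_card (α := F)
  have hq1 : (1 : ℤ) < Fintype.card F := by exact_mod_cast hF
  have : {v : V | v ≠ 0 ∧ h.form v v = 0}.Nonempty := by
    have : Finite V := Module.finite_of_finite E
    rw [← Set.ncard_pos]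
    zify
    rw [h.ncard_isotropic hn]
    have : (1 : ℤ) < Fintype.card F ^ 2 := by nlinarith
    exact mul_pos (by linarith) (by positivity)
  exact this

/-- The type is read off from the `χ`-eigenvectors orthogonal to `v`. If there are none, the
eigenspace is the line of `v`: split. If there is an isotropic one, `w`, then `w^⊥` is spanned by
`v` and `w`, on which the tuple is scalar: unipotent. If there is an anisotropic one, the third
vector of an orthonormal basis is an eigenvector too; its character either equals `χ`, making the
tuple scalar, or its line is a full eigenspace. -/
theorem mem_of_eigen_anisotropic (hn : Module.finrank E V = 3) {k : ℕ} {t : Fin k → Module.End E V}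
    (ht : t ∈ h.tuples k) {χ : Fin k → E} {v : V} (hvχ : v ∈ eigen t χ) (hv : h.form v v = 1) :
    t ∈ h.unipTuples k ∨ t ∈ h.splitTuples k := by
  have hχ : χ ∈ normOneTuples F E k :=
    mem_normOneTuples_of_eigen ht hvχ (by rw [hv]; exact one_ne_zero)
  by_cases h0 : ∃ w ∈ eigen t χ, h.form w v = 0 ∧ w ≠ 0
  · obtain ⟨w, hwχ, hwv, hw0⟩ := h0
    by_cases hww : h.form w w = 0
    · left
      refine ⟨ht, w, χ, hw0, hww, hχ, fun i => ⟨hwχ i, fun x hx => ⟨0, ?_⟩⟩⟩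
      obtain ⟨b, hb⟩ := h.exists_smul_of_mem_perp hn hv hw0 hww hwv (y := x - h.form x v • v)
        (by rw [h.sub_left, h.smul_left, hv]; ring)
        (by rw [h.sub_left, h.smul_left, h.mem_perp.1 hx, (h.form_eq_zero_comm _ _).1 hwv]; ring)
      have hx' : x = h.form x v • v + b • w := by rw [← hb]; abel
      have : x ∈ eigen t χ := by
        rw [hx']
        exact Submodule.add_mem _ (Submodule.smul_mem _ _ hvχ) (Submodule.smul_mem _ _ hwχ)
      rw [this i, zero_smul, add_zero]
    · obtain ⟨a, ha0, ha⟩ := h.exists_unit_smul hww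
      have hwχ' : a • w ∈ eigen t χ := Submodule.smul_mem _ _ hwχ
      have hwv' : h.form (a • w) v = 0 := by rw [h.smul_left, hwv, mul_zero]
      generalize a • w = w' at ha hwχ' hwv'
      obtain ⟨u, hu, huv, huw, hall⟩ := h.exists_third_unit hn hv ha hwv'
      obtain ⟨ψ, hψ⟩ := exists_character_third ht hvχ hwχ' huv huw hall
      have hexp := h.expand_unit hv ha hu hwv' huv huw hall
      by_cases hne : χ = ψ
      · left
        subst hne
        have hsc : t = scalarTuple V χ := by
          rw [← eigen_eq_top_iff, Submodule.eq_top_iff']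
          intro x
          rw [hexp x]
          exact Submodule.add_mem _ (Submodule.add_mem _ (Submodule.smul_mem _ _ hvχ)
            (Submodule.smul_mem _ _ hwχ')) (Submodule.smul_mem _ _ hψ)
        obtain ⟨v₀, hv₀, hvv₀⟩ := h.exists_isotropic hn
        subst hsc
        exact ⟨ht, v₀, χ, hv₀, hvv₀, hχ, fun i => h.isUnip_smul_one v₀ _⟩
      · right
        refine ⟨ht, u, hu, ψ, ?_⟩
        refine le_antisymm (fun x hx => ?_) ?_
        · obtain ⟨b, rfl⟩ := hall x (form_eq_zero_of_mem_eigen ht hχ hne hvχ hx)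
            (form_eq_zero_of_mem_eigen ht hχ hne hwχ' hx)
          exact Submodule.mem_span_singleton.2 ⟨b, rfl⟩
        · rw [Submodule.span_singleton_le_iff_mem]
          exact hψ
  · right
    refine ⟨ht, v, hv, χ, le_antisymm (fun x hx => ?_) ?_⟩
    · push Not at h0
      have h1 := h0 (x - h.form x v • v) (Submodule.sub_mem _ hx (Submodule.smul_mem _ _ hvχ))
        (by rw [h.sub_left, h.smul_left, hv]; ring)
      exact Submodule.mem_span_singleton.2 ⟨_, (sub_eq_zero.1 h1).symm⟩
    · rw [Submodule.span_singleton_le_iff_mem]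
      exact hvχ

/-- The tuple acts on the line `v^⊥ / v` by a character `ψ` of norm one. If `ψ = χ` it is unipotent
up to scalars. Otherwise some entry has distinct eigenvalues on `v^⊥`, and its second eigenline
there is anisotropic and stable under the whole tuple by commutation. -/
theorem mem_of_eigen_isotropic (hn : Module.finrank E V = 3) {k : ℕ} {t : Fin k → Module.End E V}
    (ht : t ∈ h.tuples k) {χ : Fin k → E} {v : V} (hvχ : v ∈ eigen t χ) (hv0 : v ≠ 0)
    (hv : h.form v v = 0) : t ∈ h.unipTuples k ∨ t ∈ h.splitTuples k := by
  obtain ⟨u, w, f⟩ := h.exists_frame hn hv0 hv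
  have htu : ∀ i, ∃ c : E, ∃ a ∈ normOne F E, t i u = a • u + c • v := by
    intro i
    have h1 := perp_stable (ht.1 i) (hvχ i) (h.mem_perp.2 f.uv)
    have h2 := f.expand hn (t i u)
    rw [h.mem_perp.1 h1, zero_smul, add_zero, add_comm] at h2
    refine ⟨_, _, ?_, h2⟩
    have h3 := ht.1 i u u
    rw [f.uu, h2] at h3
    generalize h.form ((t i) u) u = a at h3
    simp only [h.add_left, h.add_right, h.smul_left, h.smul_right, f.uu, f.uv, f.vu, f.vv] at h3
    change a * bar F a = 1
    linear_combination h3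
  choose c ψ hψ htu using htu
  by_cases hne : ψ = χ
  · left
    refine ⟨ht, v, χ, hv0, hv, hne ▸ hψ, fun i => ⟨hvχ i, fun x hx => ?_⟩⟩
    have h2 := f.expand hn x
    rw [h.mem_perp.1 hx, zero_smul, add_zero] at h2
    generalize h.form x w = a at h2
    generalize h.form x u = b at h2
    refine ⟨b * c i, ?_⟩
    rw [h2, map_add, map_smul, map_smul, hvχ i, htu i, hne]
    module
  · right
    obtain ⟨i, hi⟩ := Function.ne_iff.1 hne
    have hd : ψ i - χ i ≠ 0 := sub_ne_zero.2 hi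
    -- Chosen so that `u + d v` is an eigenvector of `t i` with eigenvalue `ψ i`.
    set d := c i / (ψ i - χ i) with hdd
    have hcd : c i = d * (ψ i - χ i) := by rw [hdd, div_mul_cancel₀ _ hd]
    set y := u + d • v with hy
    have hyy : h.form y y = 1 := by
      simp only [hy, h.add_left, h.add_right, h.smul_left, h.smul_right, f.uu, f.uv, f.vu, f.vv]
      ring
    have hty : t i y = ψ i • y := by
      rw [hy, map_add, map_smul, htu i, hvχ i, hcd]
      module
    -- Every such eigenvector in `V` is orthogonal to `v`, because `ψ i` has norm one and differs
    -- from `χ i`. It therefore lies in `v^⊥`, where the `ψ i`-eigenspace is the line of `y`.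
    have hK : ∀ x, t i x = ψ i • x → ∃ a : E, x = a • y := by
      intro x hx
      have h1 := form_eq_zero_of_eigen (ht.1 i) (hψ i) hi hx (hvχ i)
      rw [form_eq_zero_comm] at h1
      have h2 := f.expand hn x
      rw [h1, zero_smul, add_zero] at h2
      generalize h.form x w = a at h2
      generalize h.form x u = b at h2
      refine ⟨b, ?_⟩
      have h3 : t i (x - b • y) = ψ i • (x - b • y) := by
        rw [map_sub, map_smul, hx, hty]; module
      have h4 : x - b • y = (a - b * d) • v := by rw [h2, hy]; module
      rw [h4, map_smul, hvχ i, ← sub_eq_zero] at h3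
      have h5 : ((a - b * d) * (χ i - ψ i)) • v = 0 := by rw [← h3]; module
      have h6 := (smul_eq_zero.1 h5).resolve_right hv0
      have h7 := (mul_eq_zero.1 h6).resolve_right (sub_ne_zero.2 (Ne.symm hi))
      rw [h7, zero_smul] at h4
      exact sub_eq_zero.1 h4
    have : ∀ j, ∃ a : E, t j y = a • y := by
      intro j
      apply hK
      have := congrFun (congrArg DFunLike.coe (ht.2 i j)) y
      rw [Module.End.mul_apply, Module.End.mul_apply, hty, map_smul] at this
      exact this
    choose ζ hζ using this
    have hζi : ζ i = ψ i := smul_left_injective E (h.ne_zero_of_unit hyy) ((hζ i).symm.trans hty)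
    refine ⟨ht, y, hyy, ζ, le_antisymm (fun x hx => ?_) ?_⟩
    · obtain ⟨a, rfl⟩ := hK x (by rw [← hζi]; exact hx i)
      exact Submodule.mem_span_singleton.2 ⟨a, rfl⟩
    · rw [Submodule.span_singleton_le_iff_mem]
      exact hζ

/-- The isotropic vector `v` is not on the eigenline of `u`, so their characters differ and `u` lies
in `v^⊥`. Unipotence then puts `(ψ i - χ i) u` on the line of `v`, and pairing with `u` gives `ψ i =
χ i`. -/
theorem not_mem_splitTuples_of_mem_unipTuples {k : ℕ} {t : Fin k → Module.End E V}
    (h1 : t ∈ h.unipTuples k) : t ∉ h.splitTuples k := by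
  rintro ⟨ht, u, hu, ψ, hψ⟩
  obtain ⟨-, v, χ, hv0, hv, hχ, hun⟩ := h1
  have huψ : u ∈ eigen t ψ := hψ ▸ Submodule.mem_span_singleton_self u
  have hψ1 : ψ ∈ normOneTuples F E k :=
    mem_normOneTuples_of_eigen ht huψ (by rw [hu]; exact one_ne_zero)
  have hvχ : v ∈ eigen t χ := fun i => (hun i).1
  have hmul : ∀ a : E, v = a • u → False := by
    rintro a rfl
    rw [h.smul_left, h.smul_right, hu] at hv
    have : a = 0 := by simpa using hv
    exact hv0 (by rw [this, zero_smul])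
  by_cases hne : χ = ψ
  · subst hne
    rw [hψ] at hvχ
    obtain ⟨a, ha⟩ := Submodule.mem_span_singleton.1 hvχ
    exact hmul a ha.symm
  · have huv := form_eq_zero_of_mem_eigen ht hχ hne hvχ huψ
    obtain ⟨i, hi⟩ := Function.ne_iff.1 hne
    obtain ⟨c, hc⟩ := (hun i).2 u huv
    rw [huψ i] at hc
    have hc' : (ψ i - χ i) • u = c • v := by rw [sub_smul, hc]; abel
    have h2 := congrArg (fun x => h.form x u) hc'
    have hvu : h.form v u = 0 := (h.form_eq_zero_comm _ _).1 huv
    simp only [h.smul_left, hu, hvu, mul_one, mul_zero] at h2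
    exact hi (sub_eq_zero.1 h2).symm

/-- The commuting tuples are of exactly one of three types. -/
theorem numComm_eq_add (hn : Module.finrank E V = 3) (k : ℕ) :
    numComm h.isom k
      = (h.irredTuples k).ncard + (h.unipTuples k).ncard + (h.splitTuples k).ncard := by
  have : Finite V := Module.finite_of_finite E
  have : Finite (Module.End E V) := Module.finite_of_finite E
  rw [← Set.ncard_union_eq, ← Set.ncard_union_eq, numComm]
  · congr 1
    ext t
    constructor
    · intro ht
      by_cases h0 : ∀ χ, eigen t χ = ⊥
      · exact Or.inl (Or.inl ⟨ht, h0⟩)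
      · push Not at h0
        obtain ⟨χ, hχ⟩ := h0
        obtain ⟨v, hv, hv0⟩ := (Submodule.ne_bot_iff _).1 hχ
        have : t ∈ h.unipTuples k ∨ t ∈ h.splitTuples k := by
          by_cases hvv : h.form v v = 0
          · exact h.mem_of_eigen_isotropic hn ht hv hv0 hvv
          · obtain ⟨a, -, ha⟩ := h.exists_unit_smul hvv
            exact h.mem_of_eigen_anisotropic hn ht (Submodule.smul_mem _ a hv) ha
        exact this.imp (fun h1 => Or.inr h1) id
    · rintro ((ht | ht) | ht)
      · exact ht.1
      · exact ht.1
      · exact ht.1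
  · rw [Set.disjoint_left]
    rintro t (⟨-, h1⟩ | h1) h2
    · obtain ⟨-, u, hu, χ, hχ⟩ := h2
      rw [h1 χ] at hχ
      exact h.ne_zero_of_unit hu (Submodule.span_singleton_eq_bot.1 hχ.symm)
    · exact h.not_mem_splitTuples_of_mem_unipTuples h1 h2
  · rw [Set.disjoint_left]
    rintro t ⟨-, h1⟩ ⟨-, v, χ, hv0, -, -, h2⟩
    have : v ∈ eigen t χ := fun i => (h2 i).1
    rw [h1 χ] at this
    exact hv0 ((Submodule.mem_bot E).1 this)

end HermitianSpace

/-! ### Split tuples and the order of `U₃` -/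

theorem ncard_distinct_triples {α : Type*} [Finite α] (X : Set α) (hX : X.Nonempty) :
    ({p : (α × α) × α | (p.1.1 ∈ X ∧ p.1.2 ∈ X ∧ p.1.2 ≠ p.1.1) ∧ p.2 ∈ X ∧ p.2 ≠ p.1.1 ∧
      p.2 ≠ p.1.2}.ncard : ℤ) = X.ncard * (X.ncard - 1) * (X.ncard - 2) := by
  have h1 : {p : α × α | p.1 ∈ X ∧ p.2 ∈ X ∧ p.2 ≠ p.1}.ncard = X.ncard * (X.ncard - 1) := by
    refine ncard_eq_mul_of_fibers Prod.fst (fun p hp => hp.1) fun a ha => ?_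
    rw [← Set.ncard_sdiff_singleton_of_mem ha, ← Set.ncard_image_of_injective (X \ {a})
      (f := fun b => (a, b)) (fun b c hbc => congrArg Prod.snd hbc)]
    congr 1
    ext ⟨a', b⟩
    simp only [Set.mem_ofPred_eq, Set.mem_image, Prod.mk.injEq, Set.mem_sdiff, Set.mem_singleton_iff]
    constructor
    · rintro ⟨⟨-, h2, h3⟩, rfl⟩
      exact ⟨b, ⟨h2, h3⟩, rfl, rfl⟩
    · rintro ⟨b, ⟨h2, h3⟩, rfl, rfl⟩
      exact ⟨⟨ha, h2, h3⟩, rfl⟩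
  have h2 : {p : (α × α) × α | (p.1.1 ∈ X ∧ p.1.2 ∈ X ∧ p.1.2 ≠ p.1.1) ∧ p.2 ∈ X ∧ p.2 ≠ p.1.1 ∧
      p.2 ≠ p.1.2}.ncard = (X.ncard * (X.ncard - 1)) * (X.ncard - 1 - 1) := by
    rw [← h1]
    refine ncard_eq_mul_of_fibers Prod.fst (fun p hp => hp.1) fun a ha => ?_
    have e : a.2 ∈ X \ {a.1} := ⟨ha.2.1, ha.2.2⟩
    rw [← Set.ncard_sdiff_singleton_of_mem ha.1, ← Set.ncard_sdiff_singleton_of_mem e,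
      ← Set.ncard_image_of_injective ((X \ {a.1}) \ {a.2})
      (f := fun b => (a, b)) (fun b c hbc => congrArg Prod.snd hbc)]
    congr 1
    ext ⟨a', b⟩
    simp only [Set.mem_ofPred_eq, Set.mem_image, Prod.mk.injEq, Set.mem_sdiff, Set.mem_singleton_iff]
    constructor
    · rintro ⟨⟨-, h2, h3, h4⟩, rfl⟩
      exact ⟨b, ⟨⟨h2, h3⟩, h4⟩, rfl, rfl⟩
    · rintro ⟨b, ⟨⟨h2, h3⟩, h4⟩, rfl, rfl⟩
      exact ⟨⟨ha, h2, h3, h4⟩, rfl⟩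
  rw [h2]
  have h3 : 0 < X.ncard := (Set.ncard_pos).2 hX
  obtain ⟨n, hn⟩ : ∃ n, X.ncard = n + 1 := ⟨X.ncard - 1, by omega⟩
  rw [hn]
  -- For a one-element set the truncated `1 - 1 - 1` differs from the integer value, but the factor
  -- `X.ncard - 1` already vanishes.
  rcases n with _ | n
  · simp
  · push_cast [Nat.add_sub_cancel]
    ring

namespace HermitianSpace

variable {F : Type*} [Field F] [Fintype F] {E : Type*} [Field E] [Algebra F E]
  {V : Type*} [AddCommGroup V] [Module E V] (h : HermitianSpace F E V)
  [Finite E] [Fact (Module.finrank F E = 2)] [FiniteDimensional E V]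

/-- The `p.1`-eigenspace of the glued tuple is the sum of the line of `u` and the `p.1`-eigenspace
of `p.2`, so it reduces to that line exactly when `p.1` is not a character of `p.2`. -/
theorem mem_splitVectors_glueTuple {u : V} (hu : h.form u u = 1) {k : ℕ}
    (p : (Fin k → E) × (Fin k → Module.End E (h.perp u))) :
    u ∈ h.splitVectors (h.glueTuple hu p) ↔ eigen p.2 p.1 = ⊥ := by
  have hup := h.self_mem_eigen_glueTuple hu p
  have hu0 := h.ne_zero_of_unit hu
  constructor
  · rintro ⟨-, χ, hχ⟩
    have huχ : u ∈ eigen (h.glueTuple hu p) χ := hχ ▸ Submodule.mem_span_singleton_self u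
    have e : p.1 = χ := funext fun i => smul_left_injective E hu0 ((hup i).symm.trans (huχ i))
    rw [Submodule.eq_bot_iff]
    intro x hx
    rw [← h.mem_eigen_glueTuple hu, e, hχ] at hx
    obtain ⟨a, ha⟩ := Submodule.mem_span_singleton.1 hx
    have := h.mem_perp.1 x.2
    rw [← ha, h.smul_left, hu, mul_one] at this
    rw [this, zero_smul] at ha
    exact Subtype.ext ha.symm
  · intro h0
    refine ⟨hu, p.1, le_antisymm (fun y hy => ?_) ?_⟩
    · obtain ⟨b, x, rfl⟩ := h.exists_split hu y
      have hx : (x : V) ∈ eigen (h.glueTuple hu p) p.1 := by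
        have := Submodule.sub_mem _ hy (Submodule.smul_mem _ b hup)
        rwa [add_sub_cancel_left] at this
      rw [h.mem_eigen_glueTuple hu, h0, Submodule.mem_bot] at hx
      rw [hx, Submodule.coe_zero, add_zero]
      exact Submodule.smul_mem _ _ (Submodule.mem_span_singleton_self u)
    · rw [Submodule.span_singleton_le_iff_mem]
      exact hup

/-- All pairs of a character of norm one and a tuple on `u^⊥`, sorted by whether the character
occurs in the tuple. In dimension three the second summand is given by `ncard_characters_plane`. -/
theorem ncard_tuples_splitVector {u : V} (hu : h.form u u = 1) (k : ℕ) :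
    {t | t ∈ h.tuples k ∧ u ∈ h.splitVectors t}.ncard
      + {p : (Fin k → E) × (Fin k → Module.End E (h.perp u)) | p.1 ∈ normOneTuples F E k ∧
        p.2 ∈ (h.perpSpace hu).tuples k ∧ eigen p.2 p.1 ≠ ⊥}.ncard
      = (Fintype.card F + 1) ^ k * numComm (h.perpSpace hu).isom k := by
  have : Finite V := Module.finite_of_finite E
  have : Finite (Module.End E (h.perp u)) := Module.finite_of_finite E
  rw [← ncard_normOneTuples F E, numComm, ← Set.ncard_prod]
  have e : {t | t ∈ h.tuples k ∧ u ∈ h.splitVectors t} = h.glueTuple hu ''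
      {p : (Fin k → E) × (Fin k → Module.End E (h.perp u)) | p.1 ∈ normOneTuples F E k ∧
        p.2 ∈ (h.perpSpace hu).tuples k ∧ eigen p.2 p.1 = ⊥} := by
    ext t
    constructor
    · rintro ⟨ht, hut⟩
      obtain ⟨-, χ, hχ⟩ := id hut
      have huχ : u ∈ eigen t χ := hχ ▸ Submodule.mem_span_singleton_self u
      obtain ⟨t', rfl⟩ := h.exists_glueTuple hu ht huχ
      have := (h.glueTuple_mem_tuples hu).1 ht
      exact ⟨_, ⟨this.1, this.2, (h.mem_splitVectors_glueTuple hu _).1 hut⟩, rfl⟩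
    · rintro ⟨p, ⟨h1, h2, h3⟩, rfl⟩
      exact ⟨(h.glueTuple_mem_tuples hu).2 ⟨h1, h2⟩, (h.mem_splitVectors_glueTuple hu p).2 h3⟩
  rw [e, Set.ncard_image_of_injective _ (h.glueTuple_injective hu k), ← Set.ncard_union_eq]
  · congr 1
    ext ⟨χ, t⟩
    constructor
    · rintro (⟨h1, h2, -⟩ | ⟨h1, h2, -⟩) <;> exact ⟨h1, h2⟩
    · rintro ⟨h1, h2⟩
      by_cases h3 : eigen t χ = ⊥
      · exact Or.inl ⟨h1, h2, h3⟩
      · exact Or.inr ⟨h1, h2, h3⟩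
  · rw [Set.disjoint_left]
    rintro _ ⟨-, -, h3⟩ ⟨-, -, h4⟩
    exact h4 h3

/-- The commuting tuples that are diagonal in an orthonormal basis, with distinct characters. -/
def regularTuples (k : ℕ) : Set (Fin k → Module.End E V) :=
  {t | t ∈ h.tuples k ∧ ∃ u ∈ h.splitVectors t, ∃ w ∈ h.splitVectors t, h.form w u = 0}

variable {h} in
theorem splitVectors_dichotomy {k : ℕ} {t : Fin k → Module.End E V} (ht : t ∈ h.tuples k) {u w : V}
    (hu : u ∈ h.splitVectors t) (hw : w ∈ h.splitVectors t) :
    (∃ a ∈ normOne F E, w = a • u) ∨ h.form w u = 0 := by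
  obtain ⟨hu1, χ, hχ⟩ := hu
  obtain ⟨hw1, ψ, hψ⟩ := hw
  have huχ : u ∈ eigen t χ := hχ ▸ Submodule.mem_span_singleton_self u
  have hwψ : w ∈ eigen t ψ := hψ ▸ Submodule.mem_span_singleton_self w
  by_cases hne : χ = ψ
  · left
    subst hne
    rw [hχ] at hwψ
    obtain ⟨a, rfl⟩ := Submodule.mem_span_singleton.1 hwψ
    refine ⟨a, ?_, rfl⟩
    rw [h.smul_left, h.smul_right, hu1, mul_one] at hw1
    exact hw1
  · exact Or.inr (form_eq_zero_of_mem_eigen ht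
      (mem_normOneTuples_of_eigen ht huχ (by rw [hu1]; exact one_ne_zero)) hne huχ hwψ)

variable {h} in
theorem smul_mem_splitVectors {k : ℕ} {t : Fin k → Module.End E V} {u : V}
    (hu : u ∈ h.splitVectors t) {a : E} (ha : a ∈ normOne F E) : a • u ∈ h.splitVectors t := by
  obtain ⟨hu1, χ, hχ⟩ := hu
  refine ⟨?_, χ, ?_⟩
  · rw [h.smul_left, h.smul_right, hu1, mul_one]
    exact ha
  · rw [hχ, Submodule.span_singleton_smul_eq (ne_zero_of_mem_normOne ha).isUnit]

theorem ncard_normOne_smul {u : V} (hu : u ≠ 0) :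
    ((fun a : E => a • u) '' normOne F E).ncard = Fintype.card F + 1 := by
  rw [Set.ncard_image_of_injective _ (smul_left_injective E hu), ncard_normOne]

theorem ncard_splitVectors_of_not_regular {k : ℕ} {t : Fin k → Module.End E V}
    (ht : t ∈ h.splitTuples k) (hr : t ∉ h.regularTuples k) :
    (h.splitVectors t).ncard = Fintype.card F + 1 := by
  obtain ⟨ht, u, hu⟩ := ht
  rw [← ncard_normOne_smul (F := F) (E := E) (V := V) (h.ne_zero_of_unit hu.1)]
  congr 1
  ext w
  constructor
  · intro hw
    rcases splitVectors_dichotomy ht hu hw with ⟨a, ha, rfl⟩ | h0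
    · exact ⟨a, ha, rfl⟩
    · exact absurd ⟨ht, u, hu, w, hw, h0⟩ hr
  · rintro ⟨a, ha, rfl⟩
    exact smul_mem_splitVectors hu ha

variable {h} in
-- The character of `z` differs from those of `u` and `w`, since their full eigenspaces do not
-- contain `z`. Its eigenspace is then orthogonal to both vectors and reduces to the line of `z`.
theorem mem_splitVectors_third {k : ℕ} {t : Fin k → Module.End E V} (ht : t ∈ h.tuples k)
    {u w z : V} (hu : u ∈ h.splitVectors t) (hw : w ∈ h.splitVectors t) (hz : h.form z z = 1)
    (hzu : h.form z u = 0) (hzw : h.form z w = 0)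
    (hall : ∀ y, h.form y u = 0 → h.form y w = 0 → ∃ a : E, y = a • z) :
    z ∈ h.splitVectors t := by
  obtain ⟨hu1, χ, hχ⟩ := hu
  obtain ⟨hw1, ψ, hψ⟩ := hw
  have huχ : u ∈ eigen t χ := hχ ▸ Submodule.mem_span_singleton_self u
  have hwψ : w ∈ eigen t ψ := hψ ▸ Submodule.mem_span_singleton_self w
  obtain ⟨ζ, hζ⟩ := exists_character_third ht huχ hwψ hzu hzw hall
  have hχ1 := mem_normOneTuples_of_eigen ht huχ (by rw [hu1]; exact one_ne_zero)
  have hψ1 := mem_normOneTuples_of_eigen ht hwψ (by rw [hw1]; exact one_ne_zero)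
  have aux : ∀ x : V, h.form x x = 1 → h.form z x = 0 → z ∈ Submodule.span E {x} → False := by
    intro x hx hzx hzs
    obtain ⟨a, rfl⟩ := Submodule.mem_span_singleton.1 hzs
    rw [h.smul_left, hx, mul_one] at hzx
    rw [hzx, zero_smul, zero_left] at hz
    exact zero_ne_one hz
  have hne1 : χ ≠ ζ := by
    rintro rfl
    exact aux u hu1 hzu (hχ ▸ hζ)
  have hne2 : ψ ≠ ζ := by
    rintro rfl
    exact aux w hw1 hzw (hψ ▸ hζ)
  refine ⟨hz, ζ, le_antisymm (fun x hx => ?_) ?_⟩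
  · obtain ⟨a, rfl⟩ := hall x (form_eq_zero_of_mem_eigen ht hχ1 hne1 huχ hx)
      (form_eq_zero_of_mem_eigen ht hψ1 hne2 hwψ hx)
    exact Submodule.smul_mem _ _ (Submodule.mem_span_singleton_self z)
  · rw [Submodule.span_singleton_le_iff_mem]
    exact hζ

/-- Two orthogonal split lines produce a third, and any split vector is on one of the three or
orthogonal to the first two. Each line has `q+1` unit vectors. -/
theorem ncard_splitVectors_of_regular (hn : Module.finrank E V = 3) {k : ℕ}
    {t : Fin k → Module.End E V} (hr : t ∈ h.regularTuples k) :
    (h.splitVectors t).ncard = 3 * (Fintype.card F + 1) := by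
  have : Finite V := Module.finite_of_finite E
  obtain ⟨ht, u, hu, w, hw, hwu⟩ := hr
  obtain ⟨z, hz, hzu, hzw, hall⟩ := h.exists_third_unit hn hu.1 hw.1 hwu
  have hz' := mem_splitVectors_third ht hu hw hz hzu hzw hall
  have hdis : ∀ x y : V, h.form x x = 1 → h.form y x = 0 →
      Disjoint ((fun a : E => a • x) '' normOne F E) ((fun a : E => a • y) '' normOne F E) := by
    intro x y hx hyx
    rw [Set.disjoint_left]
    rintro _ ⟨a, ha, rfl⟩ ⟨b, hb, hab⟩
    have := congrArg (fun v => h.form v x) hab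
    simp only [h.smul_left, hx, hyx, mul_one, mul_zero] at this
    exact ne_zero_of_mem_normOne ha this.symm
  have e : h.splitVectors t = ((fun a : E => a • u) '' normOne F E ∪
      (fun a : E => a • w) '' normOne F E) ∪ (fun a : E => a • z) '' normOne F E := by
    ext x
    constructor
    · intro hx
      rcases splitVectors_dichotomy ht hu hx with ⟨a, ha, rfl⟩ | h0
      · exact Or.inl (Or.inl ⟨a, ha, rfl⟩)
      rcases splitVectors_dichotomy ht hw hx with ⟨a, ha, rfl⟩ | h1
      · exact Or.inl (Or.inr ⟨a, ha, rfl⟩)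
      obtain ⟨a, rfl⟩ := hall x h0 h1
      have hx1 := hx.1
      rw [h.smul_left, h.smul_right, hz, mul_one] at hx1
      exact Or.inr ⟨a, hx1, rfl⟩
    · rintro ((⟨a, ha, rfl⟩ | ⟨a, ha, rfl⟩) | ⟨a, ha, rfl⟩)
      · exact smul_mem_splitVectors hu ha
      · exact smul_mem_splitVectors hw ha
      · exact smul_mem_splitVectors hz' ha
  rw [e, Set.ncard_union_eq, Set.ncard_union_eq, ncard_normOne_smul (F := F) (E := E) (V := V) (h.ne_zero_of_unit hu.1),
    ncard_normOne_smul (F := F) (E := E) (V := V) (h.ne_zero_of_unit hw.1), ncard_normOne_smul (F := F) (E := E) (V := V) (h.ne_zero_of_unit hz)]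
  · ring
  · exact hdis u w hu.1 hwu
  · rw [Set.disjoint_union_left]
    exact ⟨hdis u z hu.1 hzu, hdis w z hw.1 hzw⟩

theorem ncard_splitPairs_of_regular (hn : Module.finrank E V = 3) {k : ℕ}
    {t : Fin k → Module.End E V} (hr : t ∈ h.regularTuples k) :
    {p : V × V | p.1 ∈ h.splitVectors t ∧ p.2 ∈ h.splitVectors t ∧ h.form p.2 p.1 = 0}.ncard
      = 3 * (Fintype.card F + 1) * (2 * (Fintype.card F + 1)) := by
  have : Finite V := Module.finite_of_finite E
  have h3 := h.ncard_splitVectors_of_regular hn hr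
  rw [← h3]
  refine ncard_eq_mul_of_fibers Prod.fst (fun p hp => hp.1) fun u hu => ?_
  have h4 : {w | w ∈ h.splitVectors t ∧ h.form w u = 0}.ncard + (Fintype.card F + 1)
      = 3 * (Fintype.card F + 1) := by
    rw [← ncard_normOne_smul (F := F) (E := E) (V := V) (h.ne_zero_of_unit hu.1), ← Set.ncard_union_eq,
      ncard_normOne_smul (F := F) (E := E) (V := V) (h.ne_zero_of_unit hu.1), ← h3]
    · congr 1
      ext w
      constructor
      · rintro (⟨hw, -⟩ | ⟨a, ha, rfl⟩)
        · exact hw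
        · exact smul_mem_splitVectors hu ha
      · intro hw
        rcases splitVectors_dichotomy hr.1 hu hw with ⟨a, ha, rfl⟩ | h0
        · exact Or.inr ⟨a, ha, rfl⟩
        · exact Or.inl ⟨hw, h0⟩
    · rw [Set.disjoint_left]
      rintro _ ⟨-, h1⟩ ⟨a, ha, rfl⟩
      simp only [h.smul_left, hu.1, mul_one] at h1
      exact ne_zero_of_mem_normOne ha h1
  have h5 : {w | w ∈ h.splitVectors t ∧ h.form w u = 0}.ncard = 2 * (Fintype.card F + 1) := by omega
  rw [← h5, ← Set.ncard_image_of_injective {w | w ∈ h.splitVectors t ∧ h.form w u = 0}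
    (f := fun w => (u, w)) (fun a b hab => congrArg Prod.snd hab)]
  congr 1
  ext ⟨u', w⟩
  simp only [Set.mem_ofPred_eq, Set.mem_image, Prod.mk.injEq]
  constructor
  · rintro ⟨⟨h1, h2, h3⟩, rfl⟩
    exact ⟨w, ⟨h2, h3⟩, rfl, rfl⟩
  · rintro ⟨w, ⟨h2, h3⟩, rfl, rfl⟩
    exact ⟨⟨hu, h2, h3⟩, rfl⟩

/-- The orthonormal pairs of vectors. -/
def orthonormalPairs : Set (V × V) := {p | h.form p.1 p.1 = 1 ∧ h.form p.2 p.2 = 1 ∧ h.form p.2 p.1 = 0}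

theorem ncard_orthonormalPairs (hn : Module.finrank E V = 3) :
    (h.orthonormalPairs.ncard : ℤ) = (Fintype.card F ^ 5 + Fintype.card F ^ 2)
      * (Fintype.card F * (Fintype.card F ^ 2 - 1)) := by
  have : Finite V := Module.finite_of_finite E
  have hF := Fintype.card_pos (α := F)
  have key : h.orthonormalPairs.ncard = {u : V | h.form u u = 1}.ncard
      * (Fintype.card F * (Fintype.card F ^ 2 - 1)) := by
    refine ncard_eq_mul_of_fibers Prod.fst (fun p hp => hp.1) fun u hu => ?_
    have hu : h.form u u = 1 := hu
    have hd := h.finrank_perp (h.ne_zero_of_unit hu)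
    have h2 := (h.perpSpace hu).ncard_form_eq_one_two (by omega)
    have h3 : ({x | h.form x x = 1} : Set (h.perp u)).ncard = Fintype.card F * (Fintype.card F ^ 2 - 1) := by
      zify [Nat.one_le_pow 2 _ hF]
      exact h2
    rw [← h3, ← Set.ncard_image_of_injective ({x | h.form x x = 1} : Set (h.perp u))
      (f := fun x : h.perp u => (u, (x : V))) (fun a b hab => Subtype.ext (congrArg Prod.snd hab))]
    congr 1
    ext ⟨u', w⟩
    simp only [orthonormalPairs, Set.mem_ofPred_eq, Set.mem_image, Prod.mk.injEq]
    constructor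
    · rintro ⟨⟨-, hw1, hw2⟩, rfl⟩
      exact ⟨⟨w, hw2⟩, hw1, rfl, rfl⟩
    · rintro ⟨w, h2, rfl, rfl⟩
      exact ⟨⟨hu, h2, w.2⟩, rfl⟩
  rw [key]
  push_cast [Nat.cast_sub (Nat.one_le_pow 2 _ hF)]
  rw [h.ncard_form_eq_one_three hn]

/-- The endomorphism carrying an orthonormal basis to given vectors. -/
def basisMap (u w z u' w' z' : V) : Module.End E V :=
  (h.formLeft u).smulRight u' + (h.formLeft w).smulRight w' + (h.formLeft z).smulRight z'

theorem basisMap_apply (u w z u' w' z' x : V) : h.basisMap u w z u' w' z' x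
    = h.form x u • u' + h.form x w • w' + h.form x z • z' := rfl

theorem basisMap_mem_isom {u w z : V} (hu : h.form u u = 1) (hw : h.form w w = 1)
    (hz : h.form z z = 1) (hwu : h.form w u = 0) (hzu : h.form z u = 0) (hzw : h.form z w = 0)
    (hall : ∀ y, h.form y u = 0 → h.form y w = 0 → ∃ a : E, y = a • z) {u' w' z' : V}
    (hu' : h.form u' u' = 1) (hw' : h.form w' w' = 1)
    (hz' : h.form z' z' = 1) (hwu' : h.form w' u' = 0) (hzu' : h.form z' u' = 0)
    (hzw' : h.form z' w' = 0) : h.basisMap u w z u' w' z' ∈ h.isom := by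
  intro x y
  have hx := h.expand_unit hu hw hz hwu hzu hzw hall x
  have e : h.form x y = h.form x u * bar F (h.form y u) + h.form x w * bar F (h.form y w)
      + h.form x z * bar F (h.form y z) := by
    conv_lhs => rw [hx]
    simp only [h.add_left, h.smul_left, h.bar_form]
  rw [e, basisMap_apply, basisMap_apply]
  simp only [h.add_left, h.add_right, h.smul_left, h.smul_right, hu', hw', hz', hwu', hzu', hzw',
    (h.form_eq_zero_comm _ _).1 hwu', (h.form_eq_zero_comm _ _).1 hzu',
    (h.form_eq_zero_comm _ _).1 hzw']
  ring

/-- The number of regular tuples for which two given orthonormal vectors span eigenspaces. -/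
theorem ncard_regular_of_orthonormal (hn : Module.finrank E V = 3) {k : ℕ} {u w : V}
    (hu : h.form u u = 1) (hw : h.form w w = 1) (hwu : h.form w u = 0) :
    ({t | t ∈ h.tuples k ∧ u ∈ h.splitVectors t ∧ w ∈ h.splitVectors t}.ncard : ℤ)
      = (Fintype.card F + 1) ^ k * ((Fintype.card F + 1) ^ k - 1) * ((Fintype.card F + 1) ^ k - 2) := by
  obtain ⟨z, hz, hzu, hzw, hall⟩ := h.exists_third_unit hn hu hw hwu
  have hexp := h.expand_unit hu hw hz hwu hzu hzw hall
  have huw := (h.form_eq_zero_comm _ _).1 hwu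
  have huz := (h.form_eq_zero_comm _ _).1 hzu
  have hwz := (h.form_eq_zero_comm _ _).1 hzw
  have hu0 := h.ne_zero_of_unit hu
  have hw0 := h.ne_zero_of_unit hw
  have hz0 := h.ne_zero_of_unit hz
  set X := normOneTuples F E k with hX
  have hXn : X.Nonempty := ⟨1, fun i => by simp [normOne]⟩
  have hXc := ncard_distinct_triples X hXn
  have hc : (X.ncard : ℤ) = (Fintype.card F + 1) ^ k := by
    rw [hX, ncard_normOneTuples]; push_cast; rfl
  rw [hc] at hXc
  rw [← hXc]
  -- Diagonal tuples in the orthonormal basis. Requiring the lines of `u` and `w` to be full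
  -- eigenspaces is the same as requiring the three characters to be pairwise distinct.
  set φ : ((Fin k → E) × (Fin k → E)) × (Fin k → E) → (Fin k → Module.End E V) :=
    fun p i => h.basisMap u w z (p.1.1 i • u) (p.1.2 i • w) (p.2 i • z) with hφ
  have hφu : ∀ p, u ∈ eigen (φ p) p.1.1 := fun p i => by
    simp [hφ, basisMap_apply, hu, huw, huz]
  have hφw : ∀ p, w ∈ eigen (φ p) p.1.2 := fun p i => by
    simp [hφ, basisMap_apply, hw, hwu, hwz]
  have hφz : ∀ p, z ∈ eigen (φ p) p.2 := fun p i => by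
    simp [hφ, basisMap_apply, hz, hzu, hzw]
  have hφi : Function.Injective φ := by
    intro p p' hpp
    refine Prod.ext (Prod.ext (funext fun i => ?_) (funext fun i => ?_)) (funext fun i => ?_)
    · exact smul_left_injective E hu0 ((hφu p i).symm.trans (by rw [hpp]; exact hφu p' i))
    · exact smul_left_injective E hw0 ((hφw p i).symm.trans (by rw [hpp]; exact hφw p' i))
    · exact smul_left_injective E hz0 ((hφz p i).symm.trans (by rw [hpp]; exact hφz p' i))
  rw [← Set.ncard_image_of_injective _ hφi]
  congr 2
  ext t
  constructor
  · rintro ⟨ht, hut, hwt⟩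
    obtain ⟨-, ζ, hζ⟩ := mem_splitVectors_third ht hut hwt hz hzu hzw hall
    obtain ⟨-, χ, hχ⟩ := hut
    obtain ⟨-, ψ, hψ⟩ := hwt
    have huχ : u ∈ eigen t χ := hχ ▸ Submodule.mem_span_singleton_self u
    have hwψ : w ∈ eigen t ψ := hψ ▸ Submodule.mem_span_singleton_self w
    have hzζ : z ∈ eigen t ζ := hζ ▸ Submodule.mem_span_singleton_self z
    have aux : ∀ x y : V, h.form x x = 1 → h.form y y = 1 → h.form y x = 0 →
        y ∈ Submodule.span E {x} → False := by
      intro x y hx hy hyx hys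
      obtain ⟨a, rfl⟩ := Submodule.mem_span_singleton.1 hys
      rw [h.smul_left, hx, mul_one] at hyx
      rw [hyx, zero_smul, zero_left] at hy
      exact zero_ne_one hy
    refine ⟨((χ, ψ), ζ), ⟨⟨?_, ?_, ?_⟩, ?_, ?_, ?_⟩, funext fun i => ?_⟩
    · exact mem_normOneTuples_of_eigen ht huχ (by rw [hu]; exact one_ne_zero)
    · exact mem_normOneTuples_of_eigen ht hwψ (by rw [hw]; exact one_ne_zero)
    · intro he
      have he : ψ = χ := he
      rw [he, hχ] at hwψ
      exact aux u w hu hw hwu hwψ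
    · exact mem_normOneTuples_of_eigen ht hzζ (by rw [hz]; exact one_ne_zero)
    · intro he
      have he : ζ = χ := he
      rw [he, hχ] at hzζ
      exact aux u z hu hz hzu hzζ
    · intro he
      have he : ζ = ψ := he
      rw [he, hψ] at hzζ
      exact aux w z hw hz hzw hzζ
    · ext x
      have hx := hexp x
      have e : t i x = h.form x u • t i u + h.form x w • t i w + h.form x z • t i z := by
        conv_lhs => rw [hx, map_add, map_add, map_smul, map_smul, map_smul]
      rw [e, huχ i, hwψ i, hzζ i]
      rfl
  · rintro ⟨p, ⟨⟨h1, h2, h3⟩, h4, h5, h6⟩, rfl⟩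
    have hscal : ∀ {a : E} {x : V}, a ∈ normOne F E → h.form x x = 1 → h.form (a • x) (a • x) = 1 := by
      intro a x ha hx
      rw [h.smul_left, h.smul_right, hx, mul_one]
      exact ha
    have ht : φ p ∈ h.tuples k := by
      refine ⟨fun i => h.basisMap_mem_isom hu hw hz hwu hzu hzw hall (hscal (h1 i) hu)
        (hscal (h2 i) hw) (hscal (h4 i) hz) ?_ ?_ ?_, fun i j => ?_⟩
      · rw [h.smul_left, h.smul_right, hwu, mul_zero, mul_zero]
      · rw [h.smul_left, h.smul_right, hzu, mul_zero, mul_zero]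
      · rw [h.smul_left, h.smul_right, hzw, mul_zero, mul_zero]
      · ext x
        rw [Module.End.mul_apply, Module.End.mul_apply]
        simp only [hφ, basisMap_apply, h.add_left, h.smul_left, hu, hw, hz, huw, huz, hwz, hwu, hzu, hzw]
        module
    refine ⟨ht, ⟨hu, p.1.1, le_antisymm (fun x hx => ?_) ?_⟩,
      ⟨hw, p.1.2, le_antisymm (fun x hx => ?_) ?_⟩⟩
    · have e1 := form_eq_zero_of_mem_eigen ht h2 h3 (hφw p) hx
      have e2 := form_eq_zero_of_mem_eigen ht h4 h5 (hφz p) hx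
      have := hexp x
      rw [e1, e2, zero_smul, zero_smul, add_zero, add_zero] at this
      exact Submodule.mem_span_singleton.2 ⟨_, this.symm⟩
    · rw [Submodule.span_singleton_le_iff_mem]
      exact hφu p
    · have e1 := form_eq_zero_of_mem_eigen ht h1 (Ne.symm h3) (hφu p) hx
      have e2 := form_eq_zero_of_mem_eigen ht h4 h6 (hφz p) hx
      have := hexp x
      rw [e1, e2, zero_smul, zero_smul, add_zero, zero_add] at this
      exact Submodule.mem_span_singleton.2 ⟨_, this.symm⟩
    · rw [Submodule.span_singleton_le_iff_mem]
      exact hφw p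

/-- The order of the isometry group of a hermitian space of dimension three. -/
theorem ncard_isom (hn : Module.finrank E V = 3) : (h.isom.ncard : ℤ)
    = (Fintype.card F ^ 5 + Fintype.card F ^ 2) * (Fintype.card F * (Fintype.card F ^ 2 - 1))
      * (Fintype.card F + 1) := by
  have : Finite V := Module.finite_of_finite E
  have : Finite (Module.End E V) := Module.finite_of_finite E
  have := nontrivial_of_finrank (E := E) (V := V) hn
  obtain ⟨u, hu⟩ := h.exists_unit
  have hd := h.finrank_perp (h.ne_zero_of_unit hu)
  have hd2 : Module.finrank E (h.perp u) = 2 := by omega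
  have := nontrivial_of_finrank (E := E) hd2
  obtain ⟨⟨w, hwu⟩, hw⟩ := (h.perpSpace hu).exists_unit
  have hw : h.form w w = 1 := hw
  have hwu : h.form w u = 0 := hwu
  obtain ⟨z, hz, hzu, hzw, hall⟩ := h.exists_third_unit hn hu hw hwu
  have hexp := h.expand_unit hu hw hz hwu hzu hzw hall
  have huw := (h.form_eq_zero_comm _ _).1 hwu
  have huz := (h.form_eq_zero_comm _ _).1 hzu
  have hwz := (h.form_eq_zero_comm _ _).1 hzw
  rw [← h.ncard_orthonormalPairs hn]
  norm_cast
  -- The images of `u` and `w` form an arbitrary orthonormal pair, and the image of `z` is then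
  -- determined up to a scalar of norm one.
  refine ncard_eq_mul_of_fibers (fun g => (g u, g w))
    (fun g hg => ⟨by rw [hg, hu], by rw [hg, hw], by rw [hg, hwu]⟩) ?_
  rintro ⟨u', w'⟩ ⟨hu', hw', hwu'⟩
  simp only at hu' hw' hwu'
  obtain ⟨z', hz', hzu', hzw', hall'⟩ := h.exists_third_unit hn hu' hw' hwu'
  rw [← ncard_normOne F (E := E), ← Set.ncard_image_of_injective (normOne F E)
    (f := fun a : E => h.basisMap u w z u' w' (a • z'))]
  · congr 1
    ext g
    constructor
    · rintro ⟨hg, hgu⟩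
      obtain ⟨rfl, rfl⟩ := Prod.mk.inj hgu
      obtain ⟨a, ha⟩ := hall' (g z) (by rw [hg, hzu]) (by rw [hg, hzw])
      refine ⟨a, ?_, ?_⟩
      · have := hg z z
        rw [ha, h.smul_left, h.smul_right, hz', hz, mul_one] at this
        exact this
      · ext x
        have hx := hexp x
        have e : g x = h.form x u • g u + h.form x w • g w + h.form x z • g z := by
          conv_lhs => rw [hx, map_add, map_add, map_smul, map_smul, map_smul]
        rw [e, ha]
        rfl
    · rintro ⟨a, ha, rfl⟩
      refine ⟨h.basisMap_mem_isom hu hw hz hwu hzu hzw hall hu' hw' ?_ hwu' ?_ ?_, ?_⟩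
      · rw [h.smul_left, h.smul_right, hz', mul_one]
        exact ha
      · rw [h.smul_left, hzu', mul_zero]
      · rw [h.smul_left, hzw', mul_zero]
      · simp [basisMap_apply, hu, hw, huw, huz, hwu, hwz]
  · intro a b hab
    have := congrFun (congrArg DFunLike.coe hab) z
    simp only [basisMap_apply, hz, hzu, hzw, zero_smul, zero_add, one_smul] at this
    exact smul_left_injective E (h.ne_zero_of_unit hz') this

/-- The number of commuting tuples with an anisotropic line as a common eigenspace. -/
theorem ncard_splitTuples (h2 : (2 : F) ≠ 0) (hn : Module.finrank E V = 3) (k : ℕ) :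
    6 * (Fintype.card F + 1) ^ 2 * ((h.splitTuples k).ncard : ℤ)
      = 3 * (Fintype.card F + 1) * (Fintype.card F ^ 5 + Fintype.card F ^ 2)
        * ((Fintype.card F + 1) ^ k * (2 * (Fintype.card F + 1)
              * (Fintype.card F * (Fintype.card F + 1)) ^ k
            + Fintype.card F * (Fintype.card F + 1) * (Fintype.card F ^ 2 - 1) ^ k
            + Fintype.card F * (Fintype.card F - 1) * ((Fintype.card F + 1) ^ 2) ^ k
            - 2 * Fintype.card F * (Fintype.card F + 1) * (Fintype.card F + 1) ^ k)
          - 2 * (Fintype.card F * (Fintype.card F - 1) * ((Fintype.card F + 1) ^ k) ^ 2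
            + (Fintype.card F + 1) * (Fintype.card F + 1) ^ k * Fintype.card F ^ k
            - Fintype.card F ^ 2 * (Fintype.card F + 1) ^ k))
        - 2 * (Fintype.card F ^ 5 + Fintype.card F ^ 2) * (Fintype.card F * (Fintype.card F ^ 2 - 1))
          * ((Fintype.card F + 1) ^ k * ((Fintype.card F + 1) ^ k - 1)
            * ((Fintype.card F + 1) ^ k - 2)) := by
  have : Finite V := Module.finite_of_finite E
  have : Finite (Module.End E V) := Module.finite_of_finite E
  set D := h.regularTuples k with hD
  set P := {t | t ∈ h.splitTuples k ∧ t ∉ D} with hP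
  have hDP : (h.splitTuples k).ncard = P.ncard + D.ncard := by
    rw [← Set.ncard_union_eq]
    · congr 1
      ext t
      constructor
      · intro ht
        by_cases h1 : t ∈ D
        · exact Or.inr h1
        · exact Or.inl ⟨ht, h1⟩
      · rintro (h1 | ⟨h1, u, hu, -⟩)
        · exact h1.1
        · exact ⟨h1, u, hu⟩
    · rw [Set.disjoint_left]
      exact fun t h1 h3 => h1.2 h3
  -- counting regular tuples
  have hreg : (D.ncard : ℤ) * (3 * (Fintype.card F + 1) * (2 * (Fintype.card F + 1)))
      = (Fintype.card F ^ 5 + Fintype.card F ^ 2) * (Fintype.card F * (Fintype.card F ^ 2 - 1))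
        * ((Fintype.card F + 1) ^ k * ((Fintype.card F + 1) ^ k - 1)
            * ((Fintype.card F + 1) ^ k - 2)) := by
    rw [← h.ncard_orthonormalPairs hn]
    -- The integer expression is a cardinality, so it can serve as a fibre size in a double count
    -- over the natural numbers.
    obtain ⟨N, hN⟩ : ∃ N : ℕ, (N : ℤ) = (Fintype.card F + 1) ^ k * ((Fintype.card F + 1) ^ k - 1)
        * ((Fintype.card F + 1) ^ k - 2) := by
      have := nontrivial_of_finrank (E := E) (V := V) hn
      obtain ⟨u, hu⟩ := h.exists_unit
      have hd := h.finrank_perp (h.ne_zero_of_unit hu)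
      have hd2 : Module.finrank E (h.perp u) = 2 := by omega
      have := nontrivial_of_finrank (E := E) hd2
      obtain ⟨⟨w, hwu⟩, hw⟩ := (h.perpSpace hu).exists_unit
      exact ⟨_, h.ncard_regular_of_orthonormal hn hu hw hwu⟩
    rw [← hN]
    have key : D.ncard * (3 * (Fintype.card F + 1) * (2 * (Fintype.card F + 1)))
        = h.orthonormalPairs.ncard * N := by
      refine ncard_mul_eq_ncard_mul
        (fun t p => p.1 ∈ h.splitVectors t ∧ p.2 ∈ h.splitVectors t) ?_ ?_
      · intro t ht
        rw [← h.ncard_splitPairs_of_regular hn ht]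
        congr 1
        ext p
        exact ⟨fun hp => ⟨hp.2.1, hp.2.2, hp.1.2.2⟩, fun hp => ⟨⟨hp.1.1, hp.2.1.1, hp.2.2⟩, hp.1, hp.2.1⟩⟩
      · rintro ⟨u, w⟩ ⟨hu, hw, hwu⟩
        zify
        rw [hN, ← h.ncard_regular_of_orthonormal hn hu hw hwu]
        congr 2
        ext t
        exact ⟨fun ht => ⟨ht.1.1, ht.2⟩, fun ht => ⟨⟨ht.1, u, ht.2.1, w, ht.2.2, hwu⟩, ht.2⟩⟩
    exact_mod_cast key
  -- counting all pairs of a tuple and a vector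
  set R : Set ((Fin k → Module.End E V) × V) := {r | r.1 ∈ h.tuples k ∧ r.2 ∈ h.splitVectors r.1} with hR
  have hR1 : R.ncard = P.ncard * (Fintype.card F + 1) + D.ncard * (3 * (Fintype.card F + 1)) := by
    have hfib : ∀ (A : Set (Fin k → Module.End E V)) (c : ℕ), A ⊆ h.tuples k →
        (∀ t ∈ A, (h.splitVectors t).ncard = c) → {r | r ∈ R ∧ r.1 ∈ A}.ncard = A.ncard * c := by
      intro A c hA hc
      refine ncard_eq_mul_of_fibers Prod.fst (fun r hr => hr.2) fun t ht => ?_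
      rw [← hc t ht, ← Set.ncard_image_of_injective (h.splitVectors t) (f := fun u => (t, u))
        (fun a b hab => congrArg Prod.snd hab)]
      congr 1
      ext ⟨t', u⟩
      simp only [hR, Set.mem_ofPred_eq, Set.mem_image, Prod.mk.injEq]
      constructor
      · rintro ⟨⟨⟨h1, h3⟩, -⟩, rfl⟩
        exact ⟨u, h3, rfl, rfl⟩
      · rintro ⟨u, h1, rfl, rfl⟩
        exact ⟨⟨⟨hA ht, h1⟩, ht⟩, rfl⟩
    rw [← hfib P _ (fun t ht => ht.1.1) (fun t ht => h.ncard_splitVectors_of_not_regular ht.1 ht.2),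
      ← hfib D _ (fun t ht => ht.1) (fun t ht => h.ncard_splitVectors_of_regular hn ht),
      ← Set.ncard_union_eq]
    · congr 1
      ext r
      constructor
      · intro hr
        by_cases h1 : r.1 ∈ D
        · exact Or.inr ⟨hr, h1⟩
        · exact Or.inl ⟨hr, ⟨hr.1, r.2, hr.2⟩, h1⟩
      · rintro (h1 | h1) <;> exact h1.1
    · rw [Set.disjoint_left]
      exact fun r h1 h3 => h1.2.2 h3.2
  have hunit : ∀ u : V, h.form u u = 1 →
      2 * ({t | t ∈ h.tuples k ∧ u ∈ h.splitVectors t}.ncard : ℤ)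
        = (Fintype.card F + 1) ^ k * (2 * (Fintype.card F + 1)
              * (Fintype.card F * (Fintype.card F + 1)) ^ k
            + Fintype.card F * (Fintype.card F + 1) * (Fintype.card F ^ 2 - 1) ^ k
            + Fintype.card F * (Fintype.card F - 1) * ((Fintype.card F + 1) ^ 2) ^ k
            - 2 * Fintype.card F * (Fintype.card F + 1) * (Fintype.card F + 1) ^ k)
          - 2 * (Fintype.card F * (Fintype.card F - 1) * ((Fintype.card F + 1) ^ k) ^ 2
            + (Fintype.card F + 1) * (Fintype.card F + 1) ^ k * Fintype.card F ^ k
            - Fintype.card F ^ 2 * (Fintype.card F + 1) ^ k) := by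
    intro u hu
    have hd := h.finrank_perp (h.ne_zero_of_unit hu)
    have hd2 : Module.finrank E (h.perp u) = 2 := by omega
    have e1 := congrArg (Nat.cast : ℕ → ℤ) (h.ncard_tuples_splitVector hu k)
    push_cast at e1
    rw [(h.perpSpace hu).ncard_characters_plane hd2] at e1
    have e2 := (h.perpSpace hu).two_mul_numComm_isom h2 hd2 k
    rw [← e2]
    linear_combination 2 * e1
  have hR2 : 2 * (R.ncard : ℤ) = (Fintype.card F ^ 5 + Fintype.card F ^ 2)
      * ((Fintype.card F + 1) ^ k * (2 * (Fintype.card F + 1)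
              * (Fintype.card F * (Fintype.card F + 1)) ^ k
            + Fintype.card F * (Fintype.card F + 1) * (Fintype.card F ^ 2 - 1) ^ k
            + Fintype.card F * (Fintype.card F - 1) * ((Fintype.card F + 1) ^ 2) ^ k
            - 2 * Fintype.card F * (Fintype.card F + 1) * (Fintype.card F + 1) ^ k)
          - 2 * (Fintype.card F * (Fintype.card F - 1) * ((Fintype.card F + 1) ^ k) ^ 2
            + (Fintype.card F + 1) * (Fintype.card F + 1) ^ k * Fintype.card F ^ k
            - Fintype.card F ^ 2 * (Fintype.card F + 1) ^ k)) := by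
    have := nontrivial_of_finrank (E := E) (V := V) hn
    obtain ⟨u₀, hu₀⟩ := h.exists_unit
    have key : R.ncard = {u : V | h.form u u = 1}.ncard
        * {t | t ∈ h.tuples k ∧ u₀ ∈ h.splitVectors t}.ncard := by
      refine ncard_eq_mul_of_fibers Prod.snd (fun r hr => hr.2.1) fun u hu => ?_
      have e : {t | t ∈ h.tuples k ∧ u₀ ∈ h.splitVectors t}.ncard
          = {t | t ∈ h.tuples k ∧ u ∈ h.splitVectors t}.ncard := by
        have := (hunit u₀ hu₀).trans (hunit u hu).symm
        omega
      rw [e, ← Set.ncard_image_of_injective {t | t ∈ h.tuples k ∧ u ∈ h.splitVectors t}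
        (f := fun t => (t, u)) (fun a b hab => congrArg Prod.fst hab)]
      congr 1
      ext ⟨t, u'⟩
      simp only [hR, Set.mem_ofPred_eq, Set.mem_image, Prod.mk.injEq]
      constructor
      · rintro ⟨⟨h1, h3⟩, rfl⟩
        exact ⟨t, ⟨h1, h3⟩, rfl, rfl⟩
      · rintro ⟨t, ⟨h1, h3⟩, rfl, rfl⟩
        exact ⟨⟨h1, h3⟩, rfl⟩
    rw [key, ← hunit u₀ hu₀]
    push_cast
    rw [h.ncard_form_eq_one_three hn]
    ring
  have hR1' := congrArg (Nat.cast : ℕ → ℤ) hR1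
  push_cast at hR1'
  rw [hDP]
  push_cast
  -- Elimination of `P.ncard`: regular tuples contribute `3(q+1)` instead of `q+1` to `R`, so
  -- `(q+1)(|P| + |D|) = |R| - 2(q+1)|D|`.
  linear_combination -6 * (Fintype.card F + 1 : ℤ) * hR1' + 3 * (Fintype.card F + 1 : ℤ) * hR2
    - 2 * hreg

end HermitianSpace

/-! ### Irreducible tuples and centralizers -/

/-- The number of elements of norm one for an involution on a finite skew field. -/
theorem ncard_mul_involution_eq_one {R : Type*} [Ring R] [IsDomain R] [Finite R] (τ : R → R)
    (hadd : ∀ x y, τ (x + y) = τ x + τ y) (hmul : ∀ x y, τ (x * y) = τ y * τ x)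
    (hinv : ∀ x, τ (τ x) = x) (hne : ∃ x, τ x ≠ x) {Q : ℕ} (hQ : Nat.card R = Q ^ 2) :
    {x | τ x * x = 1}.ncard = Q + 1 := by
  classical
  let _ : Field R := (Finite.isDomain_to_isField R).toField
  have hone : τ 1 = 1 := by
    have := hmul 1 (τ 1)
    rw [one_mul, hinv, one_mul] at this
    exact this.symm
  let T : R ≃+* R :=
    { toFun := τ
      invFun := τ
      left_inv := hinv
      right_inv := hinv
      map_add' := hadd
      map_mul' := fun x y => by rw [hmul, mul_comm] }
  have hT : ∀ x, T x = τ x := fun _ => rfl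
  -- A finite domain is a field, so the involution is an automorphism of order two. Its fixed field
  -- has index two, hence `Q` elements, and the norm count for quadratic extensions applies.
  let K : Subfield R := FixedPoints.subfield (Subgroup.zpowers T) R
  have hK : ∀ x, x ∈ K ↔ τ x = x := by
    intro x
    constructor
    · intro hx
      exact hx ⟨T, Subgroup.mem_zpowers T⟩
    · rintro hx ⟨_, n, rfl⟩
      have : T • x = x := hx
      change (T ^ n) • x = x
      exact MulAction.mem_stabilizer_iff.1 (Subgroup.zpow_mem _ (MulAction.mem_stabilizer_iff.2 this) n)
  have hord : orderOf T = 2 := by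
    refine orderOf_eq_prime ?_ ?_
    · ext x
      rw [sq]
      exact hinv x
    · rintro h1
      obtain ⟨x, hx⟩ := hne
      exact hx (by rw [← hT, h1]; rfl)
  have := Fintype.ofFinite R
  have : Finite (R ≃+* R) := Finite.of_injective (fun f : R ≃+* R => (f : R → R)) DFunLike.coe_injective
  have := Fintype.ofFinite (Subgroup.zpowers T)
  have hfin : Module.finrank K R = 2 := by
    rw [← hord, ← Nat.card_zpowers, Nat.card_eq_fintype_card]
    exact FixedPoints.finrank_eq_card (Subgroup.zpowers T) R
  have : Fact (Module.finrank K R = 2) := ⟨hfin⟩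
  have := Fintype.ofFinite K
  have hc : Fintype.card K = Q := by
    have := card_quadratic K (E := R)
    rw [hQ] at this
    exact (Nat.pow_left_injective (n := 2) (by norm_num) this).symm
  -- Both `x` and `τ x` are the roots of `X² - (x + τ x) X + x τ x`, whose coefficients lie in `K`;
  -- `bar K x` is a root as well. If it equals `x`, then `x` lies in `K` and `τ` fixes it too.
  have hbar : ∀ x, bar K x = τ x := by
    intro x
    obtain ⟨a, ha⟩ : ∃ a : K, algebraMap K R a = x + τ x :=
      ⟨⟨x + τ x, (hK _).2 (by rw [hadd, hinv, add_comm])⟩, rfl⟩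
    obtain ⟨b, hb⟩ : ∃ b : K, algebraMap K R b = x * τ x :=
      ⟨⟨x * τ x, (hK _).2 (by rw [hmul, hinv])⟩, rfl⟩
    have h1 : x * x - algebraMap K R a * x + algebraMap K R b = 0 := by
      rw [ha, hb]; ring
    have h2 := congrArg (bar K) h1
    rw [map_add, map_sub, map_mul, map_mul, bar_algebraMap, bar_algebraMap, map_zero, ha, hb] at h2
    have h3 : (bar K x - x) * (bar K x - τ x) = 0 := by linear_combination h2
    rcases mul_eq_zero.1 h3 with h4 | h4
    · obtain ⟨y, hy⟩ := exists_algebraMap_of_bar_eq K (sub_eq_zero.1 h4)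
      rw [sub_eq_zero.1 h4, ← hy]
      exact ((hK _).1 y.2).symm
    · exact sub_eq_zero.1 h4
  rw [← hc, ← ncard_normOne K (E := R)]
  congr 1
  ext x
  rw [normOne, Set.mem_ofPred_eq, Set.mem_ofPred_eq, hbar, mul_comm]

namespace HermitianSpace

variable {F : Type*} [Field F] [Fintype F] {E : Type*} [Field E] [Algebra F E]
  {V : Type*} [AddCommGroup V] [Module E V] (h : HermitianSpace F E V)

variable [Finite E] [Fact (Module.finrank F E = 2)] [FiniteDimensional E V]

/-- The map `y ↦ h(·, y)` is conjugate-linear and injective by non-degeneracy, and `V` and its dual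
have the same finite cardinality. -/
theorem exists_formLeft_eq (f : V →ₗ[E] E) : ∃ y, h.formLeft y = f := by
  have : Finite V := Module.finite_of_finite E
  have hinj : Function.Injective h.formLeft := by
    intro y z hyz
    rw [← sub_eq_zero]
    refine h.nondeg _ fun x => ?_
    rw [form_eq_zero_comm, h.sub_right, sub_eq_zero]
    exact LinearMap.congr_fun hyz x
  have hc : Nat.card (V →ₗ[E] E) ≤ Nat.card V := by
    rw [Module.natCard_eq_pow_finrank (K := E) (V := V →ₗ[E] E),
      Module.natCard_eq_pow_finrank (K := E) (V := V)]
    exact (congrArg _ (Subspace.dual_finrank_eq (K := E) (V := V))).le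
  have : Finite (V →ₗ[E] E) := Module.finite_of_finite E
  exact (hinj.bijective_of_nat_card_le hc).2 f

theorem eq_of_form_eq {y z : V} (hyz : ∀ x, h.form x y = h.form x z) : y = z := by
  rw [← sub_eq_zero]
  refine h.nondeg _ fun x => ?_
  rw [form_eq_zero_comm, h.sub_right, hyz, sub_self]

theorem exists_adjoint (c : Module.End E V) :
    ∃ d : Module.End E V, ∀ x y, h.form (c x) y = h.form x (d y) := by
  have := fun y => h.exists_formLeft_eq (h.formLeft y ∘ₗ c)
  choose d hd using this
  have hd : ∀ x y, h.form (c x) y = h.form x (d y) := fun x y => (LinearMap.congr_fun (hd y) x).symm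
  refine ⟨{ toFun := d, map_add' := fun y z => ?_, map_smul' := fun a y => ?_ }, hd⟩
  · refine h.eq_of_form_eq fun x => ?_
    rw [← hd, h.add_right, h.add_right, hd, hd]
  · refine h.eq_of_form_eq fun x => ?_
    rw [← hd, RingHom.id_apply, h.smul_right, h.smul_right, hd]

/-- The adjoint of an endomorphism. -/
noncomputable def adjoint (c : Module.End E V) : Module.End E V := (h.exists_adjoint c).choose

theorem form_adjoint (c : Module.End E V) (x y : V) : h.form (c x) y = h.form x (h.adjoint c y) :=
  (h.exists_adjoint c).choose_spec x y

theorem form_adjoint' (c : Module.End E V) (x y : V) : h.form (h.adjoint c x) y = h.form x (c y) := by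
  rw [← h.bar_form, ← h.form_adjoint, h.bar_form]

theorem adjoint_eq {c d : Module.End E V} (hd : ∀ x y, h.form (c x) y = h.form x (d y)) :
    h.adjoint c = d :=
  LinearMap.ext fun y => h.eq_of_form_eq fun x => by rw [← hd, form_adjoint]

/-- A proper subspace of a three-dimensional space determines a line that is stable under all
isometries which stabilise the subspace. -/
theorem exists_eigenvector_of_stable (hn : Module.finrank E V = 3) {W : Submodule E V} (h0 : W ≠ ⊥)
    (h1 : W ≠ ⊤) : ∃ v : V, v ≠ 0 ∧
      ∀ g ∈ h.isom, (∀ x ∈ W, g x ∈ W) → ∃ a : E, g v = a • v := by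
  have hlt := Submodule.finrank_lt h1
  have hpos : 0 < Module.finrank E W := by
    rw [Nat.pos_iff_ne_zero, Ne, Submodule.finrank_eq_zero]
    exact h0
  rcases (by omega : Module.finrank E W = 1 ∨ Module.finrank E W = 2) with hW | hW
  · obtain ⟨v, hv, hv0⟩ := W.ne_bot_iff.1 h0
    exact ⟨v, hv0, fun g _ hs => exists_smul_of_finrank_one hW hv hv0 (hs v hv)⟩
  · obtain ⟨f, hf, hWf⟩ := Submodule.exists_le_ker_of_lt_top W (lt_top_iff_ne_top.2 h1)
    obtain ⟨v, rfl⟩ := h.exists_formLeft_eq f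
    have hv0 : v ≠ 0 := by
      rintro rfl
      exact hf (LinearMap.ext fun x => h.zero_right x)
    have hperp : ∀ z : V, z ≠ 0 → W ≤ h.perp z → W = h.perp z := fun z hz hWz => by
      refine Submodule.eq_of_le_of_finrank_eq hWz ?_
      have := h.finrank_perp hz
      omega
    have hWv := hperp v hv0 hWf
    refine ⟨v, hv0, fun g hg hs => ?_⟩
    have hWg : W ≤ h.perp (g v) := by
      have hi : Function.Injective (g.restrict hs) := fun x y hxy =>
        Subtype.ext (isom_injective hg (congrArg Subtype.val hxy))
      intro x hx
      obtain ⟨x', hx'⟩ := LinearMap.surjective_of_injective hi ⟨x, hx⟩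
      have : g x' = x := congrArg Subtype.val hx'
      rw [mem_perp, ← this, hg]
      exact hWf x'.2
    obtain ⟨z, -, hz⟩ := SetLike.exists_of_lt (lt_top_iff_ne_top.2 h1)
    have hzv : h.form z v ≠ 0 := fun h3 => hz (hWv ▸ h3)
    -- The coefficient making `g v - a v` orthogonal to `z`. This vector is also orthogonal to `W`;
    -- if it were nonzero, `W` would be its full orthogonal complement and would contain `z`.
    refine ⟨bar F (h.form z (g v) / h.form z v), ?_⟩
    by_contra hne
    have hp := hperp (g v - bar F (h.form z (g v) / h.form z v) • v) (sub_ne_zero.2 hne)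
      fun x hx => by
        have e1 : h.form x (g v) = 0 := hWg hx
        have e2 : h.form x v = 0 := hWf hx
        rw [mem_perp, h.sub_right, h.smul_right, e1, e2, mul_zero, sub_zero]
    refine hz (hp ▸ ?_)
    rw [mem_perp, h.sub_right, h.smul_right, bar_bar, div_mul_cancel₀ _ hzv, sub_self]

/-- The isometries without eigenvectors. -/
def irreducibles : Set (Module.End E V) := {g | g ∈ h.isom ∧ ∀ (a : E) v, g v = a • v → v = 0}

variable {h} in
theorem eq_bot_or_top_of_irreducible (hn : Module.finrank E V = 3) {g : Module.End E V}
    (hg : g ∈ h.irreducibles) {W : Submodule E V} (hs : ∀ x ∈ W, g x ∈ W) : W = ⊥ ∨ W = ⊤ := by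
  by_contra! hW
  obtain ⟨v, hv0, hv⟩ := h.exists_eigenvector_of_stable hn hW.1 hW.2
  obtain ⟨a, ha⟩ := hv g hg.1 hs
  exact hv0 (hg.2 a v ha)

variable {h} in
-- Schur's lemma: the kernel of `c` is stable under `g`, which has no proper nonzero stable
-- subspace.
theorem eq_zero_of_commute (hn : Module.finrank E V = 3) {g c : Module.End E V}
    (hg : g ∈ h.irreducibles) (hc : g * c = c * g) {v : V} (hv : c v = 0) (hv0 : v ≠ 0) : c = 0 := by
  rcases eq_bot_or_top_of_irreducible hn hg (W := LinearMap.ker c) fun x hx => by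
    have := LinearMap.congr_fun hc x
    rw [Module.End.mul_apply, Module.End.mul_apply, LinearMap.mem_ker.1 hx, map_zero] at this
    exact this.symm with h1 | h1
  · exact absurd ((Submodule.eq_bot_iff _).1 h1 v hv) hv0
  · exact LinearMap.ker_eq_top.1 h1

variable {h} in
theorem adjoint_commute {g c : Module.End E V} (hg : g ∈ h.isom) (hc : g * c = c * g) :
    g * h.adjoint c = h.adjoint c * g := by
  refine LinearMap.ext fun y => h.eq_of_form_eq fun x => ?_
  obtain ⟨x, rfl⟩ := LinearMap.surjective_of_injective (isom_injective hg) x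
  have : g (c x) = c (g x) := LinearMap.congr_fun hc x
  rw [Module.End.mul_apply, Module.End.mul_apply, hg, ← h.form_adjoint, ← h.form_adjoint, ← this, hg]

variable {h} in
theorem isDomain_centralizer (hn : Module.finrank E V = 3) {g : Module.End E V}
    (hg : g ∈ h.irreducibles) : IsDomain (Subalgebra.centralizer E {g}) := by
  have := nontrivial_of_finrank (E := E) (V := V) hn
  have : NoZeroDivisors (Subalgebra.centralizer E {g}) := by
    refine ⟨fun {c d} hcd => ?_⟩
    by_contra! h0
    obtain ⟨v, hv⟩ : ∃ v, d.1 v ≠ 0 := by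
      by_contra! h1
      exact h0.2 (Subtype.ext (LinearMap.ext h1))
    refine h0.1 (Subtype.ext (eq_zero_of_commute hn hg (c.2 g rfl)
      (LinearMap.congr_fun (congrArg Subtype.val hcd) v) hv))
  exact NoZeroDivisors.to_isDomain _

variable {h} in
-- Evaluation at a nonzero vector identifies the centralizer with `V`. It is injective by Schur's
-- lemma, and its image is nonzero and stable under `g`, hence everything.
theorem card_centralizer (hn : Module.finrank E V = 3) {g : Module.End E V}
    (hg : g ∈ h.irreducibles) :
    Nat.card (Subalgebra.centralizer E {g}) = (Fintype.card F ^ 3) ^ 2 := by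
  have := nontrivial_of_finrank (E := E) (V := V) hn
  obtain ⟨v, hv⟩ := exists_ne (0 : V)
  have hc := card_space (F := F) (E := E) (V := V)
  rw [hn] at hc
  rw [← pow_mul, ← hc]
  let φ : Subalgebra.centralizer E {g} →ₗ[E] V :=
    (LinearMap.applyₗ v) ∘ₗ (Subalgebra.centralizer E {g}).val.toLinearMap
  have hφ : ∀ c, φ c = c.1 v := fun _ => rfl
  refine Nat.card_congr (Equiv.ofBijective φ ⟨?_, ?_⟩)
  · rw [← LinearMap.ker_eq_bot, LinearMap.ker_eq_bot']
    intro c hcv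
    exact Subtype.ext (eq_zero_of_commute hn hg (c.2 g rfl) hcv hv)
  · rw [← LinearMap.range_eq_top]
    refine (eq_bot_or_top_of_irreducible hn hg ?_).resolve_left ?_
    · rintro _ ⟨c, rfl⟩
      exact ⟨⟨g, fun x hx => by rw [Set.mem_singleton_iff.1 hx]⟩ * c, rfl⟩
    · exact (Submodule.ne_bot_iff _).2 ⟨v, ⟨1, rfl⟩, hv⟩

/-- The isometries that commute with `g`. -/
def commutant (g : Module.End E V) : Set (Module.End E V) := {c | c ∈ h.isom ∧ g * c = c * g}

variable {h} in
theorem commutant_commute (hn : Module.finrank E V = 3) {g : Module.End E V}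
    (hg : g ∈ h.irreducibles) {c d : Module.End E V} (hc : c ∈ h.commutant g)
    (hd : d ∈ h.commutant g) : c * d = d * c := by
  have := isDomain_centralizer hn hg
  have : Finite (Module.End E V) := Module.finite_of_finite E
  have hmem : ∀ c ∈ h.commutant g, c ∈ Subalgebra.centralizer E {g} := by
    intro c hc x hx
    rw [Set.mem_singleton_iff.1 hx]
    exact hc.2
  exact congrArg Subtype.val ((Finite.isDomain_to_isField (Subalgebra.centralizer E {g})).mul_comm
    ⟨c, hmem c hc⟩ ⟨d, hmem d hd⟩)

variable {h} in
-- The adjoint restricts to an involution of the centralizer, a field with `(q³)²` elements, and is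
-- nontrivial because it conjugates scalars. An element `c` is an isometry exactly when its adjoint
-- times `c` is 1.
theorem ncard_commutant (hn : Module.finrank E V = 3) {g : Module.End E V}
    (hg : g ∈ h.irreducibles) : (h.commutant g).ncard = Fintype.card F ^ 3 + 1 := by
  have := isDomain_centralizer hn hg
  have : Finite (Module.End E V) := Module.finite_of_finite E
  have := nontrivial_of_finrank (E := E) (V := V) hn
  rw [← ncard_mul_involution_eq_one (R := Subalgebra.centralizer E {g})
    (fun c => ⟨h.adjoint c.1, fun x hx => by
      rw [Set.mem_singleton_iff.1 hx]; exact adjoint_commute hg.1 (c.2 g rfl)⟩) ?_ ?_ ?_ ?_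
    (card_centralizer hn hg), ← Set.ncard_image_of_injective _ Subtype.val_injective]
  · congr 1
    ext c
    constructor
    · rintro ⟨hc, hgc⟩
      refine ⟨⟨c, fun x hx => by rw [Set.mem_singleton_iff.1 hx]; exact hgc⟩, ?_, rfl⟩
      refine Subtype.ext (LinearMap.ext fun x => h.eq_of_form_eq fun y => ?_)
      change h.form y (h.adjoint c (c x)) = h.form y x
      rw [← form_adjoint, hc]
    · rintro ⟨c, hc, rfl⟩
      refine ⟨fun x y => ?_, c.2 g rfl⟩
      rw [form_adjoint]
      exact congrArg (h.form x) (LinearMap.congr_fun (congrArg Subtype.val hc) y)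
  · intro c d
    refine Subtype.ext (h.adjoint_eq fun x y => ?_)
    change h.form (c.1 x + d.1 x) y = h.form x (h.adjoint c y + h.adjoint d y)
    rw [h.add_left, h.add_right, form_adjoint, form_adjoint]
  · intro c d
    refine Subtype.ext (h.adjoint_eq fun x y => ?_)
    change h.form (c.1 (d.1 x)) y = h.form x (h.adjoint d (h.adjoint c y))
    rw [form_adjoint, form_adjoint]
  · intro c
    exact Subtype.ext (h.adjoint_eq fun x y => h.form_adjoint' c x y)
  · obtain ⟨a, ha⟩ : ∃ a : E, bar F a ≠ a := by
      by_contra! hall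
      have h1 : {x : E | bar F x = x} = Set.univ := Set.eq_univ_of_forall hall
      have h2 := ncard_bar_eq_self F (E := E)
      rw [h1, Set.ncard_univ, card_quadratic F] at h2
      have := Fintype.one_lt_card (α := F)
      nlinarith
    refine ⟨algebraMap E _ a, fun he => ha ?_⟩
    obtain ⟨v, hv⟩ := exists_ne (0 : V)
    have e1 : h.adjoint (a • 1) = bar F a • 1 := h.adjoint_eq fun x y => by
      simp [h.smul_left, h.smul_right]
    have e2 : h.adjoint (algebraMap E (Module.End E V) a) = algebraMap E (Module.End E V) a :=
      congrArg Subtype.val he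
    rw [Algebra.algebraMap_eq_smul_one, e1] at e2
    exact smul_left_injective E hv (LinearMap.congr_fun e2 v)

variable {h} in
theorem eq_smul_one_of_mem_commutant (hn : Module.finrank E V = 3) {g c : Module.End E V}
    (hg : g ∈ h.irreducibles) (hc : c ∈ h.commutant g) {a : E} {v : V} (hv : c v = a • v)
    (hv0 : v ≠ 0) : c = a • 1 := by
  refine sub_eq_zero.1 (eq_zero_of_commute hn hg (v := v) ?_ ?_ hv0)
  · rw [mul_sub, sub_mul, hc.2, mul_smul_comm, smul_mul_assoc, mul_one, one_mul]
  · rw [LinearMap.sub_apply, LinearMap.smul_apply, Module.End.one_apply, hv, sub_self]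

/-- The homotheties of norm one. -/
def homotheties : Set (Module.End E V) := (fun a : E => a • 1) '' normOne F E

theorem ncard_homotheties [Nontrivial V] :
    (homotheties (F := F) (E := E) (V := V)).ncard = Fintype.card F + 1 := by
  rw [homotheties, Set.ncard_image_of_injective _ (smul_left_injective E one_ne_zero), ncard_normOne]

theorem homotheties_subset_commutant (g : Module.End E V) :
    homotheties (F := F) ⊆ h.commutant g := by
  rintro _ ⟨a, ha, rfl⟩
  refine ⟨fun x y => ?_, by simp⟩
  have ha : a * bar F a = 1 := ha
  simp only [LinearMap.smul_apply, Module.End.one_apply, h.smul_left, h.smul_right]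
  rw [← mul_assoc, ha, one_mul]

theorem smul_one_mem_homotheties [Nontrivial V] {a : E} (ha : a • (1 : Module.End E V) ∈ h.isom) :
    a • (1 : Module.End E V) ∈ homotheties (F := F) := by
  obtain ⟨v, hv⟩ := h.exists_unit
  exact ⟨a, eigenvalue_mem_normOne ha (by rw [hv]; exact one_ne_zero) rfl, rfl⟩

variable {h} in
theorem mem_irreducibles_of_mem_commutant (hn : Module.finrank E V = 3) {g c : Module.End E V}
    (hg : g ∈ h.irreducibles) (hc : c ∈ h.commutant g) :
    c ∈ h.irreducibles ↔ c ∉ homotheties (F := F) (E := E) (V := V) := by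
  have := nontrivial_of_finrank (E := E) (V := V) hn
  constructor
  · rintro hi ⟨a, -, rfl⟩
    obtain ⟨v, hv⟩ := exists_ne (0 : V)
    exact hv (hi.2 a v rfl)
  · refine fun hns => ⟨hc.1, fun a v hv => ?_⟩
    by_contra hv0
    have := eq_smul_one_of_mem_commutant hn hg hc hv hv0
    exact hns (this ▸ h.smul_one_mem_homotheties (this ▸ hc.1))

/-- Suppose every entry has an eigenvector. If all entries are scalar, any vector is a common
eigenvector. Otherwise an eigenspace of a non-scalar entry is a proper subspace stable under the
tuple, and `exists_eigenvector_of_stable` yields a common eigenvector. -/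
theorem exists_mem_irreducibles (hn : Module.finrank E V = 3) {k : ℕ} {t : Fin k → Module.End E V}
    (ht : t ∈ h.irredTuples k) : ∃ i, t i ∈ h.irreducibles := by
  have := nontrivial_of_finrank (E := E) (V := V) hn
  by_contra! h0
  have h1 : ∀ i, ∃ (a : E) (v : V), t i v = a • v ∧ v ≠ 0 := by
    intro i
    by_contra! h2
    exact h0 i ⟨ht.1.1 i, h2⟩
  choose a v hv hv0 using h1
  have key : ∃ w : V, w ≠ 0 ∧ ∀ j, ∃ b : E, t j w = b • w := by
    by_cases hs : ∀ i, t i = a i • 1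
    · obtain ⟨w, hw⟩ := exists_ne (0 : V)
      exact ⟨w, hw, fun j => ⟨a j, by rw [hs j]; rfl⟩⟩
    · push Not at hs
      obtain ⟨i, hi⟩ := hs
      obtain ⟨w, hw0, hw⟩ := h.exists_eigenvector_of_stable hn (W := LinearMap.ker (t i - a i • 1))
        ((Submodule.ne_bot_iff _).2 ⟨v i, by simp [hv i], hv0 i⟩)
        (fun htop => hi (sub_eq_zero.1 (LinearMap.ker_eq_top.1 htop)))
      refine ⟨w, hw0, fun j => hw (t j) (ht.1.1 j) fun x hx => ?_⟩
      have hx : t i x = a i • x := by simpa [sub_eq_zero] using hx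
      have e : t i (t j x) = t j (t i x) := LinearMap.congr_fun (ht.1.2 i j) x
      simp [e, hx]
  obtain ⟨w, hw0, hw⟩ := key
  choose b hb using hw
  have : w ∈ eigen t b := hb
  rw [ht.2 b] at this
  exact hw0 this

/-- The number of commuting tuples without common eigenvectors. -/
theorem ncard_irredTuples (hn : Module.finrank E V = 3) (k : ℕ) :
    ((h.irredTuples k).ncard : ℤ) * (Fintype.card F ^ 3 - Fintype.card F)
      = h.irreducibles.ncard * ((Fintype.card F ^ 3 + 1) ^ k - (Fintype.card F + 1) ^ k) := by
  have : Finite V := Module.finite_of_finite E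
  have : Finite (Module.End E V) := Module.finite_of_finite E
  have := nontrivial_of_finrank (E := E) (V := V) hn
  have hF := Fintype.card_pos (α := F)
  have hF3 : Fintype.card F ≤ Fintype.card F ^ 3 := Nat.le_self_pow (by norm_num) _
  -- Double count of irreducible tuples and eigenvector-free isometries commuting with them.
  -- Everything takes place in a commutative group of order `q³+1`, in which precisely the `q+1`
  -- homotheties have eigenvectors.
  have key := ncard_mul_eq_ncard_mul (A := h.irredTuples k) (B := h.irreducibles)
    (fun t g => ∀ i, g * t i = t i * g) (m := (Fintype.card F ^ 3 + 1) - (Fintype.card F + 1))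
    (n := (Fintype.card F ^ 3 + 1) ^ k - (Fintype.card F + 1) ^ k) ?_ ?_
  · have := congrArg (Nat.cast : ℕ → ℤ) key
    push_cast [Nat.cast_sub (Nat.pow_le_pow_left (Nat.add_le_add_right hF3 1) k),
      Nat.add_sub_add_right, Nat.cast_sub hF3] at this
    linear_combination this
  · intro t ht
    obtain ⟨i, hi⟩ := h.exists_mem_irreducibles hn ht
    rw [← ncard_commutant hn hi, ← ncard_homotheties (F := F) (E := E) (V := V),
      ← Set.ncard_sdiff (h.homotheties_subset_commutant (t i))]
    congr 1
    ext g
    constructor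
    · rintro ⟨hg, hgt⟩
      have hgc : g ∈ h.commutant (t i) := ⟨hg.1, (hgt i).symm⟩
      exact ⟨hgc, (mem_irreducibles_of_mem_commutant hn hi hgc).1 hg⟩
    · rintro ⟨hgc, hg⟩
      exact ⟨(mem_irreducibles_of_mem_commutant hn hi hgc).2 hg, fun j =>
        commutant_commute hn hi hgc ⟨ht.1.1 j, ht.1.2 i j⟩⟩
  · intro g hg
    rw [← ncard_commutant hn hg, ← ncard_homotheties (F := F) (E := E) (V := V), ← ncard_pi_const,
      ← ncard_pi_const, ← Set.ncard_sdiff (show {t : Fin k → Module.End E V | ∀ i, t i ∈ homotheties (F := F)}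
        ⊆ {t | ∀ i, t i ∈ h.commutant g} from fun t ht i => h.homotheties_subset_commutant g (ht i))]
    congr 1
    ext t
    constructor
    · rintro ⟨ht, hgt⟩
      refine ⟨fun i => ⟨ht.1.1 i, hgt i⟩, fun hs => ?_⟩
      choose χ _ hχ using hs
      have := eigen_eq_top_iff.2 (show t = scalarTuple V χ from funext fun i => (hχ i).symm)
      rw [ht.2 χ] at this
      exact bot_ne_top this
    · rintro ⟨ht, hs⟩
      refine ⟨⟨⟨fun i => (ht i).1, fun i j => commutant_commute hn hg (ht i) (ht j)⟩, fun χ => ?_⟩,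
        fun i => (ht i).2⟩
      by_contra hχ
      obtain ⟨v, hv, hv0⟩ := (Submodule.ne_bot_iff _).1 hχ
      refine hs fun i => ?_
      have := eq_smul_one_of_mem_commutant hn hg (ht i) (hv i) hv0
      exact this ▸ h.smul_one_mem_homotheties (this ▸ (ht i).1)

end HermitianSpace

/-! ### From Gram matrices to hermitian spaces -/

section Gram

variable {F : Type*} [Field F] [Fintype F] {E : Type*} [Field E] [Algebra F E]
  [Finite E] [Fact (Module.finrank F E = 2)] {n : Type*} [Fintype n] [DecidableEq n]

theorem map_bar_mulVec (M : Matrix n n E) (x : n → E) :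
    bar F ∘ (M *ᵥ x) = matBar F M *ᵥ (bar F ∘ x) :=
  funext fun i => RingHom.map_mulVec (bar F) M x i

/-- The hermitian space with a given Gram matrix. -/
noncomputable def gramSpace {β : Matrix n n E} (hβ : IsNondegHermitian F β) :
    HermitianSpace F E (n → E) where
  form x y := x ⬝ᵥ β *ᵥ (bar F ∘ y)
  add_left x y z := add_dotProduct _ _ _
  smul_left a x y := smul_dotProduct _ _ _
  bar_form x y := by
    have e : bar F (x ⬝ᵥ β *ᵥ (bar F ∘ y)) = (bar F ∘ x) ⬝ᵥ (bar F ∘ (β *ᵥ (bar F ∘ y))) :=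
      RingHom.map_dotProduct (bar F) _ _
    have e1 : bar F ∘ bar F ∘ y = y := funext fun i => bar_bar F (y i)
    have e2 : matBar F β = βᵀ := by
      have := congrArg Matrix.transpose hβ.1
      exact this
    rw [e, map_bar_mulVec, e1, e2, Matrix.mulVec_transpose, dotProduct_comm,
      Matrix.dotProduct_mulVec]
  nondeg x hx := by
    have h1 : x ᵥ* β = 0 := by
      funext j
      have := hx (Pi.single j 1)
      have e : bar F ∘ (Pi.single j 1 : n → E) = Pi.single j 1 := by
        funext i
        by_cases hij : i = j
        · subst hij; simp
        · simp [hij]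
      rw [e, Matrix.dotProduct_mulVec, dotProduct_single, mul_one] at this
      exact this
    by_contra hx0
    exact hβ.2.ne_zero (Matrix.exists_vecMul_eq_zero_iff.1 ⟨x, hx0, h1⟩)

theorem gramSpace_form {β : Matrix n n E} (hβ : IsNondegHermitian F β) (x y : n → E) :
    (gramSpace hβ).form x y = x ⬝ᵥ β *ᵥ (bar F ∘ y) := rfl

theorem toLin_mem_isom {β : Matrix n n E} (hβ : IsNondegHermitian F β) (M : Matrix n n E) :
    Matrix.toLinAlgEquiv' M ∈ (gramSpace hβ).isom ↔ Mᵀ * β * matBar F M = β := by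
  have e : ∀ x y, (gramSpace hβ).form (Matrix.toLinAlgEquiv' M x) (Matrix.toLinAlgEquiv' M y)
      = x ⬝ᵥ (Mᵀ * β * matBar F M) *ᵥ (bar F ∘ y) := by
    intro x y
    rw [gramSpace_form, Matrix.toLinAlgEquiv'_apply, Matrix.toLinAlgEquiv'_apply, map_bar_mulVec,
      ← Matrix.mulVec_mulVec, ← Matrix.mulVec_mulVec, Matrix.dotProduct_mulVec x,
      Matrix.vecMul_transpose]
  constructor
  · intro hM
    ext i j
    have := hM (Pi.single i 1) (Pi.single j 1)
    rw [e, gramSpace_form] at this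
    have e1 : bar F ∘ (Pi.single j 1 : n → E) = Pi.single j 1 := by
      funext i
      by_cases hij : i = j
      · subst hij; simp
      · simp [hij]
    simpa [e1] using this
  · intro hM x y
    rw [e, hM, gramSpace_form]

theorem numSimConjClasses_unitary {β : Matrix n n E} (hβ : IsNondegHermitian F β) (k : ℕ) :
    numSimConjClasses (hermitianUnitaryGroup F β) k * numComm (gramSpace hβ).isom 1
      = numComm (gramSpace hβ).isom (k + 1) := by
  have : Finite (Matrix n n E) := inferInstanceAs (Finite (n → n → E))
  let φ : hermitianUnitaryGroup F β →* Module.End E (n → E) :=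
    ((Matrix.toLinAlgEquiv' (R := E) (n := n) : Matrix n n E →* Module.End E (n → E)).comp
      (Units.coeHom _)).comp (hermitianUnitaryGroup F β).subtype
  have hφ : ∀ g, φ g = Matrix.toLinAlgEquiv' (g : GL n E).val := fun _ => rfl
  refine numSimConjClasses_mul_numComm φ ?_ ?_ k
  · intro g g' hg
    exact Subtype.ext (Units.ext (Matrix.toLinAlgEquiv'.injective hg))
  · ext g
    obtain ⟨M, rfl⟩ := Matrix.toLinAlgEquiv'.surjective g
    rw [toLin_mem_isom]
    constructor
    · rintro ⟨g, hg⟩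
      rw [hφ] at hg
      rw [← Matrix.toLinAlgEquiv'.injective hg]
      exact g.2
    · intro hM
      -- Invertibility is automatic: the determinant of `M` divides that of the invertible `β`.
      have hdet : IsUnit M.det := by
        have := congrArg Matrix.det hM
        rw [Matrix.det_mul, Matrix.det_mul, Matrix.det_transpose] at this
        exact isUnit_of_mul_isUnit_left (isUnit_of_mul_isUnit_left (this ▸ hβ.2))
      exact ⟨⟨Matrix.nonsingInvUnit M hdet, hM⟩, rfl⟩

end Gram

/-! ### Complete homogeneous sums -/

theorem sum_antidiagonalTuple_succ {M : Type*} [AddCommMonoid M] (k n : ℕ) (f : (Fin (k + 1) → ℕ) → M) :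
    ∑ v ∈ Finset.Nat.antidiagonalTuple (k + 1) n, f v
      = ∑ p ∈ Finset.HasAntidiagonal.antidiagonal n, ∑ w ∈ Finset.Nat.antidiagonalTuple k p.2, f (Fin.cons p.1 w) := by
  rw [Finset.sum_sigma']
  symm
  refine Finset.sum_bij' (fun p _ => Fin.cons p.1.1 p.2)
    (fun v _ => ⟨(v 0, ∑ i, Fin.tail v i), Fin.tail v⟩) ?_ ?_ ?_ ?_ ?_
  · rintro ⟨⟨a, b⟩, w⟩ hw
    simp only [Finset.mem_sigma, Finset.HasAntidiagonal.mem_antidiagonal, Finset.Nat.mem_antidiagonalTuple] at hw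
    rw [Finset.Nat.mem_antidiagonalTuple, Fin.sum_univ_succ]
    simp [hw.1, hw.2]
  · intro v hv
    rw [Finset.Nat.mem_antidiagonalTuple, Fin.sum_univ_succ] at hv
    simp only [Finset.mem_sigma, Finset.HasAntidiagonal.mem_antidiagonal, Finset.Nat.mem_antidiagonalTuple]
    exact ⟨hv, trivial⟩
  · rintro ⟨⟨a, b⟩, w⟩ hw
    simp only [Finset.mem_sigma, Finset.HasAntidiagonal.mem_antidiagonal, Finset.Nat.mem_antidiagonalTuple] at hw
    simp [hw.2]
  · intro v _
    simp
  · intro p _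
    rfl

/-- A convolution with a geometric sequence is determined by a first order recurrence. -/
theorem mul_sum_antidiagonal_eq {R : Type*} [CommRing R] (d y : R) (f F : ℕ → R)
    (h0 : d * f 0 = F 0) (h1 : ∀ n, F (n + 1) = y * F n + d * f (n + 1)) (n : ℕ) :
    d * ∑ p ∈ Finset.HasAntidiagonal.antidiagonal n, y ^ p.1 * f p.2 = F n := by
  induction n with
  | zero => simpa using h0
  | succ n ih =>
    rw [Finset.Nat.sum_antidiagonal_succ, h1, ← ih]
    simp only [pow_succ', mul_assoc, ← Finset.mul_sum]
    ring

/-- The bialternant formula: the Vandermonde product times the complete homogeneous sum is an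
alternating sum of powers. The cases of three and four variables follow by adjoining one variable at
a time, so no division is needed. -/
theorem sum_antidiagonalTuple_two {R : Type*} [CommRing R] (a b : R) (n : ℕ) :
    (a - b) * ∑ v ∈ Finset.Nat.antidiagonalTuple 2 n, a ^ v 0 * b ^ v 1 = a ^ (n + 1) - b ^ (n + 1) := by
  rw [sum_antidiagonalTuple_succ]
  simp only [Finset.Nat.antidiagonalTuple_one, Finset.sum_singleton]
  refine mul_sum_antidiagonal_eq (a - b) a (fun j => b ^ j) (fun n => a ^ (n + 1) - b ^ (n + 1))
    (by ring) (fun n => by ring) n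

theorem sum_antidiagonalTuple_three {R : Type*} [CommRing R] (a b c : R) (n : ℕ) :
    (a - b) * (a - c) * (b - c)
        * ∑ v ∈ Finset.Nat.antidiagonalTuple 3 n, a ^ v 0 * b ^ v 1 * c ^ v 2
      = (b - c) * a ^ (n + 2) - (a - c) * b ^ (n + 2) + (a - b) * c ^ (n + 2) := by
  rw [sum_antidiagonalTuple_succ]
  have e : ∀ p : ℕ × ℕ, ∑ w ∈ Finset.Nat.antidiagonalTuple 2 p.2,
      a ^ (Fin.cons p.1 w : Fin 3 → ℕ) 0 * b ^ (Fin.cons p.1 w : Fin 3 → ℕ) 1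
        * c ^ (Fin.cons p.1 w : Fin 3 → ℕ) 2
      = a ^ p.1 * ∑ w ∈ Finset.Nat.antidiagonalTuple 2 p.2, b ^ w 0 * c ^ w 1 := by
    intro p
    rw [Finset.mul_sum]
    exact Finset.sum_congr rfl fun w _ => mul_assoc _ _ _
  simp only [e]
  refine mul_sum_antidiagonal_eq ((a - b) * (a - c) * (b - c)) a
    (fun j => ∑ w ∈ Finset.Nat.antidiagonalTuple 2 j, b ^ w 0 * c ^ w 1)
    (fun n => (b - c) * a ^ (n + 2) - (a - c) * b ^ (n + 2) + (a - b) * c ^ (n + 2)) ?_ ?_ n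
  · linear_combination (a - b) * (a - c) * sum_antidiagonalTuple_two b c 0
  · intro n
    linear_combination -(a - b) * (a - c) * sum_antidiagonalTuple_two b c (n + 1)

theorem sum_antidiagonalTuple_four {R : Type*} [CommRing R] (a b c d : R) (n : ℕ) :
    (a - b) * (a - c) * (a - d) * (b - c) * (b - d) * (c - d)
        * ∑ v ∈ Finset.Nat.antidiagonalTuple 4 n, a ^ v 0 * b ^ v 1 * c ^ v 2 * d ^ v 3
      = (b - c) * (b - d) * (c - d) * a ^ (n + 3) - (a - c) * (a - d) * (c - d) * b ^ (n + 3)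
        + (a - b) * (a - d) * (b - d) * c ^ (n + 3) - (a - b) * (a - c) * (b - c) * d ^ (n + 3) := by
  rw [sum_antidiagonalTuple_succ]
  have e : ∀ p : ℕ × ℕ, ∑ w ∈ Finset.Nat.antidiagonalTuple 3 p.2,
      a ^ (Fin.cons p.1 w : Fin 4 → ℕ) 0 * b ^ (Fin.cons p.1 w : Fin 4 → ℕ) 1
        * c ^ (Fin.cons p.1 w : Fin 4 → ℕ) 2 * d ^ (Fin.cons p.1 w : Fin 4 → ℕ) 3
      = a ^ p.1 * ∑ w ∈ Finset.Nat.antidiagonalTuple 3 p.2, b ^ w 0 * c ^ w 1 * d ^ w 2 := by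
    intro p
    rw [Finset.mul_sum]
    refine Finset.sum_congr rfl fun w _ => ?_
    rw [← mul_assoc, ← mul_assoc]
    rfl
  simp only [e]
  refine mul_sum_antidiagonal_eq ((a - b) * (a - c) * (a - d) * (b - c) * (b - d) * (c - d)) a
    (fun j => ∑ w ∈ Finset.Nat.antidiagonalTuple 3 j, b ^ w 0 * c ^ w 1 * d ^ w 2)
    (fun n => (b - c) * (b - d) * (c - d) * a ^ (n + 3) - (a - c) * (a - d) * (c - d) * b ^ (n + 3)
        + (a - b) * (a - d) * (b - d) * c ^ (n + 3) - (a - b) * (a - c) * (b - c) * d ^ (n + 3))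
    ?_ ?_ n
  · linear_combination (a - b) * (a - c) * (a - d) * sum_antidiagonalTuple_three b c d 0
  · intro n
    linear_combination -(a - b) * (a - c) * (a - d) * sum_antidiagonalTuple_three b c d (n + 1)

theorem mul_gl2Sum (k : ℕ) {i : ℕ} (_ : i ≤ 3) (q m p : ℤ) :
    (m - m ^ 2) * (m - q * m) * (m - p * m) * (m ^ 2 - q * m) * (m ^ 2 - p * m) * (q * m - p * m)
        * gl2Sum k i q m p
      = (m ^ 2 - q * m) * (m ^ 2 - p * m) * (q * m - p * m) * m ^ (k + 3 - i)
        - (m - q * m) * (m - p * m) * (q * m - p * m) * (m ^ 2) ^ (k + 3 - i)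
        + (m - m ^ 2) * (m - p * m) * (m ^ 2 - p * m) * (q * m) ^ (k + 3 - i)
        - (m - m ^ 2) * (m - q * m) * (m ^ 2 - q * m) * (p * m) ^ (k + 3 - i) := by
  rw [gl2Sum]
  split_ifs with hk
  · rw [show k + 3 - i = k - i + 3 by omega, ← sum_antidiagonalTuple_four]
    simp only [pow_mul]
  -- An empty sum obeys the same formula: with exponent 0, 1 or 2 the alternating sum is a
  -- determinant with two equal rows.
  · obtain ⟨j, hj, hj2⟩ : ∃ j, k + 3 - i = j ∧ j < 3 := ⟨_, rfl, by omega⟩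
    rw [hj]
    interval_cases j <;> ring

/-- The closed form of the formula. -/
theorem mul_gl2Formula (k : ℕ) {q m p : ℤ} (hq : 3 ≤ q) (hm : m = q - 1 ∧ p = q + 1 ∨ m = q + 1 ∧ p = q - 1) :
    2 * (q - 1) * gl2Formula k q m p
      = 2 * (q * m) ^ k + (q - 1) * ((p * m) ^ k + (m ^ 2) ^ k) - 2 * m ^ k := by
  -- The Vandermonde product of the four variables. For `q = 2` and `m = q - 1` the variables `m`
  -- and `m²` would coincide; `q ≥ 3` keeps all four distinct.
  have hV : (m - m ^ 2) * (m - q * m) * (m - p * m) * (m ^ 2 - q * m) * (m ^ 2 - p * m)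
      * (q * m - p * m) ≠ 0 := by
    have e : (m - m ^ 2) * (m - q * m) * (m - p * m) * (m ^ 2 - q * m) * (m ^ 2 - p * m)
      * (q * m - p * m) = m ^ 6 * ((1 - m) * (1 - q) * (1 - p) * (m - q) * (m - p) * (q - p)) := by ring
    rw [e]
    refine mul_ne_zero (pow_ne_zero _ (by omega)) ?_
    refine mul_ne_zero (mul_ne_zero (mul_ne_zero (mul_ne_zero (mul_ne_zero ?_ ?_) ?_) ?_) ?_) ?_ <;>
      omega
  refine mul_left_cancel₀ hV ?_
  have h0 := mul_gl2Sum k (i := 0) (by omega) q m p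
  have h1 := mul_gl2Sum k (i := 1) (by omega) q m p
  have h2 := mul_gl2Sum k (i := 2) (by omega) q m p
  have h3 := mul_gl2Sum k (i := 3) (by omega) q m p
  simp only [Nat.sub_zero, show k + 3 - 1 = k + 2 by omega, show k + 3 - 2 = k + 1 by omega,
    show k + 3 - 3 = k by omega, pow_add] at h0 h1 h2 h3
  rw [gl2Formula]
  generalize m ^ k = a at *
  generalize (m ^ 2) ^ k = b at *
  generalize (q * m) ^ k = c at *
  generalize (p * m) ^ k = d at *
  have key := congrArg (fun x => 2 * (q - 1) * x)
    (congr (congrArg (· - ·) (congr (congrArg (· + ·) (congr (congrArg (· - ·) h0)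
      (congrArg (2 * (q * m) * ·) h1))) (congrArg ((q * m) ^ 2 * ·) h2))) (congrArg (m ^ 3 * ·) h3))
  beta_reduce at key
  refine Eq.trans ?_ (key.trans ?_)
  · ring
  · rcases hm with ⟨rfl, rfl⟩ | ⟨rfl, rfl⟩ <;> ring

/-! ### The formula for the number of classes -/

section Formula

variable {F : Type*} [Field F] [Fintype F]

theorem two_ne_zero_of_odd_card (hF : Odd (Fintype.card F)) : (2 : F) ≠ 0 :=
  Ring.two_ne_zero fun h => by
    have := FiniteField.even_card_of_char_two h
    exact (Nat.not_even_iff_odd.2 hF) (Nat.even_iff.2 this)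

theorem three_le_card_of_odd (hF : Odd (Fintype.card F)) : (3 : ℤ) ≤ Fintype.card F := by
  have := Fintype.one_lt_card (α := F)
  obtain ⟨r, hr⟩ := hF
  omega

theorem numSimConjClasses_GL_two_eq_gl2Formula (hF : Odd (Fintype.card F)) (k : ℕ) :
    (numSimConjClasses (GL (Fin 2) F) k : ℤ)
      = gl2Formula k (Fintype.card F) (Fintype.card F - 1) (Fintype.card F + 1) := by
  have hq := three_le_card_of_odd hF
  have h2 := two_ne_zero_of_odd_card hF
  have hc := congrArg (Nat.cast : ℕ → ℤ) (numSimConjClasses_GL_two (F := F) k)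
  have h1 := numComm_det_ne_zero h2 1
  have hk := numComm_det_ne_zero h2 (k + 1)
  have hf := mul_gl2Formula k hq (Or.inl ⟨rfl, rfl⟩)
  push_cast at hc
  generalize (Fintype.card F : ℤ) = q at *
  have hne : 2 * (q - 1) * (q * (q + 1) * (q - 1) ^ 2) ≠ 0 := by
    refine mul_ne_zero (mul_ne_zero two_ne_zero (by omega)) (mul_ne_zero (mul_ne_zero (by omega)
      (by omega)) (pow_ne_zero _ (by omega)))
  refine mul_left_cancel₀ hne ?_
  rw [show q ^ 2 - 1 = (q + 1) * (q - 1) by ring] at hk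
  simp only [pow_succ _ k] at hk
  linear_combination (-(q * (q + 1) * (q - 1) ^ 2)) * hf + (q - 1) * hk + 2 * (q - 1) * hc
    - (q - 1) * (numSimConjClasses (GL (Fin 2) F) k : ℤ) * h1

variable {E : Type*} [Field E] [Algebra F E]

theorem numSimConjClasses_unitary_two_eq_gl2Formula [Finite E] [Fact (Module.finrank F E = 2)]
    (hF : Odd (Fintype.card F)) {β : Matrix (Fin 2) (Fin 2) E} (hβ : IsNondegHermitian F β) (k : ℕ) :
    (numSimConjClasses (hermitianUnitaryGroup F β) k : ℤ)
      = gl2Formula k (Fintype.card F) (Fintype.card F + 1) (Fintype.card F - 1) := by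
  have hq := three_le_card_of_odd hF
  have h2 := two_ne_zero_of_odd_card hF
  have hn : Module.finrank E (Fin 2 → E) = 2 := by simp
  have hc := congrArg (Nat.cast : ℕ → ℤ) (numSimConjClasses_unitary hβ k)
  have h1 := (gramSpace hβ).two_mul_numComm_isom h2 hn 1
  have hk := (gramSpace hβ).two_mul_numComm_isom h2 hn (k + 1)
  have hf := mul_gl2Formula k hq (Or.inr ⟨rfl, rfl⟩)
  push_cast at hc
  generalize (Fintype.card F : ℤ) = q at *
  have hne : 2 * (q - 1) * (q * (q - 1) * (q + 1) ^ 2) ≠ 0 := by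
    refine mul_ne_zero (mul_ne_zero two_ne_zero (by omega)) (mul_ne_zero (mul_ne_zero (by omega)
      (by omega)) (pow_ne_zero _ (by omega)))
  refine mul_left_cancel₀ hne ?_
  rw [show q ^ 2 - 1 = (q - 1) * (q + 1) by ring] at hk
  simp only [pow_succ _ k] at hk
  linear_combination (-(q * (q - 1) * (q + 1) ^ 2)) * hf + (q - 1) * hk + 2 * (q - 1) * hc
    - (q - 1) * (numSimConjClasses (hermitianUnitaryGroup F β) k : ℤ) * h1

end Formula

/-! ### The closed form for `U₃` -/

namespace HermitianSpace

variable {F : Type*} [Field F] [Fintype F] {E : Type*} [Field E] [Algebra F E]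
  {V : Type*} [AddCommGroup V] [Module E V] (h : HermitianSpace F E V)
  [Finite E] [Fact (Module.finrank F E = 2)] [FiniteDimensional E V]

/-- Both terms of the count contain `(q+1)²`, because `q^5 + q^2 = q^2 (q+1)(q^2-q+1)`; cancelling
it gives a form usable as a polynomial numerator. -/
theorem six_mul_ncard_splitTuples (h2 : (2 : F) ≠ 0) (hn : Module.finrank E V = 3) (k : ℕ) {q : ℤ}
    (hq : q = Fintype.card F) :
    6 * ((h.splitTuples k).ncard : ℤ)
      = 3 * q ^ 2 * (q ^ 2 - q + 1)
        * ((q + 1) ^ k * (2 * (q + 1) * (q * (q + 1)) ^ k + q * (q + 1) * (q ^ 2 - 1) ^ k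
            + q * (q - 1) * ((q + 1) ^ 2) ^ k - 2 * q * (q + 1) * (q + 1) ^ k)
          - 2 * (q * (q - 1) * ((q + 1) ^ k) ^ 2 + (q + 1) * (q + 1) ^ k * q ^ k
            - q ^ 2 * (q + 1) ^ k))
        - 2 * q ^ 3 * (q - 1) * (q ^ 2 - q + 1)
          * ((q + 1) ^ k * ((q + 1) ^ k - 1) * ((q + 1) ^ k - 2)) := by
  have hs := h.ncard_splitTuples h2 hn k
  rw [← hq] at hs
  have hq0 : 0 ≤ q := hq ▸ Int.natCast_nonneg _
  refine mul_left_cancel₀ (pow_ne_zero 2 (by omega : q + 1 ≠ 0)) ?_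
  linear_combination hs

/-- The number of isometries without eigenvectors. -/
theorem three_mul_ncard_irreducibles (h2 : (2 : F) ≠ 0) (hn : Module.finrank E V = 3) {q : ℤ}
    (hq : q = Fintype.card F) :
    3 * (h.irreducibles.ncard : ℤ) = q ^ 4 * (q - 1) ^ 2 * (q + 1) ^ 3 := by
  -- For `k = 1` the three types add up to the order of the group, and an irreducible 1-tuple is a
  -- single isometry without eigenvectors, so its number can be solved for.
  have hs := h.six_mul_ncard_splitTuples h2 hn 1 hq
  have hu := h.ncard_unipTuples hn 1
  have hi := h.ncard_irredTuples hn 1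
  have hc := h.ncard_isom hn
  have hadd := congrArg (Nat.cast : ℕ → ℤ) (h.numComm_eq_add hn 1)
  rw [numComm_one] at hadd
  push_cast at hadd
  have hq1 : 1 < q := by
    rw [hq]; exact_mod_cast Fintype.one_lt_card (α := F)
  rw [← hq] at hu hi hc
  have hi' : ((h.irredTuples 1).ncard : ℤ) = h.irreducibles.ncard := by
    have hne : q ^ 3 - q ≠ 0 := by
      have : q ^ 3 - q = q * ((q - 1) * (q + 1)) := by ring
      rw [this]
      exact mul_ne_zero (by omega) (mul_ne_zero (by omega) (by omega))
    refine mul_right_cancel₀ hne ?_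
    linear_combination hi
  refine mul_left_cancel₀ (two_ne_zero (α := ℤ)) ?_
  linear_combination (-6) * hi' + 6 * hc - 6 * hadd - 6 * hu - hs

/-- The number of commuting tuples in the isometry group of a space of dimension three. -/
theorem six_mul_numComm_isom (h2 : (2 : F) ≠ 0) (hn : Module.finrank E V = 3) (k : ℕ) {q : ℤ}
    (hq : q = Fintype.card F) :
    6 * (numComm h.isom k : ℤ)
      = 2 * q ^ 3 * (q - 1) * (q + 1) ^ 2 * ((q ^ 3 + 1) ^ k - (q + 1) ^ k)
        + 6 * ((q + 1) ^ k + (q ^ 3 + 1) * (q + 1) ^ k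
          * ((1 + (q + 1) * (q ^ k - 1)) * q ^ k - 1))
        + 3 * q ^ 2 * (q ^ 2 - q + 1)
        * ((q + 1) ^ k * (2 * (q + 1) * (q * (q + 1)) ^ k + q * (q + 1) * (q ^ 2 - 1) ^ k
            + q * (q - 1) * ((q + 1) ^ 2) ^ k - 2 * q * (q + 1) * (q + 1) ^ k)
          - 2 * (q * (q - 1) * ((q + 1) ^ k) ^ 2 + (q + 1) * (q + 1) ^ k * q ^ k
            - q ^ 2 * (q + 1) ^ k))
        - 2 * q ^ 3 * (q - 1) * (q ^ 2 - q + 1)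
          * ((q + 1) ^ k * ((q + 1) ^ k - 1) * ((q + 1) ^ k - 2)) := by
  have hs := h.six_mul_ncard_splitTuples h2 hn k hq
  have hu := h.ncard_unipTuples hn k
  have hi := h.ncard_irredTuples hn k
  have hI := h.three_mul_ncard_irreducibles h2 hn hq
  have hadd := congrArg (Nat.cast : ℕ → ℤ) (h.numComm_eq_add hn k)
  push_cast at hadd
  have hq1 : 1 < q := by
    rw [hq]; exact_mod_cast Fintype.one_lt_card (α := F)
  rw [← hq] at hu hi
  have hi' : 3 * ((h.irredTuples k).ncard : ℤ)
      = q ^ 3 * (q - 1) * (q + 1) ^ 2 * ((q ^ 3 + 1) ^ k - (q + 1) ^ k) := by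
    have hne : q * ((q - 1) * (q + 1)) ≠ 0 :=
      mul_ne_zero (by omega) (mul_ne_zero (by omega) (by omega))
    refine mul_right_cancel₀ hne ?_
    linear_combination 3 * hi + ((q ^ 3 + 1) ^ k - (q + 1) ^ k) * hI
  linear_combination 6 * hadd + 2 * hi' + 6 * hu + hs

end HermitianSpace

/-! ### Division of integer polynomials by evaluation at one large integer -/

/-- Polynomial expressions with integer coefficients in one variable. -/
inductive PolyExpr
  | X : PolyExpr
  | const : ℕ → PolyExpr
  | add : PolyExpr → PolyExpr → PolyExpr
  | sub : PolyExpr → PolyExpr → PolyExpr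
  | mul : PolyExpr → PolyExpr → PolyExpr
  | pow : PolyExpr → ℕ → PolyExpr

namespace PolyExpr

instance : Add PolyExpr := ⟨add⟩
instance : Sub PolyExpr := ⟨sub⟩
instance : Mul PolyExpr := ⟨mul⟩
instance : Pow PolyExpr ℕ := ⟨pow⟩
instance (n : ℕ) : OfNat PolyExpr n := ⟨const n⟩

/-- The value at an integer. -/
def eval (x : ℤ) : PolyExpr → ℤ
  | X => x
  | const n => n
  | add a b => eval x a + eval x b
  | sub a b => eval x a - eval x b
  | mul a b => eval x a * eval x b
  | pow a n => eval x a ^ n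

/-- A bound for the sum of the absolute values of the coefficients. -/
def bound : PolyExpr → ℕ
  | X => 1
  | const n => n
  | add a b => bound a + bound b
  | sub a b => bound a + bound b
  | mul a b => bound a * bound b
  | pow a n => bound a ^ n

@[simp] theorem eval_X (x : ℤ) : eval x X = x := rfl
@[simp] theorem eval_add (x : ℤ) (a b : PolyExpr) : eval x (a + b) = eval x a + eval x b := rfl
@[simp] theorem eval_sub (x : ℤ) (a b : PolyExpr) : eval x (a - b) = eval x a - eval x b := rfl
@[simp] theorem eval_mul (x : ℤ) (a b : PolyExpr) : eval x (a * b) = eval x a * eval x b := rfl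
@[simp] theorem eval_pow (x : ℤ) (a : PolyExpr) (n : ℕ) : eval x (a ^ n) = eval x a ^ n := rfl
@[simp] theorem eval_one (x : ℤ) : eval x 1 = 1 := rfl
@[simp] theorem eval_two (x : ℤ) : eval x 2 = 2 := rfl
@[simp] theorem eval_three (x : ℤ) : eval x 3 = 3 := rfl
@[simp] theorem eval_six (x : ℤ) : eval x 6 = 6 := rfl

end PolyExpr

/-! Polynomials as lists of coefficients. -/

namespace CoeffList

/-- Multiplication by an integer. -/
def scale (c : ℤ) : List ℤ → List ℤ
  | [] => []
  | a :: l => c * a :: scale c l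

/-- Addition of coefficient lists. -/
def add : List ℤ → List ℤ → List ℤ
  | [], l => l
  | a :: l, [] => a :: l
  | a :: l, b :: l' => (a + b) :: add l l'

/-- Multiplication of coefficient lists. -/
def mul : List ℤ → List ℤ → List ℤ
  | [], _ => []
  | a :: l, l' => add (scale a l') (0 :: mul l l')

/-- The value at an integer. -/
def eval (x : ℤ) : List ℤ → ℤ
  | [] => 0
  | a :: l => a + x * eval x l

/-- The sum of the absolute values of the coefficients. -/
def norm : List ℤ → ℕ
  | [] => 0
  | a :: l => a.natAbs + norm l

theorem eval_scale (x c : ℤ) (l : List ℤ) : eval x (scale c l) = c * eval x l := by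
  induction l with
  | nil => simp [scale, eval]
  | cons a l ih => rw [scale, eval, eval, ih]; ring

theorem eval_add (x : ℤ) (l l' : List ℤ) : eval x (add l l') = eval x l + eval x l' := by
  induction l generalizing l' with
  | nil => simp [add, eval]
  | cons a l ih =>
    cases l' with
    | nil => simp [add, eval]
    | cons b l' => rw [add, eval, eval, eval, ih]; ring

theorem eval_mul (x : ℤ) (l l' : List ℤ) : eval x (mul l l') = eval x l * eval x l' := by
  induction l with
  | nil => simp [mul, eval]
  | cons a l ih => rw [mul, eval_add, eval_scale, eval, eval, ih]; ring

theorem norm_scale (c : ℤ) (l : List ℤ) : norm (scale c l) = c.natAbs * norm l := by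
  induction l with
  | nil => simp [scale, norm]
  | cons a l ih => rw [scale, norm, norm, ih, Int.natAbs_mul, mul_add]

theorem norm_add_le (l l' : List ℤ) : norm (add l l') ≤ norm l + norm l' := by
  induction l generalizing l' with
  | nil => simp [add, norm]
  | cons a l ih =>
    cases l' with
    | nil => simp [add, norm]
    | cons b l' =>
      have := ih l'
      rw [add, norm, norm, norm]
      omega

theorem norm_mul_le (l l' : List ℤ) : norm (mul l l') ≤ norm l * norm l' := by
  induction l with
  | nil => simp [mul, norm]
  | cons a l ih =>
    rw [mul, norm, add_mul, ← norm_scale]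
    refine (norm_add_le _ _).trans (Nat.add_le_add_left ?_ _)
    rw [norm, Int.natAbs_zero, zero_add]
    exact ih

/-- A polynomial with a root exceeding the sum of its coefficients vanishes. -/
theorem eval_eq_zero_of_norm_lt {B : ℕ} {l : List ℤ} (hl : norm l < B) (h0 : eval B l = 0) (x : ℤ) :
    eval x l = 0 := by
  induction l with
  | nil => rfl
  | cons a l ih =>
    rw [norm] at hl
    rw [eval] at h0
    -- The constant coefficient is divisible by `B` but smaller than `B` in absolute value; the
    -- remaining coefficients follow inductively.
    have ha : a = 0 := by
      refine Int.eq_zero_of_abs_lt_dvd (m := B) ⟨-eval B l, by linear_combination h0⟩ ?_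
      rw [Int.abs_eq_natAbs]
      omega
    rw [ha, zero_add, mul_eq_zero] at h0
    rw [eval, ha, ih (by omega) (h0.resolve_left (by omega)), mul_zero, add_zero]

end CoeffList

namespace PolyExpr

/-- The norm of a product is at most the product of the norms, so the size of the coefficients can
be bounded from the expression tree without expanding it. -/
theorem exists_coeffs (a : PolyExpr) :
    ∃ l, (∀ x, CoeffList.eval x l = eval x a) ∧ CoeffList.norm l ≤ bound a := by
  induction a with
  | X => exact ⟨[0, 1], fun x => by simp [CoeffList.eval, eval], le_rfl⟩
  | const n => exact ⟨[(n : ℤ)], fun x => by simp [CoeffList.eval, eval], le_rfl⟩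
  | add a b iha ihb =>
    obtain ⟨l, hl, hl'⟩ := iha
    obtain ⟨r, hr, hr'⟩ := ihb
    exact ⟨CoeffList.add l r, fun x => by rw [CoeffList.eval_add, hl, hr, eval],
      (CoeffList.norm_add_le l r).trans (Nat.add_le_add hl' hr')⟩
  | sub a b iha ihb =>
    obtain ⟨l, hl, hl'⟩ := iha
    obtain ⟨r, hr, hr'⟩ := ihb
    refine ⟨CoeffList.add l (CoeffList.scale (-1) r), fun x => ?_, ?_⟩
    · rw [CoeffList.eval_add, CoeffList.eval_scale, hl, hr, eval]
      ring
    · refine (CoeffList.norm_add_le l _).trans (Nat.add_le_add hl' ?_)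
      rwa [CoeffList.norm_scale, Int.natAbs_neg, Int.natAbs_one, one_mul]
  | mul a b iha ihb =>
    obtain ⟨l, hl, hl'⟩ := iha
    obtain ⟨r, hr, hr'⟩ := ihb
    exact ⟨CoeffList.mul l r, fun x => by rw [CoeffList.eval_mul, hl, hr, eval],
      (CoeffList.norm_mul_le l r).trans (Nat.mul_le_mul hl' hr')⟩
  | pow a n ih =>
    obtain ⟨l, hl, hl'⟩ := ih
    induction n with
    | zero => exact ⟨[1], fun x => by simp [CoeffList.eval, eval], le_rfl⟩
    | succ n ihn =>
      obtain ⟨r, hr, hr'⟩ := ihn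
      exact ⟨CoeffList.mul r l, fun x => by rw [CoeffList.eval_mul, hl, hr, eval, eval, pow_succ],
        (CoeffList.norm_mul_le r l).trans (Nat.mul_le_mul hr' hl')⟩

/-- The first digits of a number. -/
def digits (B : ℕ) : ℕ → ℕ → List ℕ
  | 0, _ => []
  | n + 1, a => a % B :: digits B n (a / B)

/-- The polynomial expression with given coefficients. -/
def ofDigits : List ℕ → PolyExpr
  | [] => 0
  | a :: l => const a + X * ofDigits l

theorem exists_polynomial_ofDigits (l : List ℕ) :
    ∃ P : Polynomial ℕ, ∀ x : ℕ, ((P.eval x : ℕ) : ℤ) = eval x (ofDigits l) := by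
  induction l with
  | nil => exact ⟨0, fun x => by simp [ofDigits]; rfl⟩
  | cons a l ih =>
    obtain ⟨P, hP⟩ := ih
    refine ⟨Polynomial.C a + Polynomial.X * P, fun x => ?_⟩
    rw [ofDigits, eval_add, eval_mul, ← hP]
    simp [eval]

/-- Whether the digits of `g B / d B` are the coefficients of a quotient of `g` by `d`. -/
def divides (B n : ℕ) (d g : PolyExpr) : Bool :=
  -- The digits are only a guess for the quotient. An inexact division, a negative value or too few
  -- digits could only make the test fail.
  let e := d * ofDigits (digits B n (eval B g / eval B d).toNat) - g
  decide (bound e < B) && decide (eval B e = 0)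

/-- The test shows that `d P - g` vanishes at an integer exceeding the sum of the absolute values of
its coefficients, hence everywhere. Digits are natural numbers, so the quotient has non-negative
coefficients, and the same `P` serves every `x`. -/
theorem exists_polynomial_of_divides {B n : ℕ} {d g : PolyExpr} (hd : divides B n d g = true) :
    ∃ P : Polynomial ℕ, ∀ x c : ℕ, eval x d ≠ 0 → (c : ℤ) * eval x d = eval x g → c = P.eval x := by
  rw [divides, Bool.and_eq_true, decide_eq_true_eq, decide_eq_true_eq] at hd
  obtain ⟨h1, h2⟩ := hd
  obtain ⟨l, hl, hl'⟩ := exists_coeffs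
    (d * ofDigits (digits B n (eval B g / eval B d).toNat) - g)
  obtain ⟨P, hP⟩ := exists_polynomial_ofDigits (digits B n (eval B g / eval B d).toNat)
  refine ⟨P, fun x c h0 hc => ?_⟩
  have h3 := CoeffList.eval_eq_zero_of_norm_lt (hl'.trans_lt h1) ((hl B).trans h2) x
  rw [hl, eval_sub, eval_mul, ← hP, ← hc] at h3
  have h4 : (c : ℤ) = (P.eval x : ℕ) := mul_right_cancel₀ h0 (by linear_combination -h3)
  exact_mod_cast h4

/-- Twice the number of commuting tuples in `U_2`. -/
def unitaryTwo (k : ℕ) : PolyExpr :=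
  2 * (X + 1) * (X * (X + 1)) ^ k + X * (X + 1) * (X ^ 2 - 1) ^ k + X * (X - 1) * ((X + 1) ^ 2) ^ k
    - 2 * X * (X + 1) * (X + 1) ^ k

/-- Twice the number of commuting tuples in `Sp_2`. -/
def symplecticTwo (k : ℕ) : PolyExpr :=
  2 * (X + 1) * (2 * X) ^ k + X * (X + 1) * (X - 1) ^ k + X * (X - 1) * (X + 1) ^ k
    - 2 * X * (X + 1) * 2 ^ k

/-- Six times the number of commuting tuples in `U_3`. -/
def unitaryThree (k : ℕ) : PolyExpr :=
  2 * X ^ 3 * (X - 1) * (X + 1) ^ 2 * ((X ^ 3 + 1) ^ k - (X + 1) ^ k)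
    + 6 * ((X + 1) ^ k + (X ^ 3 + 1) * (X + 1) ^ k
      * ((1 + (X + 1) * (X ^ k - 1)) * X ^ k - 1))
    + 3 * X ^ 2 * (X ^ 2 - X + 1)
    * ((X + 1) ^ k * (2 * (X + 1) * (X * (X + 1)) ^ k + X * (X + 1) * (X ^ 2 - 1) ^ k
        + X * (X - 1) * ((X + 1) ^ 2) ^ k - 2 * X * (X + 1) * (X + 1) ^ k)
      - 2 * (X * (X - 1) * ((X + 1) ^ k) ^ 2 + (X + 1) * (X + 1) ^ k * X ^ k
        - X ^ 2 * (X + 1) ^ k))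
    - 2 * X ^ 3 * (X - 1) * (X ^ 2 - X + 1)
      * ((X + 1) ^ k * ((X + 1) ^ k - 1) * ((X + 1) ^ k - 2))


/-- The divisor is `2 |U₂|`, and Burnside's lemma shifts the numerator to `k + 1`. In this and the
next two certificates `3k + 1` digits allow degree up to `3k`, and `2^200` exceeds all the
coefficient bounds for `k ≤ 20`. -/
theorem divides_unitaryTwo : (List.range 21).all (fun k =>
    divides (2 ^ 200) (3 * k + 1) (2 * X * (X - 1) * (X + 1) ^ 2) (unitaryTwo (k + 1))) = true := by
  decide +kernel


theorem divides_symplecticTwo : (List.range 21).all (fun k =>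
    divides (2 ^ 200) (3 * k + 1) (2 * X * (X - 1) * (X + 1)) (symplecticTwo (k + 1))) = true := by
  decide +kernel


/-- The divisor is `6 |U₃|`, with `|U₃| = q³(q³+1)(q²-1)(q+1)`. -/
theorem divides_unitaryThree : (List.range 21).all (fun k =>
    divides (2 ^ 200) (3 * k + 1) (6 * X ^ 3 * (X ^ 3 + 1) * (X ^ 2 - 1) * (X + 1)) (unitaryThree (k + 1))) = true := by
  decide +kernel

end PolyExpr

/-! ### Polynomials for `U₂`, `U₃` and `Sp₂`, and the final statement -/

theorem exists_polynomial_unitary_two {k : ℕ} (hk : k ≤ 20) :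
    ∃ P : Polynomial ℕ, ∀ (F : Type u) [Field F] [Fintype F], Odd (Fintype.card F) →
      ∀ (E : Type v) [Field E] [Algebra F E] [Finite E] [Fact (Module.finrank F E = 2)]
        (β : Matrix (Fin 2) (Fin 2) E), IsNondegHermitian F β →
          numSimConjClasses (hermitianUnitaryGroup F β) k = P.eval (Fintype.card F) := by
  obtain ⟨P, hP⟩ := PolyExpr.exists_polynomial_of_divides
    (List.all_eq_true.1 PolyExpr.divides_unitaryTwo k (List.mem_range.2 (by omega)))
  refine ⟨P, fun F _ _ hF E _ _ _ _ β hβ => hP _ _ ?_ ?_⟩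
  · have hq := three_le_card_of_odd hF
    simp only [PolyExpr.eval_mul, PolyExpr.eval_X, PolyExpr.eval_sub, PolyExpr.eval_add,
      PolyExpr.eval_pow, PolyExpr.eval_one, PolyExpr.eval_two]
    refine mul_ne_zero (mul_ne_zero (mul_ne_zero two_ne_zero ?_) ?_) (pow_ne_zero _ ?_) <;> omega
  · have h2 := two_ne_zero_of_odd_card hF
    have hn : Module.finrank E (Fin 2 → E) = 2 := by simp
    have hc := congrArg (Nat.cast : ℕ → ℤ) (numSimConjClasses_unitary hβ k)
    have h1 := (gramSpace hβ).two_mul_numComm_isom h2 hn 1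
    have hk := (gramSpace hβ).two_mul_numComm_isom h2 hn (k + 1)
    push_cast at hc
    simp only [PolyExpr.unitaryTwo, PolyExpr.eval_mul, PolyExpr.eval_X, PolyExpr.eval_sub,
      PolyExpr.eval_add, PolyExpr.eval_pow, PolyExpr.eval_one, PolyExpr.eval_two]
    linear_combination hk + 2 * hc - (numSimConjClasses (hermitianUnitaryGroup F β) k : ℤ) * h1

theorem exists_polynomial_unitary_three {k : ℕ} (hk : k ≤ 20) :
    ∃ P : Polynomial ℕ, ∀ (F : Type u) [Field F] [Fintype F], Odd (Fintype.card F) →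
      ∀ (E : Type v) [Field E] [Algebra F E] [Finite E] [Fact (Module.finrank F E = 2)]
        (β : Matrix (Fin 3) (Fin 3) E), IsNondegHermitian F β →
          numSimConjClasses (hermitianUnitaryGroup F β) k = P.eval (Fintype.card F) := by
  obtain ⟨P, hP⟩ := PolyExpr.exists_polynomial_of_divides
    (List.all_eq_true.1 PolyExpr.divides_unitaryThree k (List.mem_range.2 (by omega)))
  refine ⟨P, fun F _ _ hF E _ _ _ _ β hβ => hP _ _ ?_ ?_⟩
  · have hq := three_le_card_of_odd hF
    simp only [PolyExpr.eval_mul, PolyExpr.eval_X, PolyExpr.eval_sub, PolyExpr.eval_add,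
      PolyExpr.eval_pow, PolyExpr.eval_one, PolyExpr.eval_six]
    generalize (Fintype.card F : ℤ) = q at *
    have h3 : 0 < q ^ 3 := by positivity
    have h4 : 0 < q ^ 2 - 1 := by nlinarith
    refine mul_ne_zero (mul_ne_zero (mul_ne_zero (mul_ne_zero (by norm_num) ?_) ?_) ?_) ?_ <;> omega
  · have h2 := two_ne_zero_of_odd_card hF
    have hn : Module.finrank E (Fin 3 → E) = 3 := by simp
    have hc := congrArg (Nat.cast : ℕ → ℤ) (numSimConjClasses_unitary hβ k)
    have h1 := (gramSpace hβ).ncard_isom hn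
    have hk := (gramSpace hβ).six_mul_numComm_isom h2 hn (k + 1) rfl
    rw [numComm_one] at hc
    push_cast at hc
    simp only [PolyExpr.unitaryThree, PolyExpr.eval_mul, PolyExpr.eval_X, PolyExpr.eval_sub,
      PolyExpr.eval_add, PolyExpr.eval_pow, PolyExpr.eval_one, PolyExpr.eval_two, PolyExpr.eval_three,
      PolyExpr.eval_six]
    linear_combination hk + 6 * hc - 6 * (numSimConjClasses (hermitianUnitaryGroup F β) k : ℤ) * h1

theorem exists_polynomial_symplectic_two {k : ℕ} (hk : k ≤ 20) :
    ∃ P : Polynomial ℕ, ∀ (F : Type u) [Field F] [Fintype F], Odd (Fintype.card F) →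
      numSimConjClasses (Matrix.symplecticGroup (Fin 1) F) k = P.eval (Fintype.card F) := by
  obtain ⟨P, hP⟩ := PolyExpr.exists_polynomial_of_divides
    (List.all_eq_true.1 PolyExpr.divides_symplecticTwo k (List.mem_range.2 (by omega)))
  refine ⟨P, fun F _ _ hF => hP _ _ ?_ ?_⟩
  · have hq := three_le_card_of_odd hF
    simp only [PolyExpr.eval_mul, PolyExpr.eval_X, PolyExpr.eval_sub, PolyExpr.eval_add,
      PolyExpr.eval_one, PolyExpr.eval_two]
    refine mul_ne_zero (mul_ne_zero (mul_ne_zero two_ne_zero ?_) ?_) ?_ <;> omega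
  · have h2 := two_ne_zero_of_odd_card hF
    have hc := congrArg (Nat.cast : ℕ → ℤ) (numSimConjClasses_symplectic (F := F) k)
    have h1 := numComm_det_eq_one h2 1
    have hk := numComm_det_eq_one h2 (k + 1)
    push_cast at hc
    simp only [PolyExpr.symplecticTwo, PolyExpr.eval_mul, PolyExpr.eval_X, PolyExpr.eval_sub,
      PolyExpr.eval_add, PolyExpr.eval_pow, PolyExpr.eval_one, PolyExpr.eval_two]
    linear_combination hk + 2 * hc
      - (numSimConjClasses (Matrix.symplecticGroup (Fin 1) F) k : ℤ) * h1

theorem finite_of_finrank_eq_two {F E : Type*} [Field F] [Finite F] [Field E] [Algebra F E]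
    (h : Module.finrank F E = 2) : Finite E := by
  have : FiniteDimensional F E := Module.finite_of_finrank_pos (by omega)
  exact Module.finite_of_finite F

theorem corollary1p4 :
    -- (1) the formula for `GL_2`, and the same formula with `q - 1` and `q + 1` swapped for `U_2`
    (∀ (k : ℕ) (F : Type u) [Field F] [Fintype F], Odd (Fintype.card F) →
      (numSimConjClasses (GL (Fin 2) F) k : ℤ) =
          gl2Formula k (Fintype.card F) (Fintype.card F - 1) (Fintype.card F + 1) ∧
      ∀ (E : Type v) [Field E] [Algebra F E], Module.finrank F E = 2 →
        ∀ β : Matrix (Fin 2) (Fin 2) E, IsNondegHermitian F β →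
          (numSimConjClasses (hermitianUnitaryGroup F β) k : ℤ) =
            gl2Formula k (Fintype.card F) (Fintype.card F + 1) (Fintype.card F - 1)) ∧
    -- (2) polynomiality with non-negative integer coefficients for `U_2`, `U_3`, `Sp_2`
    (∀ k : ℕ, k ≤ 20 →
      (∃ P : Polynomial ℕ, ∀ (F : Type u) [Field F] [Fintype F], Odd (Fintype.card F) →
        ∀ (E : Type v) [Field E] [Algebra F E], Module.finrank F E = 2 →
          ∀ β : Matrix (Fin 2) (Fin 2) E, IsNondegHermitian F β →
            numSimConjClasses (hermitianUnitaryGroup F β) k = P.eval (Fintype.card F)) ∧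
      (∃ P : Polynomial ℕ, ∀ (F : Type u) [Field F] [Fintype F], Odd (Fintype.card F) →
        ∀ (E : Type v) [Field E] [Algebra F E], Module.finrank F E = 2 →
          ∀ β : Matrix (Fin 3) (Fin 3) E, IsNondegHermitian F β →
            numSimConjClasses (hermitianUnitaryGroup F β) k = P.eval (Fintype.card F)) ∧
      (∃ P : Polynomial ℕ, ∀ (F : Type u) [Field F] [Fintype F], Odd (Fintype.card F) →
        numSimConjClasses (Matrix.symplecticGroup (Fin 1) F) k = P.eval (Fintype.card F))) := by
  refine ⟨fun k F _ _ hF => ⟨numSimConjClasses_GL_two_eq_gl2Formula hF k, ?_⟩, fun k hk => ⟨?_, ?_, ?_⟩⟩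
  · intro E _ _ hE β hβ
    have := finite_of_finrank_eq_two hE
    have : Fact (Module.finrank F E = 2) := ⟨hE⟩
    exact numSimConjClasses_unitary_two_eq_gl2Formula hF hβ k
  · obtain ⟨P, hP⟩ := exists_polynomial_unitary_two hk
    refine ⟨P, fun F _ _ hF E _ _ hE β hβ => ?_⟩
    have := finite_of_finrank_eq_two hE
    have : Fact (Module.finrank F E = 2) := ⟨hE⟩
    exact hP F hF E β hβ
  · obtain ⟨P, hP⟩ := exists_polynomial_unitary_three hk
    refine ⟨P, fun F _ _ hF E _ _ hE β hβ => ?_⟩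
    have := finite_of_finrank_eq_two hE
    have : Fact (Module.finrank F E = 2) := ⟨hE⟩
    exact hP F hF E β hβ
  · exact exists_polynomial_symplectic_two hk
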